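/- Let $0<r_i<r_e$, $\Omega=\{|\mathbf x-(r_e,0)|<r_e\}\subset\mathbb R^2\cong\mathbb C$, and let $g\in C^{1,\delta}(\partial\Omega)$ for some $\delta>1/2$ have mean zero on $\partial\Omega$. Put $$H(\mathbf x)=-\frac1\pi\int_{\partial\Omega}\ln|\mathbf x-\zeta|\,g(\zeta)\,d\sigma(\zeta)\quad(\mathbf x\in\Omega),\qquad C_1=\frac{\partial H}{\partial x_1}(0,0),\quad C_2=\frac{\partial H}{\partial x_2}(0,0),$$ where the derivatives at the boundary point $(0,0)$ are limits from inside $\Omega$ (which exist). For $0<\epsilon<r_e-r_i$ and $k>0$ set $$c_i=\frac{r_e^2-r_i^2-(r_e-r_i-\epsilon)^2}{2(r_e-r_i-\epsilon)},\quad c_e=c_i+r_e-r_i-\epsilon,\quad x_0=c_e-r_e,$$ $$\alpha=\frac{\sqrt{\epsilon(2r_i+\epsilon)(2r_e-\epsilon)(2r_e-2r_i-\epsilon)}}{2(r_e-r_i-\epsilon)},\quad \xi_i=\frac12\ln\frac{c_i+\alpha}{c_i-\alpha},\quad \xi_e=\frac12\ln\frac{c_e+\alpha}{c_e-\alpha},$$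 $$\tau=\frac{k-1}{k+1},\qquad r_*=\sqrt{\frac{2r_ir_e}{r_e-r_i}},\qquad \beta=\frac{r_*(-\ln|\tau|)}{4\sqrt\epsilon}\ (k\neq1).$$ Let $B_e$ and $B_i$ be the open disks with centres $(c_e,0)$, $(c_i,0)$ and radii $r_e$, $r_i$; thus $B_e=(x_0,0)+\Omega$, $\overline{B_i}\subset B_e$, and $\operatorname{dist}(B_i,\partial B_e)=\epsilon$. Let $u$ be a classical solution of $$\Delta u=0\ \text{ in } B_i\cup(B_e\setminus\overline{B_i}),\qquad u|_+=u|_-,\quad \frac{\partial u}{\partial\nu}\Big|_+=k\,\frac{\partial u}{\partial\nu}\Big|_-\ \text{ on }\partial B_i,\qquad \frac{\partial u}{\partial\nu}\Big|_-=g(\cdot-(x_0,0))\ \text{ on }\partial B_e$$ (that is, $u$ is continuous in $B_e$, harmonic off $\partial B_i$, $\nu$ is the outward unit normal of the respective circle, extended radially off the circle, and the normal derivatives on the circles are limits from the indicated sides, $+$ from outside and $-$ from inside the circle). Let $(\xi,\theta)$ be bipolar coordinates, $e^{\xi+\mathrm i\theta}=(\alpha+z)/(\alpha-z)$, and define $$L(z;\beta)=-\int_0^\infty\frac{z\,e^{-(\beta+1)t}}{1+z\,e^{-t}}\,dt\quad(|z|<1,\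 \beta>0),$$ $$q(z(\xi,\theta);\beta)=\begin{cases}-L(e^{-\xi-2(\xi_i-\xi_e)-\mathrm i\theta};\beta)-L(e^{\xi-2\xi_i-\mathrm i\theta};\beta)&\text{in }B_e\setminus\overline{B_i},\\[1mm]-L(e^{-\xi-2(\xi_i-\xi_e)-\mathrm i\theta};\beta)-L(e^{-\xi-\mathrm i\theta};\beta)&\text{in }\overline{B_i},\end{cases}$$ with $e^{-\xi-\mathrm i\theta}=0$ at the pole $z=\alpha$. Then there is a constant $C$, depending on $r_i,r_e,g$ but not on $\epsilon$ or $k$, such that the following hold for all $0<\epsilon<r_e-r_i$ and all such $u$. (a) If $1<k<\infty$, then $\|\nabla u\|_{L^\infty(B_e)}\le C$. (b) If $0<k<1$, then $$u=\frac{r_*^2\tau}{2}\big[C_1\,\Re\, q(\cdot;\beta)+C_2\,\Im\, q(\cdot;\beta)\big]+r\quad\text{in }B_e,$$ where $r$ is continuous in $B_e$, differentiable off $\partial B_i$, and $\|\nabla r\|_{L^\infty(B_e)}\le C$. -/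

import Mathlib

open Set Filter Topology MeasureTheory Metric
open scoped ComplexConjugate NNReal

noncomputable section

namespace Inclusion

/-! The plane is `ℂ`, with `z = x₁ + i x₂`.  Real numbers are coerced to points of the real axis. -/

/-! ### Layer potential -/

/-- Single layer potential `(1/2π) ∫_{∂B} ln|x - ζ| φ(ζ) dσ(ζ)` of the circle with centre `c` and
radius `R`, with arc length `dσ = R dt` in the parametrization `t ↦ c + R e^{it}`. -/
def singleLayer (c : ℂ) (R : ℝ) (φ : ℂ → ℝ) (x : ℂ) : ℝ :=
  1 / (2 * Real.pi) *
    ∫ t in (0 : ℝ)..(2 * Real.pi),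
      Real.log ‖x - circleMap c R t‖ * φ (circleMap c R t) * R

/-- `H = -2 S_{∂Ω}[g]` for the disk `Ω = {|z - rₑ| < rₑ}`. -/
def H (rₑ : ℝ) (g : ℂ → ℝ) (x : ℂ) : ℝ := -2 * singleLayer (rₑ : ℂ) rₑ g x

/-- `g ∈ C^{1,δ}` on the circle with centre `c` and radius `R`, in the angular parameter. -/
def HolderC1OnCircle (c : ℂ) (R : ℝ) (δ : ℝ≥0) (g : ℂ → ℝ) : Prop :=
  ContDiff ℝ 1 (fun t : ℝ => g (circleMap c R t)) ∧
    ∃ K : ℝ≥0, HolderWith K δ (deriv fun t : ℝ => g (circleMap c R t))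

/-! ### The Neumann transmission problem -/

/-- Derivative of `u` at `y` in the radial direction `(y - c)/|y - c|`, which is the outward unit
normal direction on every circle with centre `c`. -/
def normalDeriv (c : ℂ) (u : ℂ → ℝ) (y : ℂ) : ℝ :=
  fderiv ℝ u y ((‖y - c‖⁻¹ : ℝ) • (y - c))

/-- `u` is a (classical) solution of the Neumann transmission problem in the disk
`Bₑ = B(cₑ, rₑ)` with inclusion `Bᵢ = B(cᵢ, rᵢ)`: `Δu = 0` off `∂Bᵢ`, `u|₊ = u|₋` and
`∂u/∂ν|₊ = k ∂u/∂ν|₋` on `∂Bᵢ`, and `∂u/∂ν|₋ = g` on `∂Bₑ`. Boundary values are limits from the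
respective side. -/
structure IsNeumannSolution (cₑ : ℂ) (rₑ : ℝ) (cᵢ : ℂ) (rᵢ k : ℝ) (g u : ℂ → ℝ) : Prop where
  harmonic : InnerProductSpace.HarmonicOnNhd u
    (ball cᵢ rᵢ ∪ (ball cₑ rₑ \ closedBall cᵢ rᵢ))
  continuous : ContinuousOn u (ball cₑ rₑ)
  flux : ∀ x ∈ sphere cᵢ rᵢ, ∃ l : ℝ,
    Tendsto (normalDeriv cᵢ u) (𝓝[ball cᵢ rᵢ] x) (𝓝 l) ∧
    Tendsto (normalDeriv cᵢ u) (𝓝[ball cₑ rₑ \ closedBall cᵢ rᵢ] x) (𝓝 (k * l))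
  neumann : ∀ x ∈ sphere cₑ rₑ,
    Tendsto (normalDeriv cₑ u) (𝓝[ball cₑ rₑ] x) (𝓝 (g x))

/-! ### Geometric parameters -/

/-- `τ = (k - 1)/(k + 1)`. -/
def tau (k : ℝ) : ℝ := (k - 1) / (k + 1)

/-- `r_* = √(2 rᵢ rₑ / (rₑ - rᵢ))`. -/
def rStar (rᵢ rₑ : ℝ) : ℝ := Real.sqrt (2 * rᵢ * rₑ / (rₑ - rᵢ))

/-- `β = r_* (-ln|τ|) / (4 √ε)`. -/
def beta (rᵢ rₑ ε k : ℝ) : ℝ :=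
  rStar rᵢ rₑ * (-Real.log |tau k|) / (4 * Real.sqrt ε)

def cInt (rᵢ rₑ ε : ℝ) : ℝ :=
  (rₑ ^ 2 - rᵢ ^ 2 - (rₑ - rᵢ - ε) ^ 2) / (2 * (rₑ - rᵢ - ε))

def cExt (rᵢ rₑ ε : ℝ) : ℝ := cInt rᵢ rₑ ε + rₑ - rᵢ - ε

/-- The translation distance: `Bₑ = x₀ + B(rₑ, rₑ)` and `Bᵢ = x₀ + B(rᵢ + ε, rᵢ)`. -/
def xShift (rᵢ rₑ ε : ℝ) : ℝ := cExt rᵢ rₑ ε - rₑ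

theorem cExt_eq (rᵢ rₑ ε : ℝ) : cExt rᵢ rₑ ε = xShift rᵢ rₑ ε + rₑ := by
  unfold xShift; ring

theorem cInt_eq (rᵢ rₑ ε : ℝ) : cInt rᵢ rₑ ε = xShift rᵢ rₑ ε + (rᵢ + ε) := by
  unfold xShift cExt; ring

/-- The translated exterior disk. -/
def BExt (rᵢ rₑ ε : ℝ) : Set ℂ := ball (cExt rᵢ rₑ ε : ℂ) rₑ

/-- The translated inclusion. -/
def BInt (rᵢ rₑ ε : ℝ) : Set ℂ := ball (cInt rᵢ rₑ ε : ℂ) rᵢ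

/-- The bipolar poles are `± α`. -/
def alpha (rᵢ rₑ ε : ℝ) : ℝ :=
  Real.sqrt (ε * (2 * rᵢ + ε) * (2 * rₑ - ε) * (2 * rₑ - 2 * rᵢ - ε)) / (2 * (rₑ - rᵢ - ε))

/-- The circle `∂Bᵢ` is the level curve `ξ = ξᵢ`. -/
def xiInt (rᵢ rₑ ε : ℝ) : ℝ :=
  1 / 2 * Real.log ((cInt rᵢ rₑ ε + alpha rᵢ rₑ ε) / (cInt rᵢ rₑ ε - alpha rᵢ rₑ ε))

/-- The circle `∂Bₑ` is the level curve `ξ = ξₑ`. -/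
def xiExt (rᵢ rₑ ε : ℝ) : ℝ :=
  1 / 2 * Real.log ((cExt rᵢ rₑ ε + alpha rᵢ rₑ ε) / (cExt rᵢ rₑ ε - alpha rᵢ rₑ ε))

/-! ### The singular function -/

/-- The function `L(z; β) = -∫₀^∞ z e^{-(β+1)t} / (1 + z e^{-t}) dt`, for `|z| < 1` and `β > 0`. -/
def lerch (z : ℂ) (β : ℝ) : ℂ :=
  -∫ t in Ioi (0 : ℝ),
    z * Complex.exp (-(((β + 1) * t : ℝ) : ℂ)) / (1 + z * Complex.exp (-(t : ℂ)))

/-- The point with bipolar coordinates `(ξ, θ)` for the poles `± a`. -/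
def bipolar (a ξ θ : ℝ) : ℂ :=
  (a : ℂ) * (Complex.exp (ξ + Complex.I * θ) - 1) / (Complex.exp (ξ + Complex.I * θ) + 1)

/-- `e^{ξ - iθ}` as a function of the point `z` with bipolar coordinates `(ξ, θ)`; it is the complex
conjugate of `e^{ξ + iθ} = (a + z)/(a - z)`. -/
def expXiConj (a : ℝ) (z : ℂ) : ℂ := conj (((a : ℂ) + z) / ((a : ℂ) - z))

/-- `e^{-ξ - iθ}` as a function of the point `z` with bipolar coordinates `(ξ, θ)`. At the pole
`z = a` (where `ξ = ∞`) it has its limiting value `0`. -/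
def expNegXi (a : ℝ) (z : ℂ) : ℂ := ((a : ℂ) - z) / ((a : ℂ) + z)

theorem bipolar_ratio {a ξ θ : ℝ} (ha : a ≠ 0)
    (h : Complex.exp (ξ + Complex.I * θ) + 1 ≠ 0) :
    ((a : ℂ) + bipolar a ξ θ) / ((a : ℂ) - bipolar a ξ θ) = Complex.exp (ξ + Complex.I * θ) := by
  have ha' : (a : ℂ) ≠ 0 := by exact_mod_cast ha
  unfold bipolar
  set w := Complex.exp (ξ + Complex.I * θ)
  have h1 : (a : ℂ) + a * (w - 1) / (w + 1) = 2 * a * w / (w + 1) := by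
    field_simp; ring
  have h2 : (a : ℂ) - a * (w - 1) / (w + 1) = 2 * a / (w + 1) := by
    field_simp; ring
  rw [h1, h2]
  field_simp

theorem expXiConj_bipolar {a ξ θ : ℝ} (ha : a ≠ 0)
    (h : Complex.exp (ξ + Complex.I * θ) + 1 ≠ 0) :
    expXiConj a (bipolar a ξ θ) = Complex.exp (ξ - Complex.I * θ) := by
  rw [expXiConj, bipolar_ratio ha h, ← Complex.exp_conj]
  congr 1
  simp [sub_eq_add_neg]

theorem expNegXi_bipolar {a ξ θ : ℝ} (ha : a ≠ 0)
    (h : Complex.exp (ξ + Complex.I * θ) + 1 ≠ 0) :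
    expNegXi a (bipolar a ξ θ) = Complex.exp (-ξ - Complex.I * θ) := by
  rw [expNegXi, ← inv_div, bipolar_ratio ha h, ← Complex.exp_neg]
  congr 1
  ring

open Classical in
/-- The singular function `q`: at `z = z(ξ, θ)` it is
`-L(e^{-ξ-2(ξᵢ-ξₑ)-iθ}; β) - L(e^{ξ-2ξᵢ-iθ}; β)` in `Bₑ \ closure Bᵢ` and
`-L(e^{-ξ-2(ξᵢ-ξₑ)-iθ}; β) - L(e^{-ξ-iθ}; β)` in `Bᵢ`. -/
def q (rᵢ rₑ ε β : ℝ) (z : ℂ) : ℂ :=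
  let a := alpha rᵢ rₑ ε
  let ξᵢ := xiInt rᵢ rₑ ε
  let ξₑ := xiExt rᵢ rₑ ε
  if z ∈ BExt rᵢ rₑ ε \ closure (BInt rᵢ rₑ ε) then
    -lerch (Real.exp (-2 * (ξᵢ - ξₑ)) * expNegXi a z) β
      - lerch (Real.exp (-2 * ξᵢ) * expXiConj a z) β
  else
    -lerch (Real.exp (-2 * (ξᵢ - ξₑ)) * expNegXi a z) β - lerch (expNegXi a z) β

end Inclusion

end

/-! The estimates concern the complex gradient `p = ∂₁u - i ∂₂u`, which is holomorphic wherever `u`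
is harmonic. Let `Rᵢ`, `Rₑ` be the reflections in the two circles and `T = Rᵢ ∘ Rₑ`.

Unfolding. The function equal to `u` in `Bᵢ` and to `(1 - τ) u + τ u ∘ Rᵢ` outside is continuous
across `∂Bᵢ` with equal radial derivatives on both sides, so its gradient `P` extends
holomorphically to all of `Bₑ` (`exists_holomorphic_extension`,
`IsNeumannSolution.exists_holomorphic`). On `∂Bₑ` composition with `Rₑ` reverses radial derivatives,
so the Neumann datum prescribes the boundary values of `Re ((z - cₑ)(P + τ T' · P ∘ T))`. The
Schwarz formula then gives `P + τ T' · P ∘ T = (1 - τ) G`, where `G` is the translated complex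
gradient of `H` (`IsNeumannSolution.functional_equation`). Iteration gives `P = (1 - τ) ∑ (-τ)ⁿ
(Tⁿ)' · G ∘ Tⁿ`, and `G` is Lipschitz because `g` is `C^{1,δ}`.

Dynamics. `T` is a hyperbolic Möbius map with fixed points `± α`. In bipolar coordinates it is the
shift of `ξ` by `h = 2(ξᵢ - ξₑ)`, which is of order `√ε` as `ε → 0`, so `Tⁿ` is the time `n h` map
of a flow. Along orbits in the right half plane the derivative of the flow has bounded variation,
and the length of an orbit is controlled by the distance to the attracting pole. Both bounds are
uniform in `h`.

If `k > 1`, then `τ > 0`, the series alternates, and Abel summation bounds it by the supremum and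
the variation of its terms (`norm_alternating_sum_le`).

If `k < 1`, put `s = -τ > 0`; there is no cancellation. Replacing `G` by its limit `c₀` at the
boundary point `0` costs a bounded error (`norm_sub_flowSum_le_of_tendsto`). What remains is `c₀ ∑
sⁿ (Tⁿ)'`, a Riemann sum of a Laplace integral along the flow, again up to a bounded error
(`norm_flowSum_sub_le`). That integral is, up to a factor, the derivative of `L` composed with the
bipolar coordinate (`hasDerivAt_lerch_expNegXi`), so subtracting the multiple of `q` leaves a
bounded gradient. The constants are made uniform in `ε` by `exists_uniform_bounds`. -/

noncomputable section

namespace Inclusion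

/-! ### Complex gradients of real functions -/

/-- The real function `u` is differentiable at `z` with derivative `v ↦ Re (p v)`, that is,
`p = ∂₁u - i ∂₂u`. -/
def HasCGrad (u : ℂ → ℝ) (p z : ℂ) : Prop :=
  HasFDerivAt u (Complex.reCLM.comp (ContinuousLinearMap.mul ℝ ℂ p)) z

theorem HasCGrad.of_hasFDerivAt {u : ℂ → ℝ} {p z : ℂ} {L : ℂ →L[ℝ] ℝ} (h : HasFDerivAt u L z)
    (hL : ∀ v, L v = (p * v).re) : HasCGrad u p z :=
  h.congr_fderiv (ContinuousLinearMap.ext hL)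

theorem HasCGrad.fderiv_apply {u : ℂ → ℝ} {p z : ℂ} (h : HasCGrad u p z) (v : ℂ) :
    fderiv ℝ u z v = (p * v).re := by
  rw [HasFDerivAt.fderiv h]; rfl

theorem HasCGrad.congr {u v : ℂ → ℝ} {p z : ℂ} (h : HasCGrad u p z) (huv : v =ᶠ[𝓝 z] u) :
    HasCGrad v p z :=
  HasFDerivAt.congr_of_eventuallyEq h huv

theorem HasCGrad.unique {u : ℂ → ℝ} {p p' z : ℂ} (h : HasCGrad u p z) (h' : HasCGrad u p' z) :
    p = p' := by
  have e : ∀ v : ℂ, (p * v).re = (p' * v).re := fun v => by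
    rw [← h.fderiv_apply, ← h'.fderiv_apply]
  apply Complex.ext
  · simpa using e 1
  · simpa using e Complex.I

theorem HasCGrad.differentiableAt {u : ℂ → ℝ} {p z : ℂ} (h : HasCGrad u p z) :
    DifferentiableAt ℝ u z :=
  HasFDerivAt.differentiableAt h

theorem HasCGrad.add {u v : ℂ → ℝ} {p p' z : ℂ} (h : HasCGrad u p z) (h' : HasCGrad v p' z) :
    HasCGrad (fun x => u x + v x) (p + p') z := by
  exact .of_hasFDerivAt (HasFDerivAt.add h h') fun v => by simp; ring

theorem HasCGrad.const_mul {u : ℂ → ℝ} {p z : ℂ} (h : HasCGrad u p z) (a : ℝ) :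
    HasCGrad (fun x => a * u x) (a * p) z := by
  exact .of_hasFDerivAt (HasFDerivAt.const_mul h a) fun v => by simp; ring

theorem hasCGrad_re {f : ℂ → ℂ} {f' z : ℂ} (h : HasDerivAt f f' z) :
    HasCGrad (fun x => (f x).re) f' z := by
  exact .of_hasFDerivAt (Complex.reCLM.hasFDerivAt.comp z (h.hasFDerivAt.restrictScalars ℝ))
    fun v => by simp; ring

theorem HasCGrad.comp_holo {u : ℂ → ℝ} {T : ℂ → ℂ} {T' p z : ℂ} (h : HasCGrad u p (T z))
    (hT : HasDerivAt T T' z) : HasCGrad (fun x => u (T x)) (p * T') z := by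
  exact .of_hasFDerivAt (HasFDerivAt.comp z h (hT.hasFDerivAt.restrictScalars ℝ))
    fun v => by simp; ring

/-- Reflections enter in the form `conj ∘ S` with `S` holomorphic. Since `Re (p · conj w) = Re (conj
p · w)`, the composition again has a gradient of the form `v ↦ Re (p' v)`. -/
theorem HasCGrad.comp_anti {u : ℂ → ℝ} {S : ℂ → ℂ} {S' p z : ℂ} (h : HasCGrad u p (conj (S z)))
    (hS : HasDerivAt S S' z) : HasCGrad (fun x => u (conj (S x))) (conj p * S') z := by
  have h1 := HasFDerivAt.comp z (Complex.conjCLE.toContinuousLinearMap.hasFDerivAt (x := S z))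
    (hS.hasFDerivAt.restrictScalars ℝ)
  exact .of_hasFDerivAt (HasFDerivAt.comp z (f := fun x => conj (S x)) h h1)
    fun v => by simp; ring

theorem HasCGrad.norm_gradient_le {u : ℂ → ℝ} {p z : ℂ} (h : HasCGrad u p z) :
    ‖gradient u z‖ ≤ ‖p‖ := by
  rw [gradient, LinearIsometryEquiv.norm_map]
  refine ContinuousLinearMap.opNorm_le_bound _ (norm_nonneg _) fun v => ?_
  rw [h.fderiv_apply, ← norm_mul]
  exact Complex.abs_re_le_norm _

/-- This turns all normal derivatives into the quantity `Re ((y - c) p)`, the real part of a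
holomorphic function when `p` is holomorphic. -/
theorem HasCGrad.normalDeriv_eq {u : ℂ → ℝ} {p y : ℂ} (h : HasCGrad u p y) (c : ℂ) :
    normalDeriv c u y = ‖y - c‖⁻¹ * ((y - c) * p).re := by
  rw [normalDeriv, h.fderiv_apply, Complex.real_smul, ← Complex.re_ofReal_mul]
  ring_nf

theorem exists_hasCGrad_of_harmonic {u : ℂ → ℝ} {s : Set ℂ}
    (h : InnerProductSpace.HarmonicOnNhd u s) :
    DifferentiableOn ℂ (fun z ↦ (fderiv ℝ u z 1 - Complex.I * fderiv ℝ u z Complex.I : ℂ)) s ∧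
      ∀ z ∈ s, HasCGrad u (fderiv ℝ u z 1 - Complex.I * fderiv ℝ u z Complex.I) z := by
  refine ⟨fun z hz => (HarmonicAt.differentiableAt_complex_partial
    (h z hz)).differentiableWithinAt, fun z hz => ?_⟩
  have hd : DifferentiableAt ℝ u z := (h z hz).1.differentiableAt two_ne_zero
  refine .of_hasFDerivAt hd.hasFDerivAt fun v => ?_
  have hv : v = v.re • (1 : ℂ) + v.im • Complex.I := by simp
  conv_lhs => rw [hv, map_add, map_smul, map_smul]
  simp [mul_comm]

/-! ### Reflections in circles with real centre -/

/-- The conjugate of the reflection in the circle with centre `c` and radius `r`. -/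
def reflConj (c r : ℝ) (z : ℂ) : ℂ := c + r ^ 2 / (z - c)

/-- The reflection in the circle with centre `c` and radius `r`. -/
def refl (c r : ℝ) (z : ℂ) : ℂ := conj (reflConj c r z)

theorem hasDerivAt_reflConj {c r : ℝ} {z : ℂ} (hz : z ≠ c) :
    HasDerivAt (reflConj c r) (-(r ^ 2 / (z - c) ^ 2)) z := by
  have hz' : z - c ≠ 0 := sub_ne_zero.mpr hz
  have h := ((((hasDerivAt_id z).sub_const (c : ℂ)).inv hz').const_mul ((r : ℂ) ^ 2)).const_add
    (c : ℂ)
  refine (h.congr_deriv ?_).congr_of_eventuallyEq (.of_forall fun x => ?_)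
  · simp [div_eq_mul_inv]
  · simp [reflConj, div_eq_mul_inv]

theorem continuousAt_refl {c r : ℝ} {z : ℂ} (hz : z ≠ c) : ContinuousAt (refl c r) z :=
  Complex.continuous_conj.continuousAt.comp (hasDerivAt_reflConj hz).continuousAt

theorem norm_refl_sub {c r : ℝ} {z : ℂ} : ‖refl c r z - c‖ = r ^ 2 / ‖z - c‖ := by
  have : refl c r z - c = conj ((r : ℂ) ^ 2 / (z - c)) := by
    simp [refl, reflConj]
  rw [this, RCLike.norm_conj, norm_div, norm_pow, Complex.norm_real, Real.norm_eq_abs, sq_abs]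

theorem refl_of_mem_sphere {c r : ℝ} {z : ℂ} (hr : 0 < r) (hz : ‖z - c‖ = r) :
    refl c r z = z := by
  have h1 : z - c ≠ 0 := by rw [← norm_pos_iff, hz]; exact hr
  have h2 : (r : ℂ) ^ 2 = (z - c) * conj (z - c) := by
    rw [Complex.mul_conj, Complex.normSq_eq_norm_sq, hz]; push_cast; ring
  rw [refl, reflConj, h2, mul_div_cancel_left₀ _ h1]
  simp

/-- The radial derivative of a function composed with a reflection. -/
theorem radial_comp_refl {c r : ℝ} {z p : ℂ} (hz : z ≠ c) :
    ((z - c) * (conj p * (-(r ^ 2 / (z - c) ^ 2)))).re = -((refl c r z - c) * p).re := by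
  have hz' : z - c ≠ 0 := sub_ne_zero.mpr hz
  have : refl c r z - c = conj ((r : ℂ) ^ 2 / (z - c)) := by
    simp [refl, reflConj]
  rw [this, ← Complex.conj_re, ← Complex.neg_re]
  congr 1
  simp only [map_mul, map_neg, map_div₀, map_pow, Complex.conj_ofReal, map_sub, Complex.conj_conj]
  have : (conj z - c) ≠ 0 := by
    have := (map_ne_zero (starRingEnd ℂ)).mpr hz'
    simpa using this
  field_simp

/-! ### Holomorphic extension across a circle -/

/-- Clamping the radius to `[a, b]` makes the integrand jointly continuous everywhere without
changing it near `r`. -/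
theorem continuousAt_integral_circleMap {G : ℂ → ℂ} {c : ℂ} {a r b : ℝ} (ha : 0 ≤ a) (har : a < r)
    (hrb : r < b) (hG : ContinuousOn G {ζ | a ≤ ‖ζ - c‖ ∧ ‖ζ - c‖ ≤ b}) :
    ContinuousAt (fun ρ : ℝ => ∫ t in (0 : ℝ)..(2 * Real.pi), G (circleMap c ρ t)) r := by
  have hc : Continuous fun ρ : ℝ => ∫ t in (0 : ℝ)..(2 * Real.pi),
      G (circleMap c (max a (min b ρ)) t) := by
    apply intervalIntegral.continuous_parametric_intervalIntegral_of_continuous'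
    have h1 : Continuous fun x : ℝ × ℝ => circleMap c (max a (min b x.1)) x.2 := by
      unfold circleMap; fun_prop
    refine hG.comp_continuous h1 fun x => ?_
    have h0 : 0 ≤ max a (min b x.1) := ha.trans (le_max_left _ _)
    simp only [mem_ofPred_eq, circleMap_sub_center, norm_circleMap_zero, abs_of_nonneg h0]
    exact ⟨le_max_left _ _, max_le (har.le.trans hrb.le) (min_le_left _ _)⟩
  refine hc.continuousAt.congr ?_
  filter_upwards [Ioo_mem_nhds har hrb] with ρ hρ
  rw [min_eq_right hρ.2.le, max_eq_right hρ.1.le]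

/-- On the circle `p dζ = dW + i N dt` with `N = Re ((ζ - c) p)`. Integrating the part with `dW` by
parts expresses the Cauchy integral through `W` and `N` alone. In `exists_holomorphic_extension`
these two functions, unlike `p`, are known to extend continuously across the interface. -/
theorem circleIntegral_cauchy_by_parts {W : ℂ → ℝ} {p : ℂ → ℂ} {c z : ℂ} {ρ : ℝ} (hρ : 0 < ρ)
    (hz : ‖z - c‖ ≠ ρ) (hp : ContinuousOn p (sphere c ρ))
    (hW : ∀ ζ ∈ sphere c ρ, HasCGrad W (p ζ) ζ) :
    (∮ ζ in C(c, ρ), (ζ - z)⁻¹ • p ζ) = ∫ t in (0 : ℝ)..(2 * Real.pi),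
      (fun ζ : ℂ => (W ζ : ℂ) * (Complex.I * (ζ - c)) / (ζ - z) ^ 2 +
        Complex.I * (((ζ - c) * p ζ).re : ℂ) / (ζ - z)) (circleMap c ρ t) := by
  have hmem : ∀ t, circleMap c ρ t ∈ sphere c ρ := fun t => circleMap_mem_sphere c hρ.le t
  have hne : ∀ t, circleMap c ρ t - z ≠ 0 := by
    intro t h
    apply hz
    rw [← sub_eq_zero.mp h, circleMap_sub_center, norm_circleMap_zero, abs_of_pos hρ]
  have hcm : Continuous (circleMap c ρ) := continuous_circleMap c ρ
  have hpc : Continuous fun t => p (circleMap c ρ t) := hp.comp_continuous hcm hmem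
  have hWc : Continuous fun t => W (circleMap c ρ t) := by
    have : ContinuousOn W (sphere c ρ) := fun ζ hζ =>
      (hW ζ hζ).differentiableAt.continuousAt.continuousWithinAt
    exact this.comp_continuous hcm hmem
  have hinv : Continuous fun t => (circleMap c ρ t - z)⁻¹ :=
    (hcm.sub continuous_const).inv₀ hne
  have hu : ∀ t, HasDerivAt (fun t => (circleMap c ρ t - z)⁻¹)
      (-(circleMap 0 ρ t * Complex.I) / (circleMap c ρ t - z) ^ 2) t := fun t =>
    ((hasDerivAt_circleMap c ρ t).sub_const z).inv (hne t)
  have hv : ∀ t, HasDerivAt (fun t => (W (circleMap c ρ t) : ℂ))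
      (((p (circleMap c ρ t) * (circleMap 0 ρ t * Complex.I)).re : ℝ) : ℂ) t := fun t =>
    HasDerivAt.ofReal_comp
      (HasFDerivAt.comp_hasDerivAt t (hW _ (hmem t)) (hasDerivAt_circleMap c ρ t))
  have hcm0 : Continuous (circleMap 0 ρ) := continuous_circleMap 0 ρ
  have hu'c : Continuous fun t => -(circleMap 0 ρ t * Complex.I) / (circleMap c ρ t - z) ^ 2 :=
    (hcm0.mul continuous_const).neg.div ((hcm.sub continuous_const).pow 2)
      fun t => pow_ne_zero 2 (hne t)
  have hv'c : Continuous fun t =>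
      (((p (circleMap c ρ t) * (circleMap 0 ρ t * Complex.I)).re : ℝ) : ℂ) :=
    Complex.continuous_ofReal.comp (Complex.continuous_re.comp
      (hpc.mul (hcm0.mul continuous_const)))
  have parts := intervalIntegral.integral_mul_deriv_eq_deriv_mul (a := 0) (b := 2 * Real.pi)
    (fun t _ => hu t) (fun t _ => hv t) (hu'c.intervalIntegrable _ _)
    (hv'c.intervalIntegrable _ _)
  have hper : circleMap c ρ (2 * Real.pi) = circleMap c ρ 0 := by
    have := periodic_circleMap c ρ 0
    simpa using this
  rw [hper, sub_self, zero_sub, ← intervalIntegral.integral_neg] at parts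
  have hN : Continuous fun t => Complex.I * (((circleMap c ρ t - c) * p (circleMap c ρ t)).re : ℂ)
      / (circleMap c ρ t - z) :=
    (continuous_const.mul (Complex.continuous_ofReal.comp (Complex.continuous_re.comp
      ((hcm.sub continuous_const).mul hpc)))).div (hcm.sub continuous_const) hne
  have hA : Continuous fun t => (circleMap c ρ t - z)⁻¹ *
      (((p (circleMap c ρ t) * (circleMap 0 ρ t * Complex.I)).re : ℝ) : ℂ) := hinv.mul hv'c
  have hB : Continuous fun t => -(-(circleMap 0 ρ t * Complex.I) / (circleMap c ρ t - z) ^ 2 *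
      (W (circleMap c ρ t) : ℂ)) := (hu'c.mul (Complex.continuous_ofReal.comp hWc)).neg
  calc (∮ ζ in C(c, ρ), (ζ - z)⁻¹ • p ζ)
      = ∫ t in (0 : ℝ)..(2 * Real.pi), ((circleMap c ρ t - z)⁻¹ *
          (((p (circleMap c ρ t) * (circleMap 0 ρ t * Complex.I)).re : ℝ) : ℂ) +
          Complex.I * (((circleMap c ρ t - c) * p (circleMap c ρ t)).re : ℂ)
            / (circleMap c ρ t - z)) := by
        rw [circleIntegral]
        refine intervalIntegral.integral_congr fun t _ => ?_
        simp only [deriv_circleMap, smul_eq_mul, circleMap_sub_center]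
        set X := circleMap 0 ρ t
        have e : ∀ Y : ℂ, Y * Complex.I = (((Y * Complex.I).re : ℝ) : ℂ) + Complex.I * (Y.re : ℂ) := by
          intro Y
          apply Complex.ext <;> simp
        have e1 := e (X * p (circleMap c ρ t))
        rw [show p (circleMap c ρ t) * (X * Complex.I) = X * p (circleMap c ρ t) * Complex.I by ring]
        rw [div_eq_inv_mul, ← mul_add, ← e1]
        ring
    _ = _ := by
        rw [intervalIntegral.integral_add (hA.intervalIntegrable _ _) (hN.intervalIntegrable _ _),
          parts, ← intervalIntegral.integral_add (hB.intervalIntegrable _ _)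
            (hN.intervalIntegrable _ _)]
        refine intervalIntegral.integral_congr fun t _ => ?_
        simp only [circleMap_sub_center]
        ring

/-- If the radial derivatives from both sides of a circle of a continuous function agree, and the
function is harmonic off the circle, then its complex gradient is holomorphic across the circle. -/
theorem exists_holomorphic_extension {c : ℂ} {r R₀ : ℝ} (hr : 0 < r) (hrR : r < R₀) {W : ℂ → ℝ}
    {p : ℂ → ℂ} {U : Set ℂ} (hU : U = ball c r ∪ (ball c R₀ \ closedBall c r))
    (hW : ContinuousOn W (ball c R₀)) (hp : DifferentiableOn ℂ p U)
    (hWp : ∀ z ∈ U, HasCGrad W (p z) z)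
    (hN : ∀ x ∈ sphere c r, ∃ l : ℝ, Tendsto (fun z => ((z - c) * p z).re) (𝓝[U] x) (𝓝 l)) :
    ∃ P : ℂ → ℂ, DifferentiableOn ℂ P (ball c R₀) ∧ EqOn P p U := by
  have memU : ∀ z, z ∈ U ↔ ‖z - c‖ < r ∨ (r < ‖z - c‖ ∧ ‖z - c‖ < R₀) := by
    intro z
    rw [hU]
    simp only [mem_union, mem_ball, Set.mem_sdiff, mem_closedBall, dist_eq_norm, not_le]
    tauto
  have hUo : IsOpen U := by
    rw [hU]; exact isOpen_ball.union (isOpen_ball.sdiff isClosed_closedBall)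
  set N : ℂ → ℝ := fun z => ((z - c) * p z).re with hNdef
  have hNc : ContinuousOn N U :=
    Complex.continuous_re.comp_continuousOn
      ((continuousOn_id.sub continuousOn_const).mul hp.continuousOn)
  have hdense : ball c R₀ ⊆ closure U := by
    intro x hx
    by_cases hxU : x ∈ U
    · exact subset_closure hxU
    have hxr : ‖x - c‖ = r := by
      rw [memU] at hxU; push Not at hxU
      rw [mem_ball, dist_eq_norm] at hx
      by_contra hne
      rcases lt_or_gt_of_ne hne with h | h
      · exact absurd h (not_lt.mpr hxU.1)
      · exact absurd hx (not_lt.mpr (hxU.2 h))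
    have : x ∈ closure (ball c r) := by
      rw [closure_ball c hr.ne', mem_closedBall, dist_eq_norm]; exact hxr.le
    exact closure_mono (by rw [hU]; exact subset_union_left) this
  have hlim : ∀ x ∈ ball c R₀, ∃ y, Tendsto N (𝓝[U] x) (𝓝 y) := by
    intro x hx
    by_cases hxU : x ∈ U
    · exact ⟨_, hNc x hxU⟩
    · apply hN
      rw [memU] at hxU; push Not at hxU
      rw [mem_ball, dist_eq_norm] at hx
      rw [mem_sphere, dist_eq_norm]
      by_contra hne
      rcases lt_or_gt_of_ne hne with h | h
      · exact absurd h (not_lt.mpr hxU.1)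
      · exact absurd hx (not_lt.mpr (hxU.2 h))
  -- The one-sided limits agree by `hN`, so the radial component has a continuous extension across
  -- the circle.
  set N' := extendFrom U N with hN'def
  have hN'c : ContinuousOn N' (ball c R₀) := continuousOn_extendFrom hdense hlim
  have hN'eq : ∀ z ∈ U, N' z = N z := fun z hz =>
    extendFrom_eq (subset_closure hz) (hNc z hz)
  -- `Q z ρ` is the Cauchy integral of `p` over the circle of radius `ρ`, rewritten so that it makes
  -- sense and is continuous at `ρ = r`.
  set G : ℂ → ℂ → ℂ := fun z ζ => (W ζ : ℂ) * (Complex.I * (ζ - c)) / (ζ - z) ^ 2 +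
    Complex.I * (N' ζ : ℂ) / (ζ - z) with hG
  set Q : ℂ → ℝ → ℂ := fun z ρ => ∫ t in (0 : ℝ)..(2 * Real.pi), G z (circleMap c ρ t) with hQ
  have hsphereU : ∀ ρ, 0 < ρ → ρ < R₀ → ρ ≠ r → sphere c ρ ⊆ U := by
    intro ρ h0 h1 h2 ζ hζ
    rw [mem_sphere, dist_eq_norm] at hζ
    rw [memU, hζ]
    rcases lt_or_gt_of_ne h2 with h | h
    · exact Or.inl h
    · exact Or.inr ⟨h, h1⟩
  have hQeq : ∀ z ρ, 0 < ρ → ρ < R₀ → ρ ≠ r → ‖z - c‖ ≠ ρ →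
      (∮ ζ in C(c, ρ), (ζ - z)⁻¹ • p ζ) = Q z ρ := by
    intro z ρ h0 h1 h2 hz
    have hs := hsphereU ρ h0 h1 h2
    rw [circleIntegral_cauchy_by_parts h0 hz (hp.continuousOn.mono hs) fun ζ hζ => hWp ζ (hs hζ)]
    refine intervalIntegral.integral_congr fun t _ => ?_
    simp only [hG]
    rw [hN'eq _ (hs (circleMap_mem_sphere c h0.le t))]
  have hQc : ∀ z, ‖z - c‖ ≠ r → ContinuousAt (Q z) r := by
    intro z hz
    obtain ⟨a, b, ha, har, hrb, hbR, hzab⟩ : ∃ a b, 0 ≤ a ∧ a < r ∧ r < b ∧ b < R₀ ∧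
        ¬ (a ≤ ‖z - c‖ ∧ ‖z - c‖ ≤ b) := by
      rcases lt_or_gt_of_ne hz with h | h
      · exact ⟨(‖z - c‖ + r) / 2, (r + R₀) / 2, by positivity, by linarith, by linarith,
          by linarith, fun h' => by linarith [h'.1]⟩
      · refine ⟨r / 2, min ((r + R₀) / 2) ((r + ‖z - c‖) / 2), by positivity, by linarith,
          lt_min (by linarith) (by linarith), (min_le_left _ _).trans_lt (by linarith),
          fun h' => ?_⟩
        linarith [h'.2, min_le_right ((r + R₀) / 2) ((r + ‖z - c‖) / 2)]
    refine continuousAt_integral_circleMap ha har hrb ?_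
    have hsub : {ζ : ℂ | a ≤ ‖ζ - c‖ ∧ ‖ζ - c‖ ≤ b} ⊆ ball c R₀ := by
      intro ζ hζ
      rw [mem_ball, dist_eq_norm]; exact hζ.2.trans_lt hbR
    have hWc := hW.mono hsub
    have hNc' := hN'c.mono hsub
    have hne : ∀ ζ ∈ {ζ : ℂ | a ≤ ‖ζ - c‖ ∧ ‖ζ - c‖ ≤ b}, ζ - z ≠ 0 := by
      intro ζ hζ h
      rw [sub_eq_zero.mp h] at hζ
      exact hzab hζ
    refine ContinuousOn.add (ContinuousOn.div ?_ (by fun_prop) fun ζ hζ => pow_ne_zero 2 (hne ζ hζ))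
      (ContinuousOn.div ?_ (by fun_prop) hne)
    · exact (Complex.continuous_ofReal.comp_continuousOn hWc).mul (by fun_prop)
    · exact continuousOn_const.mul (Complex.continuous_ofReal.comp_continuousOn hNc')
  have hdiff : ∀ z ∈ U, DifferentiableAt ℂ p z := fun z hz => hp.differentiableAt (hUo.mem_nhds hz)
  have key : ∀ R, r < R → R < R₀ → ∀ z ∈ U, ‖z - c‖ < R →
      (∮ ζ in C(c, R), (ζ - z)⁻¹ • p ζ) = (2 * Real.pi * Complex.I) • p z := by
    intro R hR1 hR2 z hzU hzR
    have hannU : ∀ ρ, r < ρ → closedBall c R \ ball c ρ ⊆ U := by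
      intro ρ hρ ζ hζ
      rw [Set.mem_sdiff, mem_closedBall, mem_ball, dist_eq_norm, not_lt] at hζ
      exact (memU ζ).mpr (Or.inr ⟨hρ.trans_le hζ.2, hζ.1.trans_lt hR2⟩)
    have hdiskU : ∀ ρ, ρ < r → closedBall c ρ ⊆ U := by
      intro ρ hρ ζ hζ
      rw [mem_closedBall, dist_eq_norm] at hζ
      exact (memU ζ).mpr (Or.inl (hζ.trans_lt hρ))
    rcases (memU z).mp hzU with hz | ⟨hz, -⟩
    -- For `z` inside, Cauchy's formula holds on radii just below `r`. Continuity at `r` carries the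
    -- value to radii just above `r`, and deformation through the annulus carries it to `R`.
    · have hcont := hQc z hz.ne
      have h1 : Q z r = (2 * Real.pi * Complex.I) • p z := by
        refine tendsto_nhds_unique (hcont.tendsto.mono_left
          (nhdsWithin_le_nhds (s := Iio r))) ?_
        refine tendsto_const_nhds.congr' ?_
        filter_upwards [Ioo_mem_nhdsLT hz] with ρ hρ
        have h0 : 0 < ρ := (norm_nonneg _).trans_lt hρ.1
        rw [← hQeq z ρ h0 (hρ.2.trans hrR) hρ.2.ne hρ.1.ne]
        symm
        refine Complex.circleIntegral_sub_inv_smul_of_differentiable_on_off_countable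
          countable_empty (by rw [mem_ball, dist_eq_norm]; exact hρ.1)
          (hp.continuousOn.mono (hdiskU ρ hρ.2)) fun x hx => hdiff x (hdiskU ρ hρ.2 ?_)
        exact ball_subset_closedBall hx.1
      rw [← h1]
      refine tendsto_nhds_unique ?_ (hcont.tendsto.mono_left (nhdsWithin_le_nhds (s := Ioi r)))
      refine tendsto_const_nhds.congr' ?_
      filter_upwards [Ioo_mem_nhdsGT hR1] with ρ hρ
      rw [← hQeq z ρ (hr.trans hρ.1) (hρ.2.trans hR2) hρ.1.ne' (hz.trans hρ.1).ne]
      have hne : ∀ x ∈ closedBall c R \ ball c ρ, x - z ≠ 0 := by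
        intro x hx h
        rw [sub_eq_zero.mp h, Set.mem_sdiff, mem_ball, dist_eq_norm] at hx
        exact hx.2 (hz.trans hρ.1)
      refine Complex.circleIntegral_eq_of_differentiable_on_annulus_off_countable
        (hr.trans hρ.1) hρ.2.le countable_empty ?_ fun x hx => ?_
      · exact (ContinuousOn.inv₀ (by fun_prop) hne).smul (hp.continuousOn.mono (hannU ρ hρ.1))
      · have hx' : x ∈ closedBall c R \ ball c ρ :=
          ⟨ball_subset_closedBall hx.1.1, fun h => hx.1.2 (ball_subset_closedBall h)⟩
        exact (DifferentiableAt.inv (differentiableAt_id.sub_const z) (hne x hx')).smul (hdiff x (hannU ρ hρ.1 hx'))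
    -- For `z` outside, Cauchy's theorem gives `0` on radii below `r`, hence at `r`. On radii
    -- between `r` and `‖z - c‖` the integral differs from the one over `R` by the residue at `z`.
    · have hcont := hQc z hz.ne'
      have h1 : Q z r = 0 := by
        refine tendsto_nhds_unique (hcont.tendsto.mono_left
          (nhdsWithin_le_nhds (s := Iio r))) ?_
        refine tendsto_const_nhds.congr' ?_
        filter_upwards [Ioo_mem_nhdsLT hr] with ρ hρ
        rw [← hQeq z ρ hρ.1 (hρ.2.trans hrR) hρ.2.ne (hρ.2.trans hz).ne']
        symm
        have hne : ∀ x ∈ closedBall c ρ, x - z ≠ 0 := by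
          intro x hx h
          rw [sub_eq_zero.mp h, mem_closedBall, dist_eq_norm] at hx
          linarith [hρ.2]
        refine Complex.circleIntegral_eq_zero_of_differentiable_on_off_countable hρ.1.le
          countable_empty ?_ fun x hx => ?_
        · exact (ContinuousOn.inv₀ (by fun_prop) hne).smul (hp.continuousOn.mono (hdiskU ρ hρ.2))
        · have hx' := ball_subset_closedBall hx.1
          exact (DifferentiableAt.inv (differentiableAt_id.sub_const z) (hne x hx')).smul
            (hdiff x (hdiskU ρ hρ.2 hx'))
      have h2 : Tendsto (Q z) (𝓝[>] r) (𝓝 0) := by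
        rw [← h1]; exact hcont.tendsto.mono_left nhdsWithin_le_nhds
      have h3 : Tendsto (Q z) (𝓝[>] r) (𝓝 ((∮ ζ in C(c, R), (ζ - z)⁻¹ • p ζ) -
          (2 * Real.pi * Complex.I) • p z)) := by
        refine tendsto_const_nhds.congr' ?_
        filter_upwards [Ioo_mem_nhdsGT hz] with ρ hρ
        have hρ0 := hr.trans hρ.1
        rw [← hQeq z ρ hρ0 (hρ.2.trans (hzR.trans hR2)) hρ.1.ne' hρ.2.ne']
        -- The divided difference removes the singularity at `z`, so its integrals over both circles
        -- of the annulus agree.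
        have hds : ContinuousOn (dslope p z) U :=
          (continuousOn_dslope (hUo.mem_nhds hzU)).mpr ⟨hp.continuousOn, hdiff z hzU⟩
        have hds' : DifferentiableOn ℂ (dslope p z) U :=
          (Complex.differentiableOn_dslope (hUo.mem_nhds hzU)).mpr hp
        have hC := Complex.circleIntegral_eq_of_differentiable_on_annulus_off_countable
          hρ0 (hρ.2.trans hzR).le countable_empty (f := dslope p z)
          (hds.mono (hannU ρ hρ.1)) fun x hx => hds'.differentiableAt (hUo.mem_nhds
            (hannU ρ hρ.1 ⟨ball_subset_closedBall hx.1.1,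
              fun h => hx.1.2 (ball_subset_closedBall h)⟩))
        have split : ∀ σ, r < σ → σ < R₀ → ‖z - c‖ ≠ σ → (∮ ζ in C(c, σ), dslope p z ζ) =
            (∮ ζ in C(c, σ), (ζ - z)⁻¹ • p ζ) - (∮ ζ in C(c, σ), (ζ - z)⁻¹) * p z := by
          intro σ hσ1 hσ2 hσz
          have hσ0 := hr.trans hσ1
          have hsne : ∀ x ∈ sphere c σ, x - z ≠ 0 := by
            intro x hx h
            rw [sub_eq_zero.mp h, mem_sphere, dist_eq_norm] at hx
            exact hσz hx
          have hsU := hsphereU σ hσ0 hσ2 hσ1.ne'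
          have hinv : ContinuousOn (fun ζ : ℂ => (ζ - z)⁻¹) (sphere c σ) :=
            ContinuousOn.inv₀ (by fun_prop) hsne
          rw [mul_comm, ← circleIntegral.integral_const_mul, ← circleIntegral.integral_sub]
          · refine circleIntegral.integral_congr hσ0.le fun x hx => ?_
            simp only [smul_eq_mul]
            rw [dslope_of_ne _ (sub_ne_zero.mp (hsne x hx)), slope_def_field]
            ring
          · exact (hinv.smul (hp.continuousOn.mono hsU)).circleIntegrable hσ0.le
          · exact (continuousOn_const.mul hinv).circleIntegrable hσ0.le
        rw [split R hR1 hR2 hzR.ne, split ρ hρ.1 (hρ.2.trans (hzR.trans hR2)) hρ.2.ne',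
          circleIntegral.integral_sub_inv_of_mem_ball (by rwa [mem_ball, dist_eq_norm]),
          Complex.circleIntegral_eq_zero_of_differentiable_on_off_countable (c := c) (R := ρ)
            (f := fun ζ => (ζ - z)⁻¹) hρ0.le countable_empty, zero_mul, sub_zero] at hC
        · rw [smul_eq_mul, hC]
        · refine ContinuousOn.inv₀ (by fun_prop) fun x hx h => ?_
          rw [sub_eq_zero.mp h, mem_closedBall, dist_eq_norm] at hx
          linarith [hρ.2]
        · intro x hx
          refine DifferentiableAt.inv (differentiableAt_id.sub_const z) fun h => ?_
          rw [sub_eq_zero.mp h, Set.mem_sdiff, mem_ball, dist_eq_norm] at hx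
          linarith [hρ.2, hx.1]
      exact sub_eq_zero.mp (tendsto_nhds_unique h3 h2)
  -- Any radius strictly between `r` and `R₀` serves: the Cauchy integral over it is the extension
  -- inside, and `p` itself is used outside.
  set R := (r + R₀) / 2 with hRdef
  have hR1 : r < R := by rw [hRdef]; linarith
  have hR2 : R < R₀ := by rw [hRdef]; linarith
  have hR0 : 0 < R := hr.trans hR1
  set Cint : ℂ → ℂ := fun w => (2 * Real.pi * Complex.I)⁻¹ • ∮ ζ in C(c, R), (ζ - w)⁻¹ • p ζ
    with hCint
  have hCd : DifferentiableOn ℂ Cint (ball c R) := by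
    have hco : (R.toNNReal : ℝ) = R := Real.coe_toNNReal R hR0.le
    have hci : CircleIntegrable p c R :=
      (hp.continuousOn.mono (hsphereU R hR0 hR2 hR1.ne')).circleIntegrable hR0.le
    rw [← hco] at hci
    have := (hasFPowerSeriesOn_cauchy_integral hci (Real.toNNReal_pos.mpr hR0)).differentiableOn
    rwa [Metric.eball_coe, hco] at this
  have hCeq : ∀ z ∈ U, ‖z - c‖ < R → Cint z = p z := by
    intro z hz hzR
    simp only [hCint]
    rw [key R hR1 hR2 z hz hzR, smul_smul, inv_mul_cancel₀ Complex.two_pi_I_ne_zero, one_smul]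
  classical
  refine ⟨fun z => if ‖z - c‖ < R then Cint z else p z, fun z hz => ?_, fun z hz => ?_⟩
  · apply DifferentiableAt.differentiableWithinAt
    by_cases h : ‖z - c‖ < R
    · have hb : z ∈ ball c R := by rwa [mem_ball, dist_eq_norm]
      refine (hCd.differentiableAt (isOpen_ball.mem_nhds hb)).congr_of_eventuallyEq ?_
      filter_upwards [isOpen_ball.mem_nhds hb] with y hy
      rw [mem_ball, dist_eq_norm] at hy
      exact if_pos hy
    · have hzU : z ∈ U := (memU z).mpr (Or.inr ⟨hR1.trans_le (not_lt.mp h),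
        by rwa [mem_ball, dist_eq_norm] at hz⟩)
      refine (hdiff z hzU).congr_of_eventuallyEq ?_
      filter_upwards [hUo.mem_nhds hzU] with y hy
      by_cases hyR : ‖y - c‖ < R
      · simp only [if_pos hyR]; exact hCeq y hy hyR
      · simp only [if_neg hyR]
  · by_cases h : ‖z - c‖ < R
    · simp only [if_pos h]; exact hCeq z hz h
    · simp only [if_neg h]

/-! ### Cauchy type integrals over a circle -/

theorem hasDerivAt_integral_of_continuousOn {U : Set ℂ} (hU : IsOpen U) {F F' : ℂ → ℝ → ℂ}
    {a b : ℝ} {x : ℂ} (hx : x ∈ U)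
    (hF : ContinuousOn (Function.uncurry F) (U ×ˢ univ))
    (hF' : ContinuousOn (Function.uncurry F') (U ×ˢ univ))
    (hd : ∀ y ∈ U, ∀ t, HasDerivAt (fun y => F y t) (F' y t) y) :
    HasDerivAt (fun y => ∫ t in a..b, F y t) (∫ t in a..b, F' x t) x := by
  obtain ⟨ε, hε, hεU⟩ := Metric.nhds_basis_closedBall.mem_iff.mp (hU.mem_nhds hx)
  obtain ⟨C, hC⟩ := ((isCompact_closedBall x ε).prod (isCompact_uIcc (a := a) (b := b))
    ).exists_bound_of_continuousOn (hF'.mono (prod_mono hεU (subset_univ _)))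
  have slice : ∀ {G : ℂ → ℝ → ℂ}, ContinuousOn (Function.uncurry G) (U ×ˢ univ) → ∀ y ∈ U,
      Continuous (G y) := fun {G} hG y hy =>
    hG.comp_continuous (f := fun t : ℝ => (y, t)) (by fun_prop) fun t => ⟨hy, mem_univ _⟩
  refine (intervalIntegral.hasDerivAt_integral_of_dominated_loc_of_deriv_le
    (bound := fun _ => C) (s := closedBall x ε) (closedBall_mem_nhds x hε) ?_ ?_ ?_ ?_ ?_ ?_).2
  · filter_upwards [hU.mem_nhds hx] with y hy
    exact (slice hF y hy).aestronglyMeasurable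
  · exact (slice hF x hx).intervalIntegrable _ _
  · exact (slice hF' x hx).aestronglyMeasurable
  · exact .of_forall fun t ht y hy => hC (y, t) ⟨hy, uIoc_subset_uIcc ht⟩
  · exact intervalIntegrable_const
  · exact .of_forall fun t _ y hy => hd y (hεU hy) t

/-- The Cauchy type integral `∫₀^{2π} φ(t) / (c + R e^{it} - x) dt`. -/
def cauchyCircle (c : ℂ) (R : ℝ) (φ : ℝ → ℂ) (x : ℂ) : ℂ :=
  ∫ t in (0 : ℝ)..(2 * Real.pi), φ t / (circleMap c R t - x)

theorem circleMap_sub_ne_zero {c x : ℂ} {R : ℝ} (hx : x ∈ ball c R) (t : ℝ) :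
    circleMap c R t - x ≠ 0 := by
  intro h
  rw [mem_ball, dist_eq_norm, ← sub_eq_zero.mp h, circleMap_sub_center, norm_circleMap_zero] at hx
  exact absurd hx (not_lt.mpr (le_abs_self R))

theorem hasDerivAt_cauchyCircle {c x : ℂ} {R : ℝ} {φ : ℝ → ℂ} (hφ : Continuous φ)
    (hx : x ∈ ball c R) :
    HasDerivAt (cauchyCircle c R φ)
      (∫ t in (0 : ℝ)..(2 * Real.pi), φ t / (circleMap c R t - x) ^ 2) x := by
  have hc : Continuous fun y : ℂ × ℝ => circleMap c R y.2 - y.1 := by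
    unfold circleMap; fun_prop
  have hne : ∀ y ∈ ball c R ×ˢ (univ : Set ℝ), circleMap c R y.2 - y.1 ≠ 0 := fun y hy =>
    circleMap_sub_ne_zero hy.1 _
  refine hasDerivAt_integral_of_continuousOn isOpen_ball hx
    (F := fun y t => φ t / (circleMap c R t - y))
    (F' := fun y t => φ t / (circleMap c R t - y) ^ 2) ?_ ?_ ?_
  · exact ContinuousOn.div (by fun_prop) hc.continuousOn hne
  · exact ContinuousOn.div (by fun_prop) (hc.pow 2).continuousOn fun y hy => pow_ne_zero 2 (hne y hy)
  · intro y hy t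
    have h := ((((hasDerivAt_id y).const_sub (circleMap c R t)).inv
      (circleMap_sub_ne_zero hy t)).const_mul (φ t))
    refine (h.congr_deriv ?_).congr_of_eventuallyEq (.of_forall fun x => ?_)
    · simp [div_eq_mul_inv]
    · simp [div_eq_mul_inv]

/-- The kernel `(ζ - x)⁻²` is a tangential derivative of `(ζ - x)⁻¹`, up to the factor `i R e^{it}`.
Integration by parts moves it to the density, so a Cauchy integral has as derivative a Cauchy
integral of the density `(φ' - iφ) e^{-it}`. -/
theorem integral_div_sq_eq {c x : ℂ} {R : ℝ} (hR : 0 < R) {φ φ' : ℝ → ℂ}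
    (hφ : ∀ t, HasDerivAt φ (φ' t) t) (hφ' : Continuous φ') (hper : φ 0 = φ (2 * Real.pi))
    (hx : x ∈ ball c R) :
    (∫ t in (0 : ℝ)..(2 * Real.pi), φ t / (circleMap c R t - x) ^ 2) =
      -(Complex.I / R) * ∫ t in (0 : ℝ)..(2 * Real.pi),
        (φ' t - Complex.I * φ t) * Complex.exp (-(t * Complex.I)) / (circleMap c R t - x) := by
  have hne := circleMap_sub_ne_zero hx
  have hR' : (R : ℂ) ≠ 0 := by exact_mod_cast hR.ne'
  have hφc : Continuous φ := continuous_iff_continuousAt.mpr fun t => (hφ t).continuousAt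
  have hcm : Continuous (circleMap c R) := continuous_circleMap c R
  have he : ∀ t : ℝ, HasDerivAt (fun t : ℝ => Complex.exp (-(t * Complex.I)))
      (Complex.exp (-(t * Complex.I)) * -Complex.I) t := by
    intro t
    have h1 : HasDerivAt (fun t : ℝ => -((t : ℂ) * Complex.I)) (-(1 * Complex.I)) t :=
      ((hasDerivAt_id t).ofReal_comp.mul_const Complex.I).neg
    simpa using h1.cexp
  have hu : ∀ t, HasDerivAt (fun t : ℝ => φ t * Complex.exp (-(t * Complex.I)))
      ((φ' t - Complex.I * φ t) * Complex.exp (-(t * Complex.I))) t := fun t =>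
    ((hφ t).mul (he t)).congr_deriv (by ring)
  have hv : ∀ t, HasDerivAt (fun t => (circleMap c R t - x)⁻¹)
      (-(circleMap 0 R t * Complex.I) / (circleMap c R t - x) ^ 2) t := fun t =>
    ((hasDerivAt_circleMap c R t).sub_const x).inv (hne t)
  have hu'c : Continuous fun t : ℝ =>
      (φ' t - Complex.I * φ t) * Complex.exp (-(t * Complex.I)) := by fun_prop
  have hv'c : Continuous fun t => -(circleMap 0 R t * Complex.I) / (circleMap c R t - x) ^ 2 :=
    (((continuous_circleMap 0 R).mul continuous_const).neg).div
      ((hcm.sub continuous_const).pow 2) fun t => pow_ne_zero 2 (hne t)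
  have parts := intervalIntegral.integral_mul_deriv_eq_deriv_mul (a := 0) (b := 2 * Real.pi)
    (fun t _ => hu t) (fun t _ => hv t) (hu'c.intervalIntegrable _ _)
    (hv'c.intervalIntegrable _ _)
  have hb : φ (2 * Real.pi) * Complex.exp (-((2 * Real.pi : ℝ) * Complex.I)) *
      (circleMap c R (2 * Real.pi) - x)⁻¹ -
      φ 0 * Complex.exp (-((0 : ℝ) * Complex.I)) * (circleMap c R 0 - x)⁻¹ = 0 := by
    have h1 : circleMap c R (2 * Real.pi) = circleMap c R 0 := by
      simpa using periodic_circleMap c R 0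
    have h2 : Complex.exp (-((2 * Real.pi : ℝ) * Complex.I)) = 1 := by
      rw [Complex.exp_neg]; push_cast; rw [Complex.exp_two_pi_mul_I, inv_one]
    rw [h1, h2, hper]; simp
  rw [hb, zero_sub] at parts
  rw [neg_mul, ← mul_neg]
  have e2 : -(∫ t in (0 : ℝ)..(2 * Real.pi),
        (φ' t - Complex.I * φ t) * Complex.exp (-(t * Complex.I)) / (circleMap c R t - x)) =
      ∫ t in (0 : ℝ)..(2 * Real.pi), φ t * Complex.exp (-(t * Complex.I)) *
        (-(circleMap 0 R t * Complex.I) / (circleMap c R t - x) ^ 2) := by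
    rw [parts]; simp only [div_eq_mul_inv]
  rw [e2, ← intervalIntegral.integral_const_mul]
  refine intervalIntegral.integral_congr fun t _ => ?_
  simp only [circleMap_zero]
  have h3 : Complex.exp (-(t * Complex.I)) * Complex.exp (t * Complex.I) = 1 := by
    rw [← Complex.exp_add]; simp
  have h4 : Complex.I / R * (φ t * Complex.exp (-(t * Complex.I)) *
        (-((R : ℂ) * Complex.exp (t * Complex.I) * Complex.I) / (circleMap c R t - x) ^ 2)) =
      -(Complex.I * Complex.I) * ((R : ℂ) * (R : ℂ)⁻¹) *
        (Complex.exp (-(t * Complex.I)) * Complex.exp (t * Complex.I)) *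
        (φ t / (circleMap c R t - x) ^ 2) := by ring
  rw [h4, h3, Complex.I_mul_I, mul_inv_cancel₀ hR']; ring

/-- The conjugate integrand is, up to a constant, `ζ / (R - conj y · ζ) dζ` on the unit circle,
holomorphic in the closed disk. The lemma allows a constant to be subtracted from the factor
multiplying `e^{-it}` in a density. -/
theorem integral_exp_neg_div_circleMap_sub {c x : ℂ} {R : ℝ} (hR : 0 < R) (hx : x ∈ ball c R) :
    (∫ t in (0 : ℝ)..(2 * Real.pi),
      Complex.exp (-(t * Complex.I)) / (circleMap c R t - x)) = 0 := by
  set y := x - c with hy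
  have hyR : ‖y‖ < R := by rwa [mem_ball, dist_eq_norm] at hx
  have hden : ∀ ζ ∈ closedBall (0 : ℂ) 1, (R : ℂ) - conj y * ζ ≠ 0 := by
    intro ζ hζ h
    rw [mem_closedBall_zero_iff] at hζ
    have : ‖(R : ℂ)‖ = ‖conj y * ζ‖ := by rw [sub_eq_zero.mp h]
    rw [norm_mul, RCLike.norm_conj, Complex.norm_real, Real.norm_of_nonneg hR.le] at this
    nlinarith [norm_nonneg y, norm_nonneg ζ]
  have hz : (∮ ζ in C(0, 1), ζ / ((R : ℂ) - conj y * ζ)) = 0 := by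
    refine Complex.circleIntegral_eq_zero_of_differentiable_on_off_countable zero_le_one
      countable_empty ?_ fun ζ hζ => ?_
    · exact ContinuousOn.div (by fun_prop) (by fun_prop) hden
    · exact DifferentiableAt.div (by fun_prop) (by fun_prop) (hden ζ (ball_subset_closedBall hζ.1))
  rw [circleIntegral] at hz
  have hI : (∫ t in (0 : ℝ)..(2 * Real.pi),
      conj (Complex.exp (-(t * Complex.I)) / (circleMap c R t - x))) = 0 := by
    rw [← mul_right_inj' Complex.I_ne_zero, mul_zero, ← hz,
      ← intervalIntegral.integral_const_mul]
    refine intervalIntegral.integral_congr fun t _ => ?_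
    simp only [deriv_circleMap, circleMap_zero, Complex.ofReal_one, one_mul, smul_eq_mul, map_div₀,
      ← Complex.exp_conj, map_neg, map_mul, Complex.conj_ofReal, Complex.conj_I, mul_neg, neg_neg,
      map_sub]
    have h1 : conj (circleMap c R t) - conj x = (R : ℂ) * Complex.exp (-(t * Complex.I)) - conj y := by
      rw [hy, circleMap]
      simp only [map_add, map_mul, Complex.conj_ofReal, ← Complex.exp_conj, Complex.conj_I, map_sub,
        mul_neg]
      ring
    rw [h1]
    have hE : Complex.exp (-(t * Complex.I)) = (Complex.exp (t * Complex.I))⁻¹ := Complex.exp_neg _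
    have hE0 : Complex.exp (t * Complex.I) ≠ 0 := Complex.exp_ne_zero _
    have h2 := hden (Complex.exp (t * Complex.I)) (by
      rw [mem_closedBall_zero_iff, Complex.norm_exp_ofReal_mul_I])
    rw [hE]
    have h3 : (R : ℂ) * (Complex.exp (t * Complex.I))⁻¹ - conj y ≠ 0 := by
      intro h; apply h2
      have h' : Complex.exp (t * Complex.I) * ((R : ℂ) * (Complex.exp (t * Complex.I))⁻¹ - conj y)
          = 0 := by rw [h, mul_zero]
      rw [mul_sub, mul_left_comm, mul_inv_cancel₀ hE0, mul_one] at h'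
      rw [mul_comm]; exact h'
    field_simp
  have h0 : conj (∫ t in (0 : ℝ)..(2 * Real.pi),
      Complex.exp (-(t * Complex.I)) / (circleMap c R t - x)) = 0 := by
    rw [← hI, intervalIntegral.integral_of_le Real.two_pi_pos.le,
      intervalIntegral.integral_of_le Real.two_pi_pos.le, integral_conj]
  exact (map_eq_zero _).mp h0

/-- After rotation, `|X - R| ≤ |X - ρ| + (R - ρ) ≤ 2 |X - ρ|` for `|X| = R`. So the distance to the
inner point is at least half a chord, which Jordan's inequality bounds below. -/
theorem le_norm_circleMap_sub {c : ℂ} {R ρ s t : ℝ} (hρ : 0 ≤ ρ) (hρR : ρ ≤ R)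
    (hts : |t - s| ≤ Real.pi) :
    R * |t - s| / Real.pi ≤ ‖circleMap c R t - circleMap c ρ s‖ := by
  set u := t - s with hu
  have e1 : circleMap c R t - circleMap c ρ s =
      Complex.exp (s * Complex.I) * (R * Complex.exp (Complex.I * u) - ρ) := by
    rw [circleMap, circleMap, hu, mul_sub, ← mul_assoc, mul_comm (Complex.exp _) (R : ℂ),
      mul_assoc, ← Complex.exp_add]
    push_cast; ring_nf
  rw [e1, norm_mul, Complex.norm_exp_ofReal_mul_I, one_mul]
  set X := (R : ℂ) * Complex.exp (Complex.I * u) with hX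
  have hXn : ‖X‖ = R := by
    rw [hX, norm_mul, mul_comm Complex.I, Complex.norm_exp_ofReal_mul_I, mul_one, Complex.norm_real,
      Real.norm_of_nonneg (hρ.trans hρR)]
  have h1 : R - ρ ≤ ‖X - ρ‖ := by
    have := norm_sub_norm_le X (ρ : ℂ)
    rwa [hXn, Complex.norm_real, Real.norm_of_nonneg hρ] at this
  have h2 : ‖X - R‖ ≤ ‖X - ρ‖ + (R - ρ) := by
    have : ‖((ρ - R : ℝ) : ℂ)‖ = R - ρ := by
      rw [Complex.norm_real, Real.norm_eq_abs, abs_sub_comm, abs_of_nonneg (by linarith)]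
    rw [← this]
    refine le_trans (le_of_eq ?_) (norm_add_le _ _)
    push_cast; ring_nf
  have h3 : ‖X - R‖ = R * (2 * |Real.sin (u / 2)|) := by
    have : X - R = R * (Complex.exp (Complex.I * u) - 1) := by rw [hX]; ring
    rw [this, norm_mul, Complex.norm_exp_I_mul_ofReal_sub_one, Complex.norm_real,
      Real.norm_of_nonneg (hρ.trans hρR), norm_mul, Real.norm_eq_abs, Real.norm_eq_abs]
    norm_num
  have h4 : 2 / Real.pi * (|u| / 2) ≤ |Real.sin (u / 2)| := by
    have h5 : |Real.sin (u / 2)| = Real.sin (|u| / 2) := by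
      rcases abs_cases u with ⟨h, h'⟩ | ⟨h, h'⟩
      · rw [h]
        refine abs_of_nonneg (Real.sin_nonneg_of_nonneg_of_le_pi (by linarith) ?_)
        linarith [Real.pi_pos]
      · rw [h, neg_div, Real.sin_neg]
        refine abs_of_nonpos (Real.sin_nonpos_of_nonpos_of_neg_pi_le (by linarith) ?_)
        linarith [Real.pi_pos]
    rw [h5]
    exact Real.mul_le_sin (by positivity) (by linarith)
  have hR0 : 0 ≤ R := hρ.trans hρR
  have h6 : R * |u| / Real.pi = R * (2 / Real.pi * (|u| / 2)) := by ring
  rw [h6]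
  nlinarith [mul_le_mul_of_nonneg_left h4 hR0]

/-- The Cauchy type integral of a Hölder continuous density is bounded. -/
theorem exists_bound_cauchyCircle_exp {c : ℂ} {R : ℝ} (hR : 0 < R) {k : ℝ → ℂ}
    (hk : Continuous k) (hper : Function.Periodic k (2 * Real.pi)) {δ K M : ℝ} (hδ : 0 < δ)
    (hK : 0 ≤ K) (hM : 0 ≤ M)
    (hH : ∀ s t, ‖k t - k s‖ ≤ K * |t - s| ^ δ + M * |t - s|) :
    ∃ C : ℝ, ∀ x ∈ ball c R,
      ‖∫ t in (0 : ℝ)..(2 * Real.pi),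
        k t * Complex.exp (-(t * Complex.I)) / (circleMap c R t - x)‖ ≤ C := by
  -- The Hölder modulus divided by the lower bound `R|u|/π` for the distance; `|u|^(δ-1)` is
  -- integrable as `δ > 0`.
  set b : ℝ → ℝ := fun u => Real.pi / R * (K * |u| ^ (δ - 1) + M) with hb
  have hrp : IntervalIntegrable (fun u : ℝ => |u| ^ (δ - 1)) volume (-Real.pi) Real.pi := by
    have h1 : IntervalIntegrable (fun u : ℝ => |u| ^ (δ - 1)) volume 0 Real.pi := by
      refine (intervalIntegral.intervalIntegrable_rpow' (by linarith : -1 < δ - 1)).congr ?_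
      intro u hu
      rw [uIoc_of_le Real.pi_pos.le] at hu
      simp only [abs_of_pos hu.1]
    have h2 := (IntervalIntegrable.comp_sub_left h1 0)
    simp only [zero_sub, abs_neg, neg_zero] at h2
    simpa using h2.symm.trans h1
  have hbi : IntervalIntegrable b volume (-Real.pi) Real.pi :=
    ((hrp.const_mul K).add intervalIntegrable_const).const_mul _
  refine ⟨∫ u in (-Real.pi)..Real.pi, b u, fun x hx => ?_⟩
  set ρ := ‖x - c‖ with hρ
  have hρR : ρ < R := by rwa [mem_ball, dist_eq_norm] at hx
  set s := Complex.arg (x - c) with hs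
  have hxs : x = circleMap c ρ s := by
    rw [circleMap, hρ, hs, Complex.norm_mul_exp_arg_mul_I]; ring
  have hne := circleMap_sub_ne_zero hx
  have hcm : Continuous (circleMap c R) := continuous_circleMap c R
  have hexp : Function.Periodic (fun t : ℝ => Complex.exp (-(t * Complex.I))) (2 * Real.pi) := by
    intro t
    have : -(((t + 2 * Real.pi : ℝ) : ℂ) * Complex.I) =
        -(t * Complex.I) - 2 * Real.pi * Complex.I := by push_cast; ring
    simp only [this, Complex.exp_sub, Complex.exp_two_pi_mul_I, div_one]
  have hp1 : Function.Periodic (fun t : ℝ =>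
      k t * Complex.exp (-(t * Complex.I)) / (circleMap c R t - x)) (2 * Real.pi) := by
    intro t
    have h1 := hexp t
    simp only at h1 ⊢
    rw [hper t, h1, periodic_circleMap c R t]
  have hp2 : Function.Periodic (fun t : ℝ =>
      Complex.exp (-(t * Complex.I)) / (circleMap c R t - x)) (2 * Real.pi) := by
    intro t
    have h1 := hexp t
    simp only at h1 ⊢
    rw [h1, periodic_circleMap c R t]
  have e0 := integral_exp_neg_div_circleMap_sub hR hx
  -- By periodicity the interval is centred at the argument `s` of `x - c`, so that `|t - s| ≤ π`;
  -- then `k s` is subtracted.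
  have q1 := hp1.intervalIntegral_add_eq 0 (s - Real.pi)
  have q2 := hp2.intervalIntegral_add_eq 0 (s - Real.pi)
  rw [zero_add] at q1 q2
  rw [q1]
  rw [q2] at e0
  have hend : s - Real.pi + 2 * Real.pi = s + Real.pi := by ring
  rw [hend] at e0 ⊢
  have c1 : Continuous fun t : ℝ => k t * Complex.exp (-(t * Complex.I)) / (circleMap c R t - x) :=
    Continuous.div (by fun_prop) (by fun_prop) hne
  have c2 : Continuous fun t : ℝ => Complex.exp (-(t * Complex.I)) / (circleMap c R t - x) :=
    Continuous.div (by fun_prop) (by fun_prop) hne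
  have e1 : (∫ t in (s - Real.pi)..(s + Real.pi),
      k t * Complex.exp (-(t * Complex.I)) / (circleMap c R t - x)) =
      ∫ t in (s - Real.pi)..(s + Real.pi),
        (k t - k s) * (Complex.exp (-(t * Complex.I)) / (circleMap c R t - x)) := by
    have h1 := intervalIntegral.integral_sub (c1.intervalIntegrable (μ := volume) (s - Real.pi)
      (s + Real.pi)) ((c2.const_mul (k s)).intervalIntegrable _ _)
    rw [intervalIntegral.integral_const_mul, e0, mul_zero, sub_zero] at h1
    rw [← h1]
    refine intervalIntegral.integral_congr fun t _ => ?_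
    ring
  rw [e1]
  have hbs : IntervalIntegrable (fun t => b (t - s)) volume (s - Real.pi) (s + Real.pi) := by
    have := hbi.comp_sub_right s
    rwa [show -Real.pi + s = s - Real.pi by ring, show Real.pi + s = s + Real.pi by ring] at this
  have e2 : ∫ t in (s - Real.pi)..(s + Real.pi), b (t - s) = ∫ u in (-Real.pi)..Real.pi, b u := by
    rw [intervalIntegral.integral_comp_sub_right b s]
    congr 1 <;> ring
  rw [← e2]
  refine intervalIntegral.norm_integral_le_of_norm_le (by linarith [Real.pi_pos]) ?_ hbs
  refine .of_forall fun t ht => ?_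
  have hts : |t - s| ≤ Real.pi := by
    rw [abs_le]; constructor <;> linarith [ht.1, ht.2]
  rw [norm_mul, norm_div]
  have hen : ‖Complex.exp (-(t * Complex.I))‖ = 1 := by
    rw [← neg_mul, ← Complex.ofReal_neg, Complex.norm_exp_ofReal_mul_I]
  rw [hen]
  rcases eq_or_ne t s with hts' | hne'
  · have hb0 : 0 ≤ b (t - s) := by
      have := Real.pi_pos
      simp only [hb]
      positivity
    simpa [hts'] using hb0
  · have hpos : 0 < |t - s| := abs_pos.mpr (sub_ne_zero.mpr hne')
    have hlow := le_norm_circleMap_sub (c := c) (s := s) (norm_nonneg (x - c)) hρR.le hts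
    rw [← hρ, ← hxs] at hlow
    have hlow0 : 0 < R * |t - s| / Real.pi := by have := Real.pi_pos; positivity
    calc ‖k t - k s‖ * (1 / ‖circleMap c R t - x‖)
        ≤ (K * |t - s| ^ δ + M * |t - s|) * (1 / (R * |t - s| / Real.pi)) :=
          mul_le_mul (hH s t) (one_div_le_one_div_of_le hlow0 hlow) (by positivity)
            ((norm_nonneg _).trans (hH s t))
      _ = b (t - s) := by
          simp only [hb]; rw [Real.rpow_sub_one hpos.ne']
          have := Real.pi_pos
          field_simp

/-- The complex gradient of `H`. -/
def layerGrad (R : ℝ) (g : ℂ → ℝ) (x : ℂ) : ℂ :=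
  R / Real.pi * cauchyCircle (R : ℂ) R (fun t => (g (circleMap R R t) : ℂ)) x

theorem exists_bound_of_periodic {f : ℝ → ℝ} {T : ℝ} (hT : 0 < T) (hf : Continuous f)
    (hper : Function.Periodic f T) : ∃ C : ℝ, 0 ≤ C ∧ ∀ t, ‖f t‖ ≤ C := by
  obtain ⟨C, hC⟩ := (isCompact_Icc (a := 0) (b := T)).exists_bound_of_continuousOn hf.continuousOn
  have h0 : ∀ t, ‖f t‖ ≤ C := fun t => by
    obtain ⟨y, hy, hty⟩ := hper.exists_mem_Ico₀ hT t
    rw [hty]; exact hC y (Ico_subset_Icc_self hy)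
  exact ⟨C, (norm_nonneg _).trans (h0 0), h0⟩

/-- The derivative is a Cauchy integral whose density involves `g` and its tangential derivative. It
is Hölder continuous up to a Lipschitz term, so the integral is bounded on the disk, which is
convex. -/
theorem exists_lipschitz_layerGrad {R : ℝ} (hR : 0 < R) {δ : ℝ≥0} (hδ : 0 < δ) {g : ℂ → ℝ}
    (hg : HolderC1OnCircle (R : ℂ) R δ g) :
    ∃ K : ℝ≥0, LipschitzOnWith K (layerGrad R g) (ball (R : ℂ) R) := by
  obtain ⟨hC1, K, hK⟩ := hg
  set f : ℝ → ℝ := fun t => g (circleMap (R : ℂ) R t) with hf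
  have hfd : ∀ t, HasDerivAt f (deriv f t) t := fun t =>
    (hC1.differentiable one_ne_zero t).hasDerivAt
  have hf'c : Continuous (deriv f) := hC1.continuous_deriv le_rfl
  have hfper : Function.Periodic f (2 * Real.pi) := fun t => by
    simp only [hf, periodic_circleMap (R : ℂ) R t]
  have hf'per : Function.Periodic (deriv f) (2 * Real.pi) := fun t => by
    rw [← deriv_comp_add_const]
    congr 1
    exact funext hfper
  obtain ⟨M, hM0, hM⟩ := exists_bound_of_periodic Real.two_pi_pos hf'c hf'per
  have hlip : ∀ s t, ‖f t - f s‖ ≤ M * |t - s| := fun s t =>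
    Convex.norm_image_sub_le_of_norm_hasDerivWithin_le (s := univ)
      (fun x _ => (hfd x).hasDerivWithinAt) (fun x _ => hM x) convex_univ (mem_univ s) (mem_univ t)
  have hfd' : ∀ t, HasDerivAt (fun t => (f t : ℂ)) ((deriv f t : ℝ) : ℂ) t := fun t =>
    (hfd t).ofReal_comp
  have hfc : Continuous f := hC1.continuous
  obtain ⟨C, hC⟩ := exists_bound_cauchyCircle_exp (c := R) hR
    (k := fun t => ((deriv f t : ℝ) : ℂ) - Complex.I * (f t : ℂ)) (by fun_prop)
    (fun t => by simp only [hfper t, hf'per t]) (δ := δ) (K := K) (M := M) (by exact_mod_cast hδ)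
    K.2 hM0 fun s t => by
      have h1 : ‖((deriv f t : ℝ) : ℂ) - (deriv f s : ℝ)‖ ≤ K * |t - s| ^ (δ : ℝ) := by
        rw [← Complex.ofReal_sub, Complex.norm_real, ← dist_eq_norm, ← Real.dist_eq]
        exact hK.dist_le t s
      have h2 : ‖Complex.I * ((f t : ℂ) - f s)‖ ≤ M * |t - s| := by
        rw [norm_mul, Complex.norm_I, one_mul, ← Complex.ofReal_sub, Complex.norm_real]
        exact hlip s t
      calc _ = ‖(((deriv f t : ℝ) : ℂ) - (deriv f s : ℝ)) - Complex.I * ((f t : ℂ) - f s)‖ := by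
            congr 1; ring
        _ ≤ _ := (norm_sub_le _ _).trans (add_le_add h1 h2)
  refine ⟨(C / Real.pi).toNNReal, ?_⟩
  have hC0 : 0 ≤ C := (norm_nonneg _).trans (hC R (mem_ball_self hR))
  refine Convex.lipschitzOnWith_of_nnnorm_hasDerivWithin_le (convex_ball _ _)
    (fun x hx => ((hasDerivAt_cauchyCircle (φ := fun t => (f t : ℂ)) (by fun_prop) hx).const_mul
      ((R : ℂ) / Real.pi)).hasDerivWithinAt) fun x hx => ?_
  rw [← NNReal.coe_le_coe, coe_nnnorm, Real.coe_toNNReal _ (div_nonneg hC0 Real.pi_pos.le),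
    integral_div_sq_eq hR hfd' (by fun_prop) (by rw [← hfper 0, zero_add]) hx]
  rw [norm_mul, norm_mul, norm_neg, norm_div, norm_div, Complex.norm_I, Complex.norm_real,
    Complex.norm_real, Real.norm_of_nonneg hR.le, Real.norm_of_nonneg Real.pi_pos.le, ← mul_assoc]
  have : R / Real.pi * (1 / R) = 1 / Real.pi := by field_simp
  rw [this, div_mul_eq_mul_div, one_mul]
  exact div_le_div_of_nonneg_right (hC x hx) Real.pi_pos.le

/-- For `y` in the disk, `log |ζ - y| = log R + Re log (1 - (y - c)/(ζ - c))` with `c` the centre.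
The argument of the logarithm stays in the right half plane, so the principal branch is holomorphic
and can be differentiated under the integral. -/
theorem hasCGrad_H {R : ℝ} (hR : 0 < R) {g : ℂ → ℝ}
    (hg : Continuous fun t : ℝ => g (circleMap (R : ℂ) R t)) {x : ℂ} (hx : x ∈ ball (R : ℂ) R) :
    HasCGrad (H R g) (layerGrad R g x) x := by
  set f : ℝ → ℝ := fun t => g (circleMap (R : ℂ) R t) with hf
  set B := ball (R : ℂ) R
  have hR' : (R : ℂ) ≠ 0 := by exact_mod_cast hR.ne'
  have hζ0 : ∀ t, circleMap (0 : ℂ) R t ≠ 0 := fun t => circleMap_ne_center hR.ne'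
  set A : ℂ → ℝ → ℂ := fun y t => 1 - (y - R) / circleMap 0 R t with hA
  have hAc : Continuous (Function.uncurry A) := by
    refine continuous_const.sub (Continuous.div (by fun_prop) ?_ fun y => hζ0 _)
    exact (continuous_circleMap 0 R).comp continuous_snd
  have hAs : ∀ y ∈ B, ∀ t, A y t ∈ Complex.slitPlane := by
    intro y hy t
    have h1 : ‖(y - R) / circleMap 0 R t‖ < 1 := by
      rw [norm_div, norm_circleMap_zero, abs_of_pos hR, div_lt_one hR, ← dist_eq_norm]
      exact hy
    refine Or.inl ?_
    simp only [hA, Complex.sub_re, Complex.one_re]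
    linarith [Complex.re_le_norm ((y - R) / circleMap 0 R t)]
  have hAn : ∀ y t, A y t = (circleMap (R : ℂ) R t - y) / circleMap 0 R t := by
    intro y t
    have := hζ0 t
    simp only [hA]
    rw [eq_div_iff this, sub_mul, one_mul, div_mul_cancel₀ _ this, ← circleMap_sub_center (R : ℂ)]
    ring
  have hder := hasDerivAt_integral_of_continuousOn (U := B) isOpen_ball (a := 0)
    (b := 2 * Real.pi) hx
    (F := fun y t => (Real.log R + Complex.log (A y t)) * (f t : ℂ))
    (F' := fun y t => (-(circleMap (R : ℂ) R t - y)⁻¹) * (f t : ℂ)) ?_ ?_ ?_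
  · have h1 := (hasCGrad_re hder).const_mul (-(R / Real.pi))
    have e1 : ((-(R / Real.pi) : ℝ) : ℂ) * (∫ t in (0 : ℝ)..(2 * Real.pi),
        (-(circleMap (R : ℂ) R t - x)⁻¹) * (f t : ℂ)) = layerGrad R g x := by
      rw [layerGrad, cauchyCircle]
      push_cast
      rw [neg_mul, ← mul_neg, ← intervalIntegral.integral_neg]
      congr 1
      refine intervalIntegral.integral_congr fun t _ => ?_
      simp only [hf, div_eq_mul_inv]; ring
    rw [e1] at h1
    refine h1.congr ?_
    filter_upwards [isOpen_ball.mem_nhds hx] with y hy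
    have hAy : Continuous (A y) := hAc.comp (f := fun t : ℝ => (y, t)) (by fun_prop)
    have hint : IntervalIntegrable (fun t => (Real.log R + Complex.log (A y t)) * (f t : ℂ))
        volume 0 (2 * Real.pi) := by
      refine Continuous.intervalIntegrable ?_ _ _
      exact (continuous_const.add (hAy.clog fun t => hAs y hy t)).mul (by fun_prop)
    have e2 := Complex.reCLM.intervalIntegral_comp_comm hint
    simp only [Complex.reCLM_apply] at e2
    rw [← e2, H, singleLayer, ← mul_assoc]
    have e3 : ∀ t, Real.log ‖y - circleMap (R : ℂ) R t‖ * g (circleMap (R : ℂ) R t) * R =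
        R * ((Real.log R + Complex.log (A y t)) * (f t : ℂ)).re := by
      intro t
      have hne := circleMap_sub_ne_zero hy t
      have h2 : Real.log ‖A y t‖ = Real.log ‖y - circleMap (R : ℂ) R t‖ - Real.log R := by
        rw [hAn, norm_div, norm_circleMap_zero, abs_of_pos hR,
          Real.log_div (norm_ne_zero_iff.mpr hne) hR.ne', norm_sub_rev]
      rw [Complex.re_mul_ofReal, Complex.add_re, Complex.ofReal_re, Complex.log_re, h2]
      simp only [hf]; ring
    simp only [e3]
    rw [intervalIntegral.integral_const_mul, ← mul_assoc]
    congr 1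
    have := Real.pi_pos
    field_simp
  · refine ContinuousOn.mul (continuousOn_const.add
      (hAc.continuousOn.clog fun y hy => hAs _ hy.1 _)) ?_
    exact Continuous.continuousOn (by fun_prop)
  · refine ContinuousOn.mul (ContinuousOn.neg (ContinuousOn.inv₀ ?_
      fun y hy => circleMap_sub_ne_zero hy.1 _)) (Continuous.continuousOn (by fun_prop))
    have : Continuous fun y : ℂ × ℝ => circleMap (R : ℂ) R y.2 - y.1 := by
      unfold circleMap; fun_prop
    exact this.continuousOn
  · intro y hy t
    have hne := circleMap_sub_ne_zero hy t
    have h0 := hζ0 t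
    have h1 : HasDerivAt (fun y => A y t) (-(1 / circleMap 0 R t)) y :=
      (((hasDerivAt_id y).sub_const (R : ℂ)).div_const _).const_sub 1
    have h2 := ((h1.clog (hAs y hy t)).const_add ((Real.log R : ℝ) : ℂ)).mul_const (f t : ℂ)
    refine h2.congr_deriv ?_
    rw [hAn]
    field_simp

/-- A holomorphic function vanishing at the centre of a disk is determined by the boundary values of
its real part. -/
theorem eq_cauchyCircle_of_tendsto_re {c : ℂ} {R : ℝ} (hR : 0 < R) {F : ℂ → ℂ} {φ : ℂ → ℝ}
    (hF : DifferentiableOn ℂ F (ball c R)) (hFc : F c = 0)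
    (hφ : Continuous fun t : ℝ => φ (circleMap c R t))
    (hφ0 : ∫ t in (0 : ℝ)..(2 * Real.pi), φ (circleMap c R t) = 0)
    (hlim : ∀ ζ ∈ sphere c R, Tendsto (fun z => (F z).re) (𝓝[ball c R] ζ) (𝓝 (φ ζ)))
    {x : ℂ} (hx : x ∈ ball c R) :
    F x = (x - c) / Real.pi * cauchyCircle c R (fun t => (φ (circleMap c R t) : ℂ)) x := by
  set B := ball c R
  have hFa : AnalyticOnNhd ℂ F B := hF.analyticOnNhd isOpen_ball
  set u : ℂ → ℝ := extendFrom B fun z => (F z).re with hu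
  have huB : ∀ z ∈ B, u z = (F z).re := fun z hz =>
    extendFrom_eq (subset_closure hz)
      (Complex.continuous_re.continuousAt.comp_continuousWithinAt (hF.continuousOn z hz))
  have hclB : closure B = closedBall c R := closure_ball c hR.ne'
  have huS : ∀ ζ ∈ sphere c R, u ζ = φ ζ := fun ζ hζ =>
    extendFrom_eq (by rw [hclB]; exact sphere_subset_closedBall hζ) (hlim ζ hζ)
  have hharm : InnerProductSpace.HarmonicContOnCl u B := by
    refine ⟨fun z hz => ?_, ?_⟩
    · refine (InnerProductSpace.harmonicAt_congr_nhds ?_).mpr (hFa z hz).harmonicAt_re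
      filter_upwards [isOpen_ball.mem_nhds hz] with y hy using huB y hy
    · refine continuousOn_extendFrom subset_rfl fun z hz => ?_
      by_cases hzB : z ∈ B
      · exact ⟨_, Complex.continuous_re.continuousAt.comp_continuousWithinAt
          (hF.continuousOn z hzB)⟩
      · refine ⟨_, hlim z ?_⟩
        rw [hclB, mem_closedBall] at hz
        rw [mem_ball, not_lt] at hzB
        exact le_antisymm hz hzB
  set ψ : ℝ → ℂ := fun t => (φ (circleMap c R t) : ℂ) with hψ
  have hψc : Continuous ψ := Complex.continuous_ofReal.comp hφ
  set G : ℂ → ℂ := fun w => (w - c) / Real.pi * cauchyCircle c R ψ w with hG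
  have hGd : DifferentiableOn ℂ G B := fun w hw =>
    (((differentiableAt_id.sub_const c).div_const _).mul
      (hasDerivAt_cauchyCircle hψc hw).differentiableAt).differentiableWithinAt
  have hre : ∀ w ∈ B, (F w).re = (G w).re := by
    intro w hw
    have h1 := hharm.circleAverage_re_herglotzRieszKernel_smul hw
    rw [huB w hw] at h1
    rw [← h1, Real.circleAverage]
    have hne := circleMap_sub_ne_zero hw
    have e1 : ∀ t, (Complex.re ∘ herglotzRieszKernel c w • u) (circleMap c R t) =
        φ (circleMap c R t) + (2 * (w - c) * (ψ t / (circleMap c R t - w))).re := by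
      intro t
      have hmem := circleMap_mem_sphere c hR.le t
      simp only [Pi.smul_apply', Function.comp_apply, smul_eq_mul, herglotzRieszKernel]
      rw [huS _ hmem, ← Complex.re_mul_ofReal]
      -- The Herglotz–Riesz kernel is `1 + 2 (w - c)/(ζ - w)`; the constant `1` drops out because
      -- `φ` has mean zero.
      have e2 : (circleMap c R t - c + (w - c)) / (circleMap c R t - c - (w - c)) *
          (φ (circleMap c R t) : ℂ) =
          ψ t + 2 * (w - c) * (ψ t / (circleMap c R t - w)) := by
        have h3 : circleMap c R t - c - (w - c) = circleMap c R t - w := by ring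
        rw [h3]
        have := hne t
        simp only [hψ]
        field_simp
        ring
      rw [e2, Complex.add_re]
      rfl
    have hc1 : Continuous fun t => 2 * (w - c) * (ψ t / (circleMap c R t - w)) :=
      continuous_const.mul (hψc.div (by fun_prop) hne)
    have hc2 : Continuous fun t => (2 * (w - c) * (ψ t / (circleMap c R t - w))).re :=
      Complex.continuous_re.comp hc1
    rw [intervalIntegral.integral_congr (fun t _ => e1 t), intervalIntegral.integral_add
      (hφ.intervalIntegrable (μ := volume) 0 (2 * Real.pi)) (hc2.intervalIntegrable _ _), hφ0,
      zero_add]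
    have e3 := Complex.reCLM.intervalIntegral_comp_comm (hc1.intervalIntegrable (μ := volume) 0 (2 * Real.pi))
    simp only [Complex.reCLM_apply] at e3
    rw [e3, intervalIntegral.integral_const_mul, smul_eq_mul, ← Complex.re_ofReal_mul]
    congr 1
    simp only [hG, cauchyCircle]
    have : (Real.pi : ℂ) ≠ 0 := by exact_mod_cast Real.pi_ne_zero
    push_cast
    field_simp
  -- Equal real parts have equal complex gradients, so `F` and `G` differ by a constant, which is
  -- zero at the centre.
  have hderiv : B.EqOn (deriv F) (deriv G) := by
    intro w hw
    have h1 := hasCGrad_re (hF.differentiableAt (isOpen_ball.mem_nhds hw)).hasDerivAt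
    have h2 := hasCGrad_re (hGd.differentiableAt (isOpen_ball.mem_nhds hw)).hasDerivAt
    refine h1.unique (h2.congr ?_)
    filter_upwards [isOpen_ball.mem_nhds hw] with y hy using hre y hy
  have hGc : G c = 0 := by simp [hG]
  exact isOpen_ball.eqOn_of_deriv_eq (convex_ball c R).isPreconnected hF hGd hderiv
    (mem_ball_self hR) (hFc.trans hGc.symm) hx

/-! ### The hyperbolic flow

In the normalization where the poles are `± 1` the shift `ξ ↦ ξ + t` of bipolar coordinates is the
Möbius map `ζ ↦ (sinh (t/2) + ζ cosh (t/2)) / (cosh (t/2) + ζ sinh (t/2))`. -/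

/-- The denominator of the hyperbolic flow. -/
def flowDen (ζ : ℂ) (t : ℝ) : ℂ := (Real.cosh (t / 2) : ℂ) + ζ * (Real.sinh (t / 2) : ℂ)

/-- The hyperbolic flow with fixed points `± 1`. -/
def flow (ζ : ℂ) (t : ℝ) : ℂ :=
  ((Real.sinh (t / 2) : ℂ) + ζ * (Real.cosh (t / 2) : ℂ)) / flowDen ζ t

/-- The derivative of the hyperbolic flow. -/
def flowDer (ζ : ℂ) (t : ℝ) : ℂ := 1 / flowDen ζ t ^ 2

/-- Up to a factor `√2`, a lower bound for `|flowDen ζ t|`, where `m = |ζ|`. -/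
def flowLow (m t : ℝ) : ℝ := Real.cosh (t / 2) + m * Real.sinh (t / 2)

section

variable {ζ : ℂ} {m s t h : ℝ}

theorem sinh_half_nonneg (ht : 0 ≤ t) : 0 ≤ Real.sinh (t / 2) :=
  Real.sinh_nonneg_iff.mpr (by linarith)

theorem one_le_flowLow (hm : 0 ≤ m) (ht : 0 ≤ t) : 1 ≤ flowLow m t := by
  have h1 := Real.one_le_cosh (t / 2)
  have h2 := mul_nonneg hm (sinh_half_nonneg ht)
  unfold flowLow; linarith

theorem flowLow_pos (hm : 0 ≤ m) (ht : 0 ≤ t) : 0 < flowLow m t :=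
  zero_lt_one.trans_le (one_le_flowLow hm ht)

theorem cosh_half_mono (hs : 0 ≤ s) (hst : s ≤ t) : Real.cosh (s / 2) ≤ Real.cosh (t / 2) :=
  Real.cosh_le_cosh.mpr (by rw [abs_of_nonneg (by linarith), abs_of_nonneg (by linarith)]; linarith)

theorem sinh_half_mono (hst : s ≤ t) : Real.sinh (s / 2) ≤ Real.sinh (t / 2) :=
  Real.sinh_le_sinh.mpr (by linarith)

theorem flowLow_mono (hm : 0 ≤ m) (hs : 0 ≤ s) (hst : s ≤ t) : flowLow m s ≤ flowLow m t :=
  add_le_add (cosh_half_mono hs hst) (mul_le_mul_of_nonneg_left (sinh_half_mono hst) hm)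

theorem normSq_flowDen (ζ : ℂ) (t : ℝ) : ‖flowDen ζ t‖ ^ 2 =
    Real.cosh (t / 2) ^ 2 + 2 * ζ.re * (Real.cosh (t / 2) * Real.sinh (t / 2)) +
      ‖ζ‖ ^ 2 * Real.sinh (t / 2) ^ 2 := by
  rw [← Complex.normSq_eq_norm_sq, ← Complex.normSq_eq_norm_sq, Complex.normSq_apply,
    Complex.normSq_apply, flowDen]
  simp only [Complex.add_re, Complex.add_im, Complex.mul_re, Complex.mul_im, Complex.ofReal_re,
    Complex.ofReal_im]
  ring

/-- For `Re ζ ≥ 0` the cross term in `|cosh + ζ sinh|²` is nonnegative, and `a² + b² ≥ (a + b)²/2`.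
-/
theorem flowLow_sq_le (hζ : 0 ≤ ζ.re) (ht : 0 ≤ t) :
    flowLow ‖ζ‖ t ^ 2 ≤ 2 * ‖flowDen ζ t‖ ^ 2 := by
  rw [normSq_flowDen, flowLow]
  have h1 : 0 ≤ ζ.re * (Real.cosh (t / 2) * Real.sinh (t / 2)) :=
    mul_nonneg hζ (mul_nonneg (Real.cosh_pos _).le (sinh_half_nonneg ht))
  nlinarith [sq_nonneg (Real.cosh (t / 2) - ‖ζ‖ * Real.sinh (t / 2))]

theorem cosh_le_norm_flowDen (hζ : 0 ≤ ζ.re) (ht : 0 ≤ t) : Real.cosh (t / 2) ≤ ‖flowDen ζ t‖ := by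
  refine le_trans ?_ (Complex.re_le_norm _)
  have := mul_nonneg hζ (sinh_half_nonneg ht)
  simp only [flowDen, Complex.add_re, Complex.mul_re, Complex.ofReal_re, Complex.ofReal_im,
    mul_zero, sub_zero]
  linarith

theorem one_le_norm_flowDen (hζ : 0 ≤ ζ.re) (ht : 0 ≤ t) : 1 ≤ ‖flowDen ζ t‖ :=
  (Real.one_le_cosh _).trans (cosh_le_norm_flowDen hζ ht)

theorem flowDen_ne_zero (hζ : 0 ≤ ζ.re) (ht : 0 ≤ t) : flowDen ζ t ≠ 0 :=
  norm_pos_iff.mp (zero_lt_one.trans_le (one_le_norm_flowDen hζ ht))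

theorem norm_flowDen_le (ht : 0 ≤ t) : ‖flowDen ζ t‖ ≤ flowLow ‖ζ‖ t := by
  refine (norm_add_le _ _).trans ?_
  rw [norm_mul, Complex.norm_real, Complex.norm_real, Real.norm_of_nonneg (Real.cosh_pos _).le,
    Real.norm_of_nonneg (sinh_half_nonneg ht), flowLow]

theorem norm_flowDer (ζ : ℂ) (t : ℝ) : ‖flowDer ζ t‖ = 1 / ‖flowDen ζ t‖ ^ 2 := by
  rw [flowDer, norm_div, norm_pow, norm_one]

theorem norm_flowDer_le (hζ : 0 ≤ ζ.re) (ht : 0 ≤ t) :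
    ‖flowDer ζ t‖ ≤ 2 / flowLow ‖ζ‖ t ^ 2 := by
  have h1 := flowLow_sq_le hζ ht
  have h2 := flowLow_pos (norm_nonneg ζ) ht
  have h3 := one_le_norm_flowDen hζ ht
  rw [norm_flowDer, div_le_div_iff₀ (by positivity) (by positivity)]
  linarith

theorem norm_flowDer_le_one (hζ : 0 ≤ ζ.re) (ht : 0 ≤ t) : ‖flowDer ζ t‖ ≤ 1 := by
  have h3 := one_le_norm_flowDen hζ ht
  rw [norm_flowDer, div_le_one (by positivity)]
  exact one_le_pow₀ h3

theorem norm_flowDer_le_exp (hζ : 0 ≤ ζ.re) (ht : 0 ≤ t) :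
    ‖flowDer ζ t‖ ≤ 4 * Real.exp (-t) := by
  have h1 := cosh_le_norm_flowDen hζ ht
  have h2 : Real.exp (t / 2) / 2 ≤ Real.cosh (t / 2) := by
    rw [Real.cosh_eq]; linarith [Real.exp_pos (-(t / 2))]
  have h3 : Real.exp t / 4 ≤ ‖flowDen ζ t‖ ^ 2 := by
    have : Real.exp t / 4 = (Real.exp (t / 2) / 2) ^ 2 := by
      rw [div_pow, ← Real.exp_nat_mul]; norm_num; ring_nf
    rw [this]
    exact pow_le_pow_left₀ (by positivity) (h2.trans h1) 2
  have := Real.exp_pos t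
  rw [norm_flowDer, Real.exp_neg, ← div_eq_mul_inv, div_le_div_iff₀ (by linarith) (by positivity)]
  linarith

/-- With `D` the denominator, the difference of `1/D²` factors as `(D_t - D_s)(D_t + D_s)/(D_s²
D_t²)`, and each factor is controlled by `flowLow`. The increment is thus dominated by that of a
monotone function, and such bounds telescope. -/
theorem norm_flowDer_sub_le (hζ : 0 ≤ ζ.re) (hs : 0 ≤ s) (hst : s ≤ t) :
    ‖flowDer ζ s - flowDer ζ t‖ ≤ 4 * (1 / flowLow ‖ζ‖ s ^ 2 - 1 / flowLow ‖ζ‖ t ^ 2) := by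
  have ht : 0 ≤ t := hs.trans hst
  set a := flowLow ‖ζ‖ s with ha
  set b := flowLow ‖ζ‖ t with hb
  have ha0 : 0 < a := flowLow_pos (norm_nonneg ζ) hs
  have hb0 : 0 < b := flowLow_pos (norm_nonneg ζ) ht
  have hab : a ≤ b := flowLow_mono (norm_nonneg ζ) hs hst
  have hEs := flowDen_ne_zero hζ hs
  have hEt := flowDen_ne_zero hζ ht
  have e1 : flowDer ζ s - flowDer ζ t = (flowDen ζ t - flowDen ζ s) * (flowDen ζ t + flowDen ζ s) *
      (flowDer ζ s * flowDer ζ t) := by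
    simp only [flowDer]; field_simp; ring
  have h1 : ‖flowDen ζ t - flowDen ζ s‖ ≤ b - a := by
    have : flowDen ζ t - flowDen ζ s = ((Real.cosh (t / 2) - Real.cosh (s / 2) : ℝ) : ℂ) +
        ζ * ((Real.sinh (t / 2) - Real.sinh (s / 2) : ℝ) : ℂ) := by
      simp only [flowDen]; push_cast; ring
    rw [this]
    refine (norm_add_le _ _).trans ?_
    rw [norm_mul, Complex.norm_real, Complex.norm_real,
      Real.norm_of_nonneg (sub_nonneg.mpr (cosh_half_mono hs hst)),
      Real.norm_of_nonneg (sub_nonneg.mpr (sinh_half_mono hst)), ha, hb, flowLow, flowLow]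
    linarith
  have h2 : ‖flowDen ζ t + flowDen ζ s‖ ≤ b + a :=
    (norm_add_le _ _).trans (add_le_add (norm_flowDen_le ht) (norm_flowDen_le hs))
  have h3 : ‖flowDer ζ s * flowDer ζ t‖ ≤ 2 / a ^ 2 * (2 / b ^ 2) := by
    rw [norm_mul]
    exact mul_le_mul (norm_flowDer_le hζ hs) (norm_flowDer_le hζ ht) (norm_nonneg _) (by positivity)
  rw [e1, norm_mul, norm_mul]
  calc _ ≤ (b - a) * (b + a) * (2 / a ^ 2 * (2 / b ^ 2)) :=
        mul_le_mul (mul_le_mul h1 h2 (norm_nonneg _) (by linarith)) h3 (norm_nonneg _)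
          (mul_nonneg (by linarith) (by linarith))
    _ = _ := by field_simp; ring

theorem flow_sub_flow (hζ : 0 ≤ ζ.re) (hs : 0 ≤ s) (ht : 0 ≤ t) :
    flow ζ t - flow ζ s =
      (1 - ζ ^ 2) * (Real.sinh ((t - s) / 2) : ℂ) / (flowDen ζ s * flowDen ζ t) := by
  have hEs := flowDen_ne_zero hζ hs
  have hEt := flowDen_ne_zero hζ ht
  rw [flow, flow, div_sub_div _ _ hEt hEs, mul_comm (flowDen ζ s) (flowDen ζ t), sub_div t s,
    Real.sinh_sub]
  congr 1
  simp only [flowDen]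
  push_cast
  ring

/-- The addition formula for `sinh` makes the left side an exact difference, so sums of `1/(L_s
L_t)` over equally spaced times telescope. The total is at most `1/(1 + m)` divided by `sinh (h/2)`.
-/
theorem sinh_div_flowLow_mul (hm : 0 ≤ m) (hs : 0 ≤ s) (ht : 0 ≤ t) :
    Real.sinh ((t - s) / 2) / (flowLow m s * flowLow m t) =
      Real.sinh (t / 2) / flowLow m t - Real.sinh (s / 2) / flowLow m s := by
  have h1 := (flowLow_pos hm hs).ne'
  have h2 := (flowLow_pos hm ht).ne'
  rw [div_sub_div _ _ h2 h1, mul_comm (flowLow m s), sub_div, Real.sinh_sub]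
  congr 1
  simp only [flowLow]
  ring

theorem sinh_div_flowLow_le (hm : 0 ≤ m) (ht : 0 ≤ t) :
    Real.sinh (t / 2) / flowLow m t ≤ 1 / (1 + m) := by
  rw [div_le_div_iff₀ (flowLow_pos hm ht) (by linarith), flowLow]
  nlinarith [Real.sinh_lt_cosh (t / 2)]

theorem sum_inv_flowLow_mul_le (hm : 0 ≤ m) (hh : 0 < h) (N : ℕ) :
    ∑ n ∈ Finset.range N, 1 / (flowLow m (n * h) * flowLow m ((n + 1 : ℕ) * h)) ≤
      1 / ((1 + m) * Real.sinh (h / 2)) := by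
  have hsh : 0 < Real.sinh (h / 2) := Real.sinh_pos_iff.mpr (by linarith)
  have e1 : ∀ n : ℕ, 1 / (flowLow m (n * h) * flowLow m ((n + 1 : ℕ) * h)) =
      (Real.sinh (((n + 1 : ℕ) * h) / 2) / flowLow m ((n + 1 : ℕ) * h) -
        Real.sinh ((n * h) / 2) / flowLow m (n * h)) / Real.sinh (h / 2) := by
    intro n
    rw [← sinh_div_flowLow_mul hm (by positivity) (by positivity)]
    have : ((n + 1 : ℕ) * h - n * h) / 2 = h / 2 := by push_cast; ring
    rw [this]
    field_simp
  rw [Finset.sum_congr rfl fun n _ => e1 n, ← Finset.sum_div,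
    Finset.sum_range_sub (fun n : ℕ => Real.sinh ((n * h) / 2) / flowLow m (n * h)), ← div_div]
  refine div_le_div_of_nonneg_right ?_ hsh.le
  have := sinh_div_flowLow_le hm (t := (N : ℝ) * h) (by positivity)
  simpa using this

/-- Written as `tanh (t/2) + ζ / (cosh (t/2) · flowDen ζ t)`, the flow has a first term of modulus
at most `1` and a second of modulus at most `|ζ|`. -/
theorem norm_flow_le (hζ : 0 ≤ ζ.re) (ht : 0 ≤ t) : ‖flow ζ t‖ ≤ 1 + ‖ζ‖ := by
  have hE := flowDen_ne_zero hζ ht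
  have hc := Real.one_le_cosh (t / 2)
  have hc0 : (Real.cosh (t / 2) : ℂ) ≠ 0 := by exact_mod_cast (Real.cosh_pos _).ne'
  have e1 : flow ζ t = (Real.sinh (t / 2) : ℂ) / Real.cosh (t / 2) +
      ζ / (Real.cosh (t / 2) * flowDen ζ t) := by
    have h1 : (Real.cosh (t / 2) : ℂ) ^ 2 = 1 + (Real.sinh (t / 2) : ℂ) ^ 2 := by
      exact_mod_cast (Real.cosh_sq' (t / 2))
    rw [flow, div_add_div _ _ hc0 (mul_ne_zero hc0 hE), div_eq_div_iff hE
      (mul_ne_zero hc0 (mul_ne_zero hc0 hE))]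
    simp only [flowDen] at *
    linear_combination (ζ * Real.cosh (t / 2) * (Real.cosh (t / 2) + ζ * Real.sinh (t / 2))) * h1
  rw [e1]
  refine (norm_add_le _ _).trans (add_le_add ?_ ?_)
  · rw [norm_div, Complex.norm_real, Complex.norm_real, Real.norm_of_nonneg (sinh_half_nonneg ht),
      Real.norm_of_nonneg (by linarith), div_le_one (by linarith)]
    exact (Real.sinh_lt_cosh _).le
  · rw [norm_div, norm_mul, Complex.norm_real, Real.norm_of_nonneg (by linarith)]
    exact div_le_self (norm_nonneg _) (one_le_mul_of_one_le_of_one_le hc (one_le_norm_flowDen hζ ht))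

theorem flowDen_add (hζ : 0 ≤ ζ.re) (hs : 0 ≤ s) :
    flowDen ζ (s + t) = flowDen ζ s * flowDen (flow ζ s) t := by
  have hE := flowDen_ne_zero hζ hs
  have e : flowDen ζ s * flowDen (flow ζ s) t = flowDen ζ s * (Real.cosh (t / 2) : ℂ) +
      (((Real.sinh (s / 2) : ℂ) + ζ * (Real.cosh (s / 2) : ℂ))) * (Real.sinh (t / 2) : ℂ) := by
    rw [show flowDen (flow ζ s) t = (Real.cosh (t / 2) : ℂ) + flow ζ s * (Real.sinh (t / 2) : ℂ)
      from rfl, flow]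
    field_simp
  rw [e]
  simp only [flowDen, add_div, Real.cosh_add, Real.sinh_add]
  push_cast
  ring

theorem flow_flow (hζ : 0 ≤ ζ.re) (hs : 0 ≤ s) (ht : 0 ≤ t) :
    flow (flow ζ s) t = flow ζ (s + t) := by
  have hE := flowDen_ne_zero hζ hs
  have hE2 := flowDen_ne_zero hζ (add_nonneg hs ht)
  rw [flowDen_add hζ hs] at hE2
  have hE3 := right_ne_zero_of_mul hE2
  have e : flow ζ (s + t) = ((Real.sinh ((s + t) / 2) : ℂ) + ζ * (Real.cosh ((s + t) / 2) : ℂ)) /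
    (flowDen ζ s * flowDen (flow ζ s) t) := by rw [← flowDen_add hζ hs]; rfl
  have e' : flow (flow ζ s) t = ((Real.sinh (t / 2) : ℂ) + flow ζ s * (Real.cosh (t / 2) : ℂ)) /
    flowDen (flow ζ s) t := rfl
  rw [e, e', div_eq_div_iff hE3 (mul_ne_zero hE hE3)]
  have e2 : (flow ζ s) * flowDen ζ s = (Real.sinh (s / 2) : ℂ) + ζ * (Real.cosh (s / 2) : ℂ) :=
    div_mul_cancel₀ _ hE
  have e3 : ((Real.sinh (t / 2) : ℂ) + flow ζ s * (Real.cosh (t / 2) : ℂ)) * flowDen ζ s =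
      (Real.sinh ((s + t) / 2) : ℂ) + ζ * (Real.cosh ((s + t) / 2) : ℂ) := by
    rw [add_mul, mul_right_comm, e2]
    simp only [flowDen, add_div, Real.cosh_add, Real.sinh_add]
    push_cast
    ring
  rw [← mul_assoc, e3]

theorem flowDer_add (hζ : 0 ≤ ζ.re) (hs : 0 ≤ s) :
    flowDer ζ (s + t) = flowDer ζ s * flowDer (flow ζ s) t := by
  simp only [flowDer, flowDen_add hζ hs]
  rw [mul_pow, one_div_mul_one_div]

theorem flow_re_nonneg (hζ : 0 ≤ ζ.re) (ht : 0 ≤ t) : 0 ≤ (flow ζ t).re := by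
  rw [flow, Complex.div_re, ← add_div]
  refine div_nonneg ?_ (Complex.normSq_nonneg _)
  simp only [flowDen, Complex.add_re, Complex.add_im, Complex.mul_re, Complex.mul_im,
    Complex.ofReal_re, Complex.ofReal_im]
  have h1 := sinh_half_nonneg ht
  have h2 := (Real.cosh_pos (t / 2)).le
  have h3 := mul_nonneg h1 h2
  have e : (Real.sinh (t / 2) + (ζ.re * Real.cosh (t / 2) - ζ.im * 0)) *
      (Real.cosh (t / 2) + (ζ.re * Real.sinh (t / 2) - ζ.im * 0)) +
      (0 + (ζ.re * 0 + ζ.im * Real.cosh (t / 2))) * (0 + (ζ.re * 0 + ζ.im * Real.sinh (t / 2))) =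
      Real.sinh (t / 2) * Real.cosh (t / 2) * (1 + ζ.re ^ 2 + ζ.im ^ 2) +
        ζ.re * (Real.sinh (t / 2) ^ 2 + Real.cosh (t / 2) ^ 2) := by ring
  rw [e]
  positivity

theorem hasDerivAt_flow (hζ : 0 ≤ ζ.re) (ht : 0 ≤ t) :
    HasDerivAt (fun x => flow x t) (flowDer ζ t) ζ := by
  have hE := flowDen_ne_zero hζ ht
  have h1 : HasDerivAt (fun x : ℂ => (Real.sinh (t / 2) : ℂ) + x * (Real.cosh (t / 2) : ℂ))
      (1 * (Real.cosh (t / 2) : ℂ)) ζ := ((hasDerivAt_id ζ).mul_const _).const_add _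
  have h2 : HasDerivAt (fun x : ℂ => flowDen x t) (1 * (Real.sinh (t / 2) : ℂ)) ζ :=
    ((hasDerivAt_id ζ).mul_const _).const_add _
  refine (h1.div h2 hE).congr_deriv ?_
  rw [flowDer]
  congr 1
  have h3 : (Real.cosh (t / 2) : ℂ) ^ 2 = 1 + (Real.sinh (t / 2) : ℂ) ^ 2 := by
    exact_mod_cast (Real.cosh_sq' (t / 2))
  simp only [flowDen]
  linear_combination h3

theorem continuous_flowDen (ζ : ℂ) : Continuous (flowDen ζ) := by
  unfold flowDen
  have h1 := Real.continuous_cosh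
  have h2 := Real.continuous_sinh
  fun_prop

theorem continuousOn_flowDer (hζ : 0 ≤ ζ.re) : ContinuousOn (flowDer ζ) (Ici 0) :=
  continuousOn_const.div ((continuous_flowDen ζ).pow 2).continuousOn fun _ ht =>
    pow_ne_zero 2 (flowDen_ne_zero hζ ht)

end

/-! ### Sums along orbits of the flow -/

/-- Abel summation: multiplication by `1 + τ ≥ 1` turns the sum into two boundary terms and a
weighted sum of increments. The bound does not deteriorate as `τ → 1`. -/
theorem norm_alternating_sum_le {a : ℕ → ℂ} {τ A V : ℝ} (hτ0 : 0 ≤ τ) (hτ1 : τ ≤ 1)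
    (hA : ∀ n, ‖a n‖ ≤ A) (hV : ∀ N, ∑ n ∈ Finset.range N, ‖a (n + 1) - a n‖ ≤ V) (N : ℕ) :
    ‖∑ n ∈ Finset.range N, (-(τ : ℂ)) ^ n * a n‖ ≤ 2 * A + V := by
  have hA0 : 0 ≤ A := (norm_nonneg _).trans (hA 0)
  have hV0 : 0 ≤ V := by simpa using hV 0
  rcases N with _ | N
  · simp; positivity
  have key : ∀ N : ℕ, (1 + (τ : ℂ)) * ∑ n ∈ Finset.range (N + 1), (-(τ : ℂ)) ^ n * a n =
      a 0 + ∑ n ∈ Finset.range N, (-(τ : ℂ)) ^ (n + 1) * (a (n + 1) - a n) -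
        (-(τ : ℂ)) ^ (N + 1) * a N := by
    intro N
    induction N with
    | zero => simp; ring
    | succ N ih =>
      rw [Finset.sum_range_succ, mul_add, ih, Finset.sum_range_succ _ N]
      ring
  have hτn : ∀ n : ℕ, ‖(-(τ : ℂ)) ^ n‖ ≤ 1 := fun n => by
    rw [norm_pow, norm_neg, Complex.norm_real, Real.norm_of_nonneg hτ0]
    exact pow_le_one₀ hτ0 hτ1
  have h1 : ‖(1 + (τ : ℂ)) * ∑ n ∈ Finset.range (N + 1), (-(τ : ℂ)) ^ n * a n‖ ≤ A + V + A := by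
    rw [key]
    refine (norm_sub_le _ _).trans (add_le_add ((norm_add_le _ _).trans (add_le_add (hA 0) ?_)) ?_)
    · refine ((norm_sum_le _ _).trans (Finset.sum_le_sum fun n _ => ?_)).trans (hV N)
      rw [norm_mul]
      exact mul_le_of_le_one_left (norm_nonneg _) (hτn _)
    · rw [norm_mul]
      exact (mul_le_of_le_one_left (norm_nonneg _) (hτn _)).trans (hA N)
  rw [norm_mul] at h1
  have h2 : (1 : ℝ) ≤ ‖(1 + (τ : ℂ))‖ := by
    rw [← Complex.ofReal_one, ← Complex.ofReal_add, Complex.norm_real,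
      Real.norm_of_nonneg (by linarith)]
    linarith
  have := norm_nonneg (∑ n ∈ Finset.range (N + 1), (-(τ : ℂ)) ^ n * a n)
  nlinarith

section

variable {ζ : ℂ} {h α : ℝ}

theorem sum_norm_flowDer_sub_le (hζ : 0 ≤ ζ.re) (hh : 0 < h) (N : ℕ) :
    ∑ n ∈ Finset.range N, ‖flowDer ζ (n * h) - flowDer ζ ((n + 1 : ℕ) * h)‖ ≤ 4 := by
  have hle : ∀ n : ℕ, (n : ℝ) * h ≤ (n + 1 : ℕ) * h := fun n => by
    push_cast; nlinarith
  refine (Finset.sum_le_sum fun n _ => norm_flowDer_sub_le hζ (by positivity) (hle n)).trans ?_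
  rw [← Finset.mul_sum, Finset.sum_range_sub' (fun n : ℕ => 1 / flowLow ‖ζ‖ (n * h) ^ 2)]
  have h1 : flowLow ‖ζ‖ ((0 : ℕ) * h) = 1 := by simp [flowLow]
  have h2 : 0 ≤ 1 / flowLow ‖ζ‖ (N * h) ^ 2 := by positivity
  rw [h1]
  linarith

/-- The orbit tends to the fixed point `1`, and its polygonal length is at most twice the initial
distance to it. The factor `1 + ‖ζ‖` from `|1 - ζ²|` cancels against the telescoped sum, as does
`sinh (h/2)`; hence the uniformity in `h`. -/
theorem sum_norm_flow_sub_le (hζ : 0 ≤ ζ.re) (hh : 0 < h) (N : ℕ) :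
    ∑ n ∈ Finset.range N, ‖flow ζ (n * h) - flow ζ ((n + 1 : ℕ) * h)‖ ≤ 2 * ‖1 - ζ‖ := by
  have hsh : 0 < Real.sinh (h / 2) := Real.sinh_pos_iff.mpr (by linarith)
  have hm := norm_nonneg ζ
  have e1 : ∀ n : ℕ, ‖flow ζ (n * h) - flow ζ ((n + 1 : ℕ) * h)‖ ≤
      2 * ‖1 - ζ‖ * (1 + ‖ζ‖) * Real.sinh (h / 2) *
        (1 / (flowLow ‖ζ‖ (n * h) * flowLow ‖ζ‖ ((n + 1 : ℕ) * h))) := by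
    intro n
    have hn0 : 0 ≤ (n : ℝ) * h := by positivity
    have hn1 : 0 ≤ ((n + 1 : ℕ) : ℝ) * h := by positivity
    have p0 := flowLow_pos hm hn0
    have p1 := flowLow_pos hm hn1
    have q0 := one_le_norm_flowDen hζ hn0
    have q1 := one_le_norm_flowDen hζ hn1
    rw [norm_sub_rev, flow_sub_flow hζ hn0 hn1]
    have : ((n + 1 : ℕ) * h - n * h) / 2 = h / 2 := by push_cast; ring
    rw [this, show (1 : ℂ) - ζ ^ 2 = (1 - ζ) * (1 + ζ) by ring, norm_div, norm_mul, norm_mul,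
      norm_mul, Complex.norm_real, Real.norm_of_nonneg hsh.le]
    have h1 : flowLow ‖ζ‖ (n * h) * flowLow ‖ζ‖ ((n + 1 : ℕ) * h) ≤
        2 * (‖flowDen ζ (n * h)‖ * ‖flowDen ζ ((n + 1 : ℕ) * h)‖) := by
      refine le_of_sq_le_sq ?_ (by positivity)
      have := mul_le_mul (flowLow_sq_le hζ hn0) (flowLow_sq_le hζ hn1) (by positivity)
        (by positivity)
      nlinarith
    have h2 : 1 / (‖flowDen ζ (n * h)‖ * ‖flowDen ζ ((n + 1 : ℕ) * h)‖) ≤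
        2 * (1 / (flowLow ‖ζ‖ (n * h) * flowLow ‖ζ‖ ((n + 1 : ℕ) * h))) := by
      rw [mul_one_div, div_le_div_iff₀ (by positivity) (by positivity)]
      linarith
    have h3 : ‖1 + ζ‖ ≤ 1 + ‖ζ‖ := (norm_add_le _ _).trans (by rw [norm_one])
    calc _ = ‖1 - ζ‖ * ‖1 + ζ‖ * Real.sinh (h / 2) *
          (1 / (‖flowDen ζ (n * h)‖ * ‖flowDen ζ ((n + 1 : ℕ) * h)‖)) := by ring
      _ ≤ ‖1 - ζ‖ * (1 + ‖ζ‖) * Real.sinh (h / 2) *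
          (2 * (1 / (flowLow ‖ζ‖ (n * h) * flowLow ‖ζ‖ ((n + 1 : ℕ) * h)))) := by
        gcongr
      _ = _ := by ring
  refine (Finset.sum_le_sum fun n _ => e1 n).trans ?_
  rw [← Finset.mul_sum]
  refine (mul_le_mul_of_nonneg_left (sum_inv_flowLow_mul_le hm hh N) (by positivity)).trans ?_
  have : 0 < 1 + ‖ζ‖ := by positivity
  apply le_of_eq
  field_simp

/-- The time `0` is omitted so that `L_{n+1}² ≥ L_n L_{n+1}` leads to the telescoping sum. The gain
`1/(1 + ‖ζ‖)` later absorbs the size of the orbit. -/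
theorem sum_norm_flowDer_le (hζ : 0 ≤ ζ.re) (hh : 0 < h) (N : ℕ) :
    ∑ n ∈ Finset.range N, ‖flowDer ζ ((n + 1 : ℕ) * h)‖ ≤ 2 / ((1 + ‖ζ‖) * Real.sinh (h / 2)) := by
  have hm := norm_nonneg ζ
  rw [← mul_one_div]
  refine le_trans ?_ (mul_le_mul_of_nonneg_left (sum_inv_flowLow_mul_le hm hh N) zero_le_two)
  rw [Finset.mul_sum]
  refine Finset.sum_le_sum fun n _ => ?_
  have hn0 : 0 ≤ (n : ℝ) * h := by positivity
  have hn1 : 0 ≤ ((n + 1 : ℕ) : ℝ) * h := by positivity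
  have hle : (n : ℝ) * h ≤ (n + 1 : ℕ) * h := by push_cast; nlinarith
  have p0 := flowLow_pos hm hn0
  have p1 := flowLow_pos hm hn1
  refine (norm_flowDer_le hζ hn1).trans ?_
  rw [mul_one_div]
  refine div_le_div_of_nonneg_left zero_le_two (by positivity) ?_
  rw [sq]
  exact mul_le_mul_of_nonneg_right (flowLow_mono hm hn0 hle) p1.le

end

/-! ### Comparison of geometric sums with Laplace integrals -/

/-- The Laplace transform of the derivative of the flow. -/
def flowInt (ζ : ℂ) (b : ℝ) : ℂ :=
  ∫ t in Ioi (0 : ℝ), (Real.exp (-(b * t)) : ℂ) * flowDer ζ t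

/-- The generating function of the derivatives along an orbit of the flow. -/
def flowSum (ζ : ℂ) (h s : ℝ) : ℂ := ∑' n : ℕ, (s : ℂ) ^ n * flowDer ζ (n * h)

section

variable {ζ : ℂ} {h s : ℝ}

theorem integrableOn_exp_neg_Ioi : IntegrableOn (fun t : ℝ => 4 * Real.exp (-t)) (Ioi 0) := by
  have := (exp_neg_integrableOn_Ioi 0 one_pos).const_mul 4
  simpa [IntegrableOn] using this

theorem norm_exp_mul_flowDer_le (hζ : 0 ≤ ζ.re) {b t : ℝ} (hb : 0 ≤ b) (ht : 0 ≤ t) :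
    ‖(Real.exp (-(b * t)) : ℂ) * flowDer ζ t‖ ≤ 4 * Real.exp (-t) := by
  rw [norm_mul, Complex.norm_real, Real.norm_of_nonneg (Real.exp_pos _).le]
  refine (mul_le_of_le_one_left (norm_nonneg _) ?_).trans (norm_flowDer_le_exp hζ ht)
  exact Real.exp_le_one_iff.mpr (by have := mul_nonneg hb ht; linarith)

theorem continuousOn_exp_mul_flowDer (hζ : 0 ≤ ζ.re) (b : ℝ) :
    ContinuousOn (fun t : ℝ => (Real.exp (-(b * t)) : ℂ) * flowDer ζ t) (Ici 0) := by
  refine ContinuousOn.mul (Continuous.continuousOn ?_) (continuousOn_flowDer hζ)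
  exact Complex.continuous_ofReal.comp (Real.continuous_exp.comp (by fun_prop))

theorem integrableOn_exp_mul_flowDer (hζ : 0 ≤ ζ.re) {b : ℝ} (hb : 0 ≤ b) :
    IntegrableOn (fun t : ℝ => (Real.exp (-(b * t)) : ℂ) * flowDer ζ t) (Ioi 0) := by
  refine Integrable.mono' integrableOn_exp_neg_Ioi
    (((continuousOn_exp_mul_flowDer hζ b).mono Ioi_subset_Ici_self).aestronglyMeasurable
      measurableSet_Ioi) ?_
  filter_upwards [ae_restrict_mem measurableSet_Ioi] with t ht
  exact norm_exp_mul_flowDer_le hζ hb (le_of_lt ht)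

/-- Since `sⁿ` is the exponential at time `n h`, the integral over one cell differs from its term by
at most the drop of `sⁿ` plus four times the drop of `1/flowLow²`. These telescope to at most `1 +
4`, whatever `ζ`, `h` and `s` are. -/
theorem norm_geom_sum_sub_integral_le (hζ : 0 ≤ ζ.re) (hh : 0 < h) (hs0 : 0 < s) (hs1 : s < 1)
    (N : ℕ) :
    ‖∑ n ∈ Finset.range N, (s : ℂ) ^ n * flowDer ζ (n * h) -
      (1 / h : ℝ) * ∫ t in (0 : ℝ)..(N * h),
        (Real.exp (-(-Real.log s / h * t)) : ℂ) * flowDer ζ t‖ ≤ 5 := by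
  set f : ℝ → ℂ := fun t => (Real.exp (-(-Real.log s / h * t)) : ℂ) * flowDer ζ t with hf
  have hfc := continuousOn_exp_mul_flowDer hζ (-Real.log s / h)
  have hexp : ∀ n : ℕ, Real.exp (-(-Real.log s / h * (n * h))) = s ^ n := by
    intro n
    have : -(-Real.log s / h * (n * h)) = n * Real.log s := by field_simp
    rw [this, Real.exp_nat_mul, Real.exp_log hs0]
  have hlog : 0 < -Real.log s / h := div_pos (neg_pos.mpr (Real.log_neg hs0 hs1)) hh
  have hle : ∀ n : ℕ, (n : ℝ) * h ≤ (n + 1 : ℕ) * h := fun n => by push_cast; nlinarith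
  have hn0 : ∀ n : ℕ, 0 ≤ (n : ℝ) * h := fun n => by positivity
  have hint : ∀ n : ℕ, IntervalIntegrable f volume (n * h) ((n + 1 : ℕ) * h) := fun n =>
    ContinuousOn.intervalIntegrable (hfc.mono fun t ht => by
      rw [uIcc_of_le (hle n)] at ht; exact (hn0 n).trans ht.1)
  have hsum := intervalIntegral.sum_integral_adjacent_intervals (f := f) (μ := volume)
    (a := fun n : ℕ => (n : ℝ) * h) (n := N) fun n _ => hint n
  simp only [Nat.cast_zero, zero_mul] at hsum
  rw [← hsum, Finset.mul_sum, ← Finset.sum_sub_distrib]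
  set B : ℕ → ℝ := fun n => (s ^ n - s ^ (n + 1)) +
    4 * (1 / flowLow ‖ζ‖ (n * h) ^ 2 - 1 / flowLow ‖ζ‖ ((n + 1 : ℕ) * h) ^ 2) with hB
  have hterm : ∀ n : ℕ, ‖(s : ℂ) ^ n * flowDer ζ (n * h) -
      (1 / h : ℝ) * ∫ t in (n * h)..((n + 1 : ℕ) * h), f t‖ ≤ B n := by
    intro n
    have e1 : (s : ℂ) ^ n * flowDer ζ (n * h) - (1 / h : ℝ) * ∫ t in (n * h)..((n + 1 : ℕ) * h), f t
        = (1 / h : ℝ) * ∫ t in (n * h)..((n + 1 : ℕ) * h),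
          ((s : ℂ) ^ n * flowDer ζ (n * h) - f t) := by
      rw [intervalIntegral.integral_sub intervalIntegrable_const (hint n),
        intervalIntegral.integral_const, mul_sub]
      congr 1
      have : ((n + 1 : ℕ) : ℝ) * h - n * h = h := by push_cast; ring
      have hh' : (h : ℂ) ≠ 0 := by exact_mod_cast hh.ne'
      rw [this, Complex.real_smul]
      push_cast
      field_simp
    rw [e1, norm_mul, Complex.norm_real, Real.norm_of_nonneg (by positivity)]
    have hb : ‖∫ t in (n * h)..((n + 1 : ℕ) * h), ((s : ℂ) ^ n * flowDer ζ (n * h) - f t)‖ ≤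
        B n * |((n + 1 : ℕ) : ℝ) * h - n * h| := by
      refine intervalIntegral.norm_integral_le_of_norm_le_const fun t ht => ?_
      rw [uIoc_of_le (hle n)] at ht
      have ht0 : 0 ≤ t := (hn0 n).trans ht.1.le
      have h1 : Real.exp (-(-Real.log s / h * t)) ≤ s ^ n := by
        rw [← hexp n]
        exact Real.exp_le_exp.mpr (neg_le_neg (mul_le_mul_of_nonneg_left ht.1.le hlog.le))
      have h2 : s ^ (n + 1) ≤ Real.exp (-(-Real.log s / h * t)) := by
        rw [← hexp (n + 1)]
        exact Real.exp_le_exp.mpr (neg_le_neg (mul_le_mul_of_nonneg_left ht.2 hlog.le))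
      have e2 : (s : ℂ) ^ n * flowDer ζ (n * h) - f t =
          ((s ^ n - Real.exp (-(-Real.log s / h * t)) : ℝ) : ℂ) * flowDer ζ (n * h) +
          (Real.exp (-(-Real.log s / h * t)) : ℂ) * (flowDer ζ (n * h) - flowDer ζ t) := by
        simp only [hf]; push_cast; ring
      rw [e2]
      refine (norm_add_le _ _).trans (add_le_add ?_ ?_)
      · rw [norm_mul, Complex.norm_real, Real.norm_of_nonneg (by linarith)]
        refine (mul_le_of_le_one_right (by linarith) (norm_flowDer_le_one hζ (hn0 n))).trans ?_
        linarith
      · rw [norm_mul, Complex.norm_real, Real.norm_of_nonneg (Real.exp_pos _).le]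
        refine (mul_le_of_le_one_left (norm_nonneg _) (h1.trans (pow_le_one₀ hs0.le hs1.le))).trans ?_
        refine (norm_flowDer_sub_le hζ (hn0 n) ht.1.le).trans ?_
        have p1 := flowLow_pos (norm_nonneg ζ) ht0
        have p2 := flowLow_mono (norm_nonneg ζ) ht0 ht.2
        have : 1 / flowLow ‖ζ‖ ((n + 1 : ℕ) * h) ^ 2 ≤ 1 / flowLow ‖ζ‖ t ^ 2 :=
          one_div_le_one_div_of_le (by positivity) (pow_le_pow_left₀ p1.le p2 2)
        linarith
    have : ((n + 1 : ℕ) : ℝ) * h - n * h = h := by push_cast; ring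
    rw [this, abs_of_pos hh] at hb
    rw [div_mul_eq_mul_div, one_mul, div_le_iff₀ hh]
    exact hb
  refine (norm_sum_le _ _).trans ((Finset.sum_le_sum fun n _ => hterm n).trans ?_)
  rw [hB, Finset.sum_add_distrib, ← Finset.mul_sum, Finset.sum_range_sub',
    Finset.sum_range_sub' (fun n : ℕ => 1 / flowLow ‖ζ‖ (n * h) ^ 2)]
  have h1 : flowLow ‖ζ‖ ((0 : ℕ) * h) = 1 := by simp [flowLow]
  have h2 : 0 ≤ 1 / flowLow ‖ζ‖ (N * h) ^ 2 := by positivity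
  have h3 : 0 ≤ s ^ N := by positivity
  rw [h1]
  linarith

theorem abs_exp_sub_exp_le {a b t : ℝ} (ha : 0 < a) (hab : a ≤ b) (ht : 0 ≤ t) :
    |Real.exp (-(a * t)) - Real.exp (-(b * t))| ≤ (b - a) / a := by
  have h1 : Real.exp (-(b * t)) ≤ Real.exp (-(a * t)) :=
    Real.exp_le_exp.mpr (neg_le_neg (mul_le_mul_of_nonneg_right hab ht))
  rw [abs_of_nonneg (by linarith), le_div_iff₀ ha]
  have e : Real.exp (-(b * t)) = Real.exp (-(a * t)) * Real.exp (-((b - a) * t)) := by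
    rw [← Real.exp_add]; ring_nf
  have h2 : 1 - (b - a) * t ≤ Real.exp (-((b - a) * t)) := by
    have := Real.add_one_le_exp (-((b - a) * t)); linarith
  have h3 : Real.exp (-(a * t)) * (a * t) ≤ 1 := by
    have h4 := Real.add_one_le_exp (a * t)
    rw [Real.exp_neg, inv_mul_le_iff₀ (Real.exp_pos _)]
    linarith
  have h5 := Real.exp_pos (-(a * t))
  calc (Real.exp (-(a * t)) - Real.exp (-(b * t))) * a
      = Real.exp (-(a * t)) * (1 - Real.exp (-((b - a) * t))) * a := by rw [e]; ring
    _ ≤ Real.exp (-(a * t)) * ((b - a) * t) * a := by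
      have : 1 - Real.exp (-((b - a) * t)) ≤ (b - a) * t := by linarith
      gcongr
    _ = (b - a) * (Real.exp (-(a * t)) * (a * t)) := by ring
    _ ≤ (b - a) * 1 := mul_le_mul_of_nonneg_left h3 (by linarith)
    _ = b - a := mul_one _

/-- The bound is independent of `ℓ`, later `-log s`, which ranges over all positive numbers: as `x
e^{-x} ≤ 1`, only the relative change of the rate matters. -/
theorem abs_exp_div_sub_exp_div_le {ℓ h h' t : ℝ} (hℓ : 0 < ℓ) (hh : 0 < h) (hh' : 0 < h')
    (ht : 0 ≤ t) :
    |Real.exp (-(ℓ / h * t)) - Real.exp (-(ℓ / h' * t))| ≤ |1 / h - 1 / h'| * (h + h') := by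
  have e : |1 / h - 1 / h'| = |h - h'| / (h * h') := by
    rw [← abs_of_pos (mul_pos hh hh'), ← abs_div, abs_sub_comm (1 / h)]
    congr 1; field_simp
  rw [e]
  rcases le_total h h' with hle | hle
  · have h1 : ℓ / h' ≤ ℓ / h := div_le_div_of_nonneg_left hℓ.le hh hle
    rw [abs_sub_comm]
    refine (abs_exp_sub_exp_le (by positivity) h1 ht).trans ?_
    rw [abs_sub_comm, abs_of_nonneg (by linarith : 0 ≤ h' - h)]
    have e1 : (ℓ / h - ℓ / h') / (ℓ / h') = (h' - h) / (h * h') * h' := by field_simp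
    rw [e1]
    exact mul_le_mul_of_nonneg_left (by linarith) (div_nonneg (by linarith) (by positivity))
  · have h1 : ℓ / h ≤ ℓ / h' := div_le_div_of_nonneg_left hℓ.le hh' hle
    refine (abs_exp_sub_exp_le (by positivity) h1 ht).trans ?_
    rw [abs_of_nonneg (by linarith : 0 ≤ h - h')]
    have e1 : (ℓ / h' - ℓ / h) / (ℓ / h) = (h - h') / (h * h') * h := by field_simp
    rw [e1]
    exact mul_le_mul_of_nonneg_left (by linarith) (div_nonneg (by linarith) (by positivity))

theorem integral_four_exp_neg : ∫ t in Ioi (0 : ℝ), 4 * Real.exp (-t) = 4 := by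
  rw [integral_const_mul, integral_exp_neg_Ioi_zero, mul_one]

theorem norm_flowInt_le (hζ : 0 ≤ ζ.re) {b : ℝ} (hb : 0 ≤ b) : ‖flowInt ζ b‖ ≤ 4 := by
  rw [flowInt, ← integral_four_exp_neg]
  refine norm_integral_le_of_norm_le integrableOn_exp_neg_Ioi ?_
  filter_upwards [ae_restrict_mem measurableSet_Ioi] with t ht
  exact norm_exp_mul_flowDer_le hζ hb (le_of_lt ht)

theorem summable_flowSum (hζ : 0 ≤ ζ.re) (hh : 0 < h) (hs0 : 0 < s) (hs1 : s < 1) :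
    Summable fun n : ℕ => (s : ℂ) ^ n * flowDer ζ (n * h) := by
  refine Summable.of_norm_bounded (summable_geometric_of_lt_one hs0.le hs1) fun n => ?_
  rw [norm_mul, norm_pow, Complex.norm_real, Real.norm_of_nonneg hs0.le]
  exact mul_le_of_le_one_right (by positivity) (norm_flowDer_le_one hζ (by positivity))

/-- Three errors: the Riemann sum with its exact step (`5`), the change of the rate from `1/h` to
`1/h'`, and the change of the prefactor from `1/h` to `κ`. The factors `4` are `∫ 4 e^{-t} dt`. -/
theorem norm_flowSum_sub_le (hζ : 0 ≤ ζ.re) (hh : 0 < h) (hs0 : 0 < s) (hs1 : s < 1) {h' κ : ℝ}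
    (hh' : 0 < h') :
    ‖flowSum ζ h s - κ * flowInt ζ (-Real.log s / h')‖ ≤
      5 + 4 * (|1 / h - 1 / h'| * (1 + h' / h) + |1 / h - κ|) := by
  have hℓ : 0 < -Real.log s := neg_pos.mpr (Real.log_neg hs0 hs1)
  have hb : 0 ≤ -Real.log s / h := by positivity
  have hb' : 0 ≤ -Real.log s / h' := by positivity
  have h1 : ‖flowSum ζ h s - (1 / h : ℝ) * flowInt ζ (-Real.log s / h)‖ ≤ 5 := by
    have t1 := (summable_flowSum hζ hh hs0 hs1).hasSum.tendsto_sum_nat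
    have hNh : Tendsto (fun N : ℕ => (N : ℝ) * h) atTop atTop :=
      tendsto_natCast_atTop_atTop.atTop_mul_const hh
    have t2 := intervalIntegral_tendsto_integral_Ioi (0 : ℝ)
      (integrableOn_exp_mul_flowDer hζ hb) hNh
    exact le_of_tendsto (t1.sub (t2.const_mul ((1 / h : ℝ) : ℂ))).norm
      (.of_forall fun N => norm_geom_sum_sub_integral_le hζ hh hs0 hs1 N)
  have h2 : ‖flowInt ζ (-Real.log s / h) - flowInt ζ (-Real.log s / h')‖ ≤
      4 * (|1 / h - 1 / h'| * (h + h')) := by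
    rw [flowInt, flowInt, ← integral_sub (integrableOn_exp_mul_flowDer hζ hb)
      (integrableOn_exp_mul_flowDer hζ hb')]
    have e4 : 4 * (|1 / h - 1 / h'| * (h + h')) =
        ∫ t in Ioi (0 : ℝ), |1 / h - 1 / h'| * (h + h') * (4 * Real.exp (-t)) := by
      rw [integral_const_mul, integral_four_exp_neg]; ring
    rw [e4]
    refine norm_integral_le_of_norm_le (integrableOn_exp_neg_Ioi.const_mul _) ?_
    filter_upwards [ae_restrict_mem measurableSet_Ioi] with t ht
    have ht0 : 0 ≤ t := le_of_lt ht
    rw [← sub_mul, norm_mul, ← Complex.ofReal_sub, Complex.norm_real, Real.norm_eq_abs]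
    exact mul_le_mul (abs_exp_div_sub_exp_div_le hℓ hh hh' ht0) (norm_flowDer_le_exp hζ ht0)
      (norm_nonneg _) (by positivity)
  have e : flowSum ζ h s - κ * flowInt ζ (-Real.log s / h') =
      (flowSum ζ h s - (1 / h : ℝ) * flowInt ζ (-Real.log s / h)) +
      (1 / h : ℝ) * (flowInt ζ (-Real.log s / h) - flowInt ζ (-Real.log s / h')) +
      ((1 / h - κ : ℝ) : ℂ) * flowInt ζ (-Real.log s / h') := by push_cast; ring
  rw [e]
  refine (norm_add₃_le).trans ?_
  have h3 : ‖((1 / h : ℝ) : ℂ) * (flowInt ζ (-Real.log s / h) - flowInt ζ (-Real.log s / h'))‖ ≤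
      4 * (|1 / h - 1 / h'| * (1 + h' / h)) := by
    rw [norm_mul, Complex.norm_real, Real.norm_of_nonneg (by positivity)]
    refine (mul_le_mul_of_nonneg_left h2 (by positivity)).trans (le_of_eq ?_)
    field_simp
  have h4 : ‖((1 / h - κ : ℝ) : ℂ) * flowInt ζ (-Real.log s / h')‖ ≤ 4 * |1 / h - κ| := by
    rw [norm_mul, Complex.norm_real, Real.norm_eq_abs, mul_comm 4]
    exact mul_le_mul_of_nonneg_left (norm_flowInt_le hζ hb') (abs_nonneg _)
  linarith

/-- The first term is `1`, and the cocycle property of `flowDer` pulls the others back from one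
period later. So the sum can be compared with the Laplace integral at `ζ` or, up to a bounded term,
at `flow ζ h`. These are the two arguments of `L` in `q`. -/
theorem flowSum_eq (hζ : 0 ≤ ζ.re) (hh : 0 < h) (hs0 : 0 < s) (hs1 : s < 1) :
    flowSum ζ h s = 1 + s * (flowDer ζ h * flowSum (flow ζ h) h s) := by
  rw [flowSum, (summable_flowSum hζ hh hs0 hs1).tsum_eq_zero_add, flowSum, ← tsum_mul_left,
    ← tsum_mul_left]
  congr 1
  · simp [flowDer, flowDen]
  · refine tsum_congr fun n => ?_
    have : ((n + 1 : ℕ) : ℝ) * h = h + n * h := by push_cast; ring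
    rw [this, flowDer_add hζ hh.le]
    ring

end

/-! ### The derivative of the singular function -/

theorem norm_one_add_mul_exp_ge {w : ℂ} {t : ℝ} (ht : 0 ≤ t) :
    1 - ‖w‖ ≤ ‖1 + w * Complex.exp (-(t : ℂ))‖ := by
  have h1 : ‖w * Complex.exp (-(t : ℂ))‖ ≤ ‖w‖ := by
    rw [norm_mul, Complex.norm_exp]
    refine mul_le_of_le_one_right (norm_nonneg _) (Real.exp_le_one_iff.mpr ?_)
    simpa using ht
  have h2 := norm_sub_norm_le (1 : ℂ) (-(w * Complex.exp (-(t : ℂ))))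
  rw [norm_one, norm_neg, sub_neg_eq_add] at h2
  linarith

theorem hasDerivAt_lerch {w : ℂ} {β : ℝ} (hw : ‖w‖ < 1) (hβ : 0 ≤ β) :
    HasDerivAt (fun x => lerch x β)
      (-∫ t in Ioi (0 : ℝ), Complex.exp (-(((β + 1) * t : ℝ) : ℂ)) /
        (1 + w * Complex.exp (-(t : ℂ))) ^ 2) w := by
  obtain ⟨ρ, hwρ, hρ1⟩ := exists_between hw
  have hball : ball (0 : ℂ) ρ ∈ 𝓝 w := isOpen_ball.mem_nhds (by simpa using hwρ)
  have hne : ∀ x ∈ ball (0 : ℂ) ρ, ∀ t : ℝ, 0 ≤ t → 1 + x * Complex.exp (-(t : ℂ)) ≠ 0 := by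
    intro x hx t ht h
    have := norm_one_add_mul_exp_ge (w := x) ht
    rw [h, norm_zero] at this
    rw [mem_ball_zero_iff] at hx
    linarith
  have hexp : ∀ t : ℝ, ‖Complex.exp (-(((β + 1) * t : ℝ) : ℂ))‖ = Real.exp (-((β + 1) * t)) := by
    intro t
    rw [Complex.norm_exp, ← Complex.ofReal_neg, Complex.ofReal_re]
  have hexpint : ∀ C : ℝ, IntegrableOn (fun t : ℝ => C * Real.exp (-((β + 1) * t))) (Ioi 0) := by
    intro C
    have := (exp_neg_integrableOn_Ioi 0 (by linarith : 0 < β + 1)).const_mul C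
    simpa only [IntegrableOn, neg_mul] using this
  have hcont : ∀ x ∈ ball (0 : ℂ) ρ, ContinuousOn (fun t : ℝ =>
      x * Complex.exp (-(((β + 1) * t : ℝ) : ℂ)) / (1 + x * Complex.exp (-(t : ℂ)))) (Ioi 0) :=
    fun x hx => ContinuousOn.div (Continuous.continuousOn (by fun_prop))
      (Continuous.continuousOn (by fun_prop)) fun t ht => hne x hx t (le_of_lt ht)
  have hw' : w ∈ ball (0 : ℂ) ρ := by simpa using hwρ
  refine ((hasDerivAt_integral_of_dominated_loc_of_deriv_le
    (μ := volume.restrict (Ioi (0 : ℝ)))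
    (F := fun x t => x * Complex.exp (-(((β + 1) * t : ℝ) : ℂ)) / (1 + x * Complex.exp (-(t : ℂ))))
    (F' := fun x t => Complex.exp (-(((β + 1) * t : ℝ) : ℂ)) / (1 + x * Complex.exp (-(t : ℂ))) ^ 2)
    (bound := fun t => 1 / (1 - ρ) ^ 2 * Real.exp (-((β + 1) * t)))
    hball ?_ ?_ ?_ ?_ ?_ ?_).2).neg
  · filter_upwards [hball] with x hx
    exact (hcont x hx).aestronglyMeasurable measurableSet_Ioi
  · refine Integrable.mono' (hexpint (1 / (1 - ρ)))
      ((hcont w hw').aestronglyMeasurable measurableSet_Ioi) ?_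
    filter_upwards [ae_restrict_mem measurableSet_Ioi] with t ht
    have h1 := norm_one_add_mul_exp_ge (w := w) (le_of_lt ht)
    rw [norm_div, norm_mul, hexp, one_div, inv_mul_eq_div]
    refine div_le_div₀ (Real.exp_pos _).le ?_ (by linarith) (by linarith)
    exact mul_le_of_le_one_left (Real.exp_pos _).le (by linarith)
  · refine ContinuousOn.aestronglyMeasurable ?_ measurableSet_Ioi
    exact ContinuousOn.div (Continuous.continuousOn (by fun_prop))
      (Continuous.continuousOn (by fun_prop)) fun t ht => pow_ne_zero 2 (hne w hw' t (le_of_lt ht))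
  · filter_upwards [ae_restrict_mem measurableSet_Ioi] with t ht x hx
    have h1 := norm_one_add_mul_exp_ge (w := x) (le_of_lt ht)
    rw [mem_ball_zero_iff] at hx
    rw [norm_div, norm_pow, hexp, one_div, inv_mul_eq_div]
    refine div_le_div_of_nonneg_left (Real.exp_pos _).le (by nlinarith) ?_
    exact pow_le_pow_left₀ (by linarith) (by linarith) 2
  · exact hexpint _
  · filter_upwards [ae_restrict_mem measurableSet_Ioi] with t ht x hx
    have h0 := hne x hx t (le_of_lt ht)
    have h1 : HasDerivAt (fun x : ℂ => x * Complex.exp (-(((β + 1) * t : ℝ) : ℂ)))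
        (1 * Complex.exp (-(((β + 1) * t : ℝ) : ℂ))) x := (hasDerivAt_id x).mul_const _
    have h2 : HasDerivAt (fun x : ℂ => 1 + x * Complex.exp (-(t : ℂ)))
        (1 * Complex.exp (-(t : ℂ))) x := ((hasDerivAt_id x).mul_const _).const_add _
    refine (h1.div h2 h0).congr_deriv ?_
    congr 1
    ring

theorem norm_expNegXi_lt_one {α : ℝ} (hα : 0 < α) {z : ℂ} (hz : 0 < z.re) :
    ‖expNegXi α z‖ < 1 := by
  have h1 : ‖(α : ℂ) - z‖ ^ 2 < ‖(α : ℂ) + z‖ ^ 2 := by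
    rw [← Complex.normSq_eq_norm_sq, ← Complex.normSq_eq_norm_sq, Complex.normSq_apply,
      Complex.normSq_apply]
    simp only [Complex.sub_re, Complex.sub_im, Complex.add_re, Complex.add_im, Complex.ofReal_re,
      Complex.ofReal_im]
    nlinarith [mul_pos hα hz]
  have h2 : ‖(α : ℂ) - z‖ < ‖(α : ℂ) + z‖ := lt_of_pow_lt_pow_left₀ 2 (norm_nonneg _) h1
  rw [expNegXi, norm_div, div_lt_one ((norm_nonneg _).trans_lt h2)]
  exact h2

/-- With `T = a + t` one has `(α + z)(1 + e^{-T}(α - z)/(α + z)) = 2α e^{-T/2} flowDen (z/α) T`.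
Hence the derivative of the integrand of `L`, times the chain rule factor `-2α/(α + z)²`, is an
exponential times `flowDer`, and the integral is a Laplace transform along the flow. -/
theorem hasDerivAt_lerch_expNegXi {α β a : ℝ} (hα : 0 < α) (hβ : 0 ≤ β) (ha : 0 ≤ a) {z : ℂ}
    (hz : 0 < z.re) :
    HasDerivAt (fun x => lerch (Real.exp (-a) * expNegXi α x) β)
      (1 / (2 * α) * (flowDer (z / α) a * flowInt (flow (z / α) a) β)) z := by
  have hα' : (α : ℂ) ≠ 0 := by exact_mod_cast hα.ne'
  set ζ : ℂ := z / α with hζdef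
  have hζ : 0 ≤ ζ.re := by
    rw [hζdef, Complex.div_ofReal_re]; positivity
  have hzα : (α : ℂ) + z ≠ 0 := by
    intro h
    have := congrArg Complex.re h
    simp only [Complex.add_re, Complex.ofReal_re, Complex.zero_re] at this
    linarith
  have hw1 := norm_expNegXi_lt_one hα hz
  have hlt : ‖(Real.exp (-a) : ℂ) * expNegXi α z‖ < 1 := by
    rw [norm_mul, Complex.norm_real, Real.norm_of_nonneg (Real.exp_pos _).le]
    refine (mul_le_of_le_one_left (norm_nonneg _) ?_).trans_lt hw1
    exact Real.exp_le_one_iff.mpr (by linarith)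
  have hd : HasDerivAt (fun x => (Real.exp (-a) : ℂ) * expNegXi α x)
      (Real.exp (-a) * (-(2 * α) / (α + z) ^ 2)) z := by
    have h1 : HasDerivAt (fun x : ℂ => (α : ℂ) - x) (-1) z := (hasDerivAt_id z).const_sub _
    have h2 : HasDerivAt (fun x : ℂ => (α : ℂ) + x) 1 z := (hasDerivAt_id z).const_add _
    refine ((h1.div h2 hzα).congr_deriv ?_).const_mul _
    congr 1; ring
  refine (HasDerivAt.comp z (hasDerivAt_lerch hlt hβ) hd).congr_deriv ?_
  rw [flowInt, neg_mul, ← mul_neg, mul_comm, ← integral_const_mul, ← integral_const_mul,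
    ← integral_const_mul]
  refine setIntegral_congr_fun measurableSet_Ioi fun t ht => ?_
  have ht0 : 0 ≤ t := le_of_lt ht
  have hE : flowDer ζ a * flowDer (flow ζ a) t = flowDer ζ (a + t) := (flowDer_add hζ ha).symm
  have hEn := flowDen_ne_zero hζ (add_nonneg ha ht0)
  rw [mul_left_comm (flowDer ζ a), hE, flowDer]
  set T := a + t with hT
  have key : (α + z) * (1 + Real.exp (-a) * expNegXi α z * Complex.exp (-(t : ℂ))) =
      2 * α * (Real.exp (-(T / 2)) * flowDen ζ T) := by
    have e1 : (Real.exp (-a) : ℂ) * Complex.exp (-(t : ℂ)) = Real.exp (-T) := by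
      rw [hT, Complex.ofReal_exp, ← Complex.exp_add, Complex.ofReal_exp]; push_cast; ring_nf
    have e2 : (α + z) * (1 + Real.exp (-a) * expNegXi α z * Complex.exp (-(t : ℂ))) =
        (α + z) + (α - z) * Real.exp (-T) := by
      rw [← e1, expNegXi]; field_simp
    have e3 : (Real.exp (-(T / 2)) : ℂ) * Real.exp (T / 2) = 1 := by
      rw [← Complex.ofReal_mul, ← Real.exp_add]; simp
    have e4 : (Real.exp (-(T / 2)) : ℂ) * Real.exp (-(T / 2)) = Real.exp (-T) := by
      rw [← Complex.ofReal_mul, ← Real.exp_add]; ring_nf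
    rw [e2, flowDen, Real.cosh_eq, Real.sinh_eq, hζdef, ← e4]
    push_cast at e3 ⊢
    field_simp
    linear_combination (-(α : ℂ) - z) * e3
  have hden : 1 + (Real.exp (-a) : ℂ) * expNegXi α z * Complex.exp (-(t : ℂ)) ≠ 0 := by
    intro h
    have := norm_one_add_mul_exp_ge (w := (Real.exp (-a) : ℂ) * expNegXi α z) ht0
    rw [h, norm_zero] at this
    linarith
  have key2 : ((α : ℂ) + z) ^ 2 * (1 + Real.exp (-a) * expNegXi α z * Complex.exp (-(t : ℂ))) ^ 2 =
      4 * α ^ 2 * (Real.exp (-T) * flowDen ζ T ^ 2) := by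
    have e4 : (Real.exp (-(T / 2)) : ℂ) * Real.exp (-(T / 2)) = Real.exp (-T) := by
      rw [← Complex.ofReal_mul, ← Real.exp_add]; ring_nf
    rw [← mul_pow, key, ← e4]; ring
  have e5 : Complex.exp (-(((β + 1) * t : ℝ) : ℂ)) * Real.exp (-a) =
      Real.exp (-(β * t)) * Real.exp (-T) := by
    rw [← Complex.ofReal_neg, ← Complex.ofReal_exp, ← Complex.ofReal_mul, ← Complex.ofReal_mul,
      ← Real.exp_add, ← Real.exp_add, hT]
    ring_nf
  have hTn : (Real.exp (-T) : ℂ) ≠ 0 := by exact_mod_cast (Real.exp_pos _).ne'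
  rw [show -((Real.exp (-a) : ℂ) * (-(2 * α) / (α + z) ^ 2)) *
      (Complex.exp (-(((β + 1) * t : ℝ) : ℂ)) /
        (1 + Real.exp (-a) * expNegXi α z * Complex.exp (-(t : ℂ))) ^ 2) =
      2 * α * (Complex.exp (-(((β + 1) * t : ℝ) : ℂ)) * Real.exp (-a)) / (((α : ℂ) + z) ^ 2 *
        (1 + Real.exp (-a) * expNegXi α z * Complex.exp (-(t : ℂ))) ^ 2) by
      field_simp, key2, e5]
  field_simp
  ring

/-! ### The geometry of the two circles -/

/-- Two nested circles with centres `cᵢ`, `cₑ` and radii `rᵢ`, `rₑ` in the coaxal system with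
limiting points `± α`. -/
structure IsCoaxal (rᵢ rₑ α cᵢ cₑ : ℝ) : Prop where
  ri_pos : 0 < rᵢ
  re_pos : 0 < rₑ
  alpha_pos : 0 < α
  ci_pos : 0 < cᵢ
  ce_pos : 0 < cₑ
  ci_sq : cᵢ ^ 2 = α ^ 2 + rᵢ ^ 2
  ce_sq : cₑ ^ 2 = α ^ 2 + rₑ ^ 2
  lt : cᵢ < cₑ
  sub_lt : cₑ - cᵢ < rₑ - rᵢ

/-- The coordinate `ξ` of a circle with centre `c` in the coaxal system. -/
def xiOf (α c : ℝ) : ℝ := 1 / 2 * Real.log ((c + α) / (c - α))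

section circle

variable {α c r : ℝ}

theorem lt_center (hr : 0 < r) (hc : 0 < c) (h : c ^ 2 = α ^ 2 + r ^ 2) : α < c :=
  lt_of_pow_lt_pow_left₀ 2 hc.le (by rw [h]; linarith [pow_pos hr 2])

theorem exp_xiOf (hα : 0 < α) (hr : 0 < r) (hc : 0 < c) (h : c ^ 2 = α ^ 2 + r ^ 2) :
    Real.exp (xiOf α c) = (c + α) / r := by
  have h1 := lt_center hr hc h
  have h2 : (c + α) / (c - α) = ((c + α) / r) ^ 2 := by
    have : c - α ≠ 0 := by linarith
    field_simp
    nlinarith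
  rw [xiOf, h2, Real.log_pow, ← mul_assoc]
  norm_num
  rw [Real.exp_log (by positivity)]

theorem exp_neg_xiOf (hα : 0 < α) (hr : 0 < r) (hc : 0 < c) (h : c ^ 2 = α ^ 2 + r ^ 2) :
    Real.exp (-xiOf α c) = (c - α) / r := by
  rw [Real.exp_neg, exp_xiOf hα hr hc h, inv_div, div_eq_div_iff (by positivity) hr.ne']
  nlinarith

theorem cosh_xiOf (hα : 0 < α) (hr : 0 < r) (hc : 0 < c) (h : c ^ 2 = α ^ 2 + r ^ 2) :
    Real.cosh (xiOf α c) = c / r := by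
  rw [Real.cosh_eq, exp_xiOf hα hr hc h, exp_neg_xiOf hα hr hc h]; ring

theorem sinh_xiOf (hα : 0 < α) (hr : 0 < r) (hc : 0 < c) (h : c ^ 2 = α ^ 2 + r ^ 2) :
    Real.sinh (xiOf α c) = α / r := by
  rw [Real.sinh_eq, exp_xiOf hα hr hc h, exp_neg_xiOf hα hr hc h]; ring

theorem re_pos_of_mem_ball (hα : 0 < α) (hc : 0 < c) (h : c ^ 2 = α ^ 2 + r ^ 2)
    {z : ℂ} (hz : z ∈ ball (c : ℂ) r) : 0 < z.re := by
  have h1 : r < c := lt_of_pow_lt_pow_left₀ 2 hc.le (by rw [h]; linarith [pow_pos hα 2])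
  rw [mem_ball, dist_eq_norm] at hz
  have h2 := (abs_lt.mp ((Complex.abs_re_le_norm (z - c)).trans_lt hz)).1
  simp only [Complex.sub_re, Complex.ofReal_re] at h2
  linarith

/-- A disk of the coaxal system is a sublevel set of `|expNegXi α z|`. -/
theorem mem_ball_iff_norm_expNegXi (hα : 0 < α) (hr : 0 < r) (hc : 0 < c)
    (h : c ^ 2 = α ^ 2 + r ^ 2) {z : ℂ} (hz : 0 < z.re) :
    z ∈ ball (c : ℂ) r ↔ ‖expNegXi α z‖ < Real.exp (-xiOf α c) := by
  have hlt := lt_center hr hc h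
  have e1 : ‖z - c‖ ^ 2 = z.re ^ 2 + z.im ^ 2 + α ^ 2 - 2 * c * z.re + r ^ 2 := by
    rw [← Complex.normSq_eq_norm_sq, Complex.normSq_apply]
    simp only [Complex.sub_re, Complex.sub_im, Complex.ofReal_re, Complex.ofReal_im]
    nlinarith
  have e2 : ‖(α : ℂ) - z‖ ^ 2 = (α - z.re) ^ 2 + z.im ^ 2 := by
    rw [← Complex.normSq_eq_norm_sq, Complex.normSq_apply]
    simp only [Complex.sub_re, Complex.sub_im, Complex.ofReal_re, Complex.ofReal_im]
    ring
  have e3 : ‖(α : ℂ) + z‖ ^ 2 = (α + z.re) ^ 2 + z.im ^ 2 := by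
    rw [← Complex.normSq_eq_norm_sq, Complex.normSq_apply]
    simp only [Complex.add_re, Complex.add_im, Complex.ofReal_re, Complex.ofReal_im]
    ring
  have h3 : 0 < ‖(α : ℂ) + z‖ := by
    have : 0 < ‖(α : ℂ) + z‖ ^ 2 := by rw [e3]; positivity
    refine (norm_nonneg _).lt_of_ne' fun h0 => ?_
    rw [h0] at this
    norm_num at this
  rw [mem_ball, dist_eq_norm, exp_neg_xiOf hα hr hc h, expNegXi, norm_div,
    div_lt_div_iff₀ h3 hr, ← pow_lt_pow_iff_left₀ (norm_nonneg _) hr.le two_ne_zero,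
    ← pow_lt_pow_iff_left₀ (by positivity) (mul_nonneg (by linarith) h3.le) two_ne_zero,
    mul_pow, mul_pow, e1, e2, e3]
  have e4 : r ^ 2 = (c - α) * (c + α) := by linarith
  have e5 : ((α - z.re) ^ 2 + z.im ^ 2) * r ^ 2 - (c - α) ^ 2 * ((α + z.re) ^ 2 + z.im ^ 2) =
      2 * α * (c - α) * (z.re ^ 2 + z.im ^ 2 + α ^ 2 - 2 * c * z.re) := by
    rw [e4]; ring
  -- By `e5` both inequalities reduce to the sign of `|z|² + α² - 2c Re z`.
  have h6 : 0 < 2 * α * (c - α) := mul_pos (by positivity) (by linarith)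
  constructor
  · intro h7
    have : 2 * α * (c - α) * (z.re ^ 2 + z.im ^ 2 + α ^ 2 - 2 * c * z.re) < 0 :=
      mul_neg_of_pos_of_neg h6 (by linarith)
    linarith
  · intro h7
    have h8 : 2 * α * (c - α) * (z.re ^ 2 + z.im ^ 2 + α ^ 2 - 2 * c * z.re) < 0 := by linarith
    have := neg_of_mul_neg_right h8 h6.le
    linarith

/-- The reflection in a circle of the coaxal system in terms of `expNegXi`. -/
theorem expNegXi_refl (hα : 0 < α) (hr : 0 < r) (hc : 0 < c)
    (h : c ^ 2 = α ^ 2 + r ^ 2) {z : ℂ} (hz : z ≠ c) (hzα : z ≠ α) :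
    (Real.exp (-2 * xiOf α c) : ℂ) * expXiConj α z = expNegXi α (refl c r z) := by
  have hlt := lt_center hr hc h
  have e0 : Real.exp (-2 * xiOf α c) = (c - α) / (c + α) := by
    have : -2 * xiOf α c = -xiOf α c - xiOf α c := by ring
    rw [this, Real.exp_sub, exp_neg_xiOf hα hr hc h, exp_xiOf hα hr hc h]
    have : c + α ≠ 0 := by positivity
    field_simp
  have h1 : conj z - (c : ℂ) ≠ 0 := by
    intro h'
    apply hz
    have := congrArg conj (sub_eq_zero.mp h')
    simpa using this
  have h2 : (α : ℂ) - conj z ≠ 0 := by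
    intro h'
    apply hzα
    have := congrArg conj (sub_eq_zero.mp h').symm
    simpa using this
  have h3 : (c : ℂ) + α ≠ 0 := by exact_mod_cast (by positivity : c + α ≠ 0)
  have hrr : (r : ℂ) ^ 2 = (c - α) * (c + α) := by
    have : r ^ 2 = (c - α) * (c + α) := by linarith
    exact_mod_cast this
  have e2 : refl c r z = c + (r : ℂ) ^ 2 / (conj z - c) := by
    simp [refl, reflConj]
  rw [e0, expXiConj, expNegXi, e2, hrr]
  have e3 : (α : ℂ) - (c + (c - α) * (c + α) / (conj z - c)) =
      (c - α) * (α + conj z) * (-1) / (conj z - c) := by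
    field_simp; ring
  have e4 : (α : ℂ) + (c + (c - α) * (c + α) / (conj z - c)) =
      (c + α) * (α - conj z) * (-1) / (conj z - c) := by
    field_simp; ring
  rw [e3, e4]
  simp only [map_div₀, map_add, map_sub, Complex.conj_ofReal]
  push_cast
  field_simp

end circle

/-! ### The flow in the coaxal system -/

theorem flow_re_pos {ζ : ℂ} {t : ℝ} (hζ : 0 < ζ.re) (ht : 0 ≤ t) : 0 < (flow ζ t).re := by
  have hE := flowDen_ne_zero hζ.le ht
  rw [flow, Complex.div_re, ← add_div]
  refine div_pos ?_ (Complex.normSq_pos.mpr hE)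
  simp only [flowDen, Complex.add_re, Complex.add_im, Complex.mul_re, Complex.mul_im,
    Complex.ofReal_re, Complex.ofReal_im]
  have h1 := sinh_half_nonneg ht
  have h2 := Real.cosh_pos (t / 2)
  have e : (Real.sinh (t / 2) + (ζ.re * Real.cosh (t / 2) - ζ.im * 0)) *
      (Real.cosh (t / 2) + (ζ.re * Real.sinh (t / 2) - ζ.im * 0)) +
      (0 + (ζ.re * 0 + ζ.im * Real.cosh (t / 2))) * (0 + (ζ.re * 0 + ζ.im * Real.sinh (t / 2))) =
      Real.sinh (t / 2) * Real.cosh (t / 2) * (1 + ζ.re ^ 2 + ζ.im ^ 2) +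
        ζ.re * (Real.sinh (t / 2) ^ 2 + Real.cosh (t / 2) ^ 2) := by ring
  rw [e]
  positivity

/-- The shift `ξ ↦ ξ + t` of bipolar coordinates with poles `± α`. -/
def shift (α t : ℝ) (z : ℂ) : ℂ := α * flow (z / α) t

section shift

variable {α s t : ℝ} {z : ℂ}

theorem div_re_pos (hα : 0 < α) (hz : 0 < z.re) : 0 < (z / (α : ℂ)).re := by
  rw [Complex.div_ofReal_re]; positivity

theorem shift_re_pos (hα : 0 < α) (hz : 0 < z.re) (ht : 0 ≤ t) : 0 < (shift α t z).re := by
  rw [shift, Complex.re_ofReal_mul]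
  exact mul_pos hα (flow_re_pos (div_re_pos hα hz) ht)

theorem shift_div (hα : 0 < α) : shift α t z / α = flow (z / α) t := by
  have : (α : ℂ) ≠ 0 := by exact_mod_cast hα.ne'
  rw [shift, mul_div_cancel_left₀ _ this]

theorem shift_shift (hα : 0 < α) (hz : 0 < z.re) (hs : 0 ≤ s) (ht : 0 ≤ t) :
    shift α t (shift α s z) = shift α (s + t) z := by
  rw [shift, shift_div hα, flow_flow (div_re_pos hα hz).le hs ht, shift]

theorem shift_zero (hα : 0 < α) : shift α 0 z = z := by
  have : (α : ℂ) ≠ 0 := by exact_mod_cast hα.ne'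
  simp [shift, flow, flowDen, mul_div_cancel₀ _ this]

theorem hasDerivAt_shift (hα : 0 < α) (hz : 0 < z.re) (ht : 0 ≤ t) :
    HasDerivAt (shift α t) (flowDer (z / α) t) z := by
  have hα' : (α : ℂ) ≠ 0 := by exact_mod_cast hα.ne'
  have h1 : HasDerivAt (fun x : ℂ => x / (α : ℂ)) (1 / α) z := (hasDerivAt_id z).div_const _
  have h2 := (HasDerivAt.comp z (hasDerivAt_flow (div_re_pos hα hz).le ht) h1).const_mul (α : ℂ)
  refine h2.congr_deriv ?_
  field_simp

/-- The coordinate `(α - z)/(α + z)` sends the fixed points `α`, `-α` to `0`, `∞` and so linearizes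
the flow. -/
theorem expNegXi_shift (hα : 0 < α) (hz : 0 < z.re) (ht : 0 ≤ t) :
    expNegXi α (shift α t z) = Real.exp (-t) * expNegXi α z := by
  have hα' : (α : ℂ) ≠ 0 := by exact_mod_cast hα.ne'
  have hE := flowDen_ne_zero (div_re_pos hα hz).le ht
  set ζ := z / (α : ℂ) with hζ
  have hzζ : z = α * ζ := by rw [hζ, mul_div_cancel₀ _ hα']
  have h1 : (Real.exp (-(t / 2)) : ℂ) = Real.cosh (t / 2) - Real.sinh (t / 2) := by
    rw [Real.cosh_eq, Real.sinh_eq]; push_cast; ring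
  have h2 : (Real.exp (t / 2) : ℂ) = Real.cosh (t / 2) + Real.sinh (t / 2) := by
    rw [Real.cosh_eq, Real.sinh_eq]; push_cast; ring
  have e1 : (α : ℂ) - shift α t z = α * (Real.exp (-(t / 2)) * (1 - ζ)) / flowDen ζ t := by
    rw [shift, ← hζ, flow, h1, eq_div_iff hE, sub_mul, mul_assoc, div_mul_cancel₀ _ hE, flowDen]
    ring
  have e2 : (α : ℂ) + shift α t z = α * (Real.exp (t / 2) * (1 + ζ)) / flowDen ζ t := by
    rw [shift, ← hζ, flow, h2, eq_div_iff hE, add_mul, mul_assoc, div_mul_cancel₀ _ hE, flowDen]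
    ring
  have h3 : (1 : ℂ) + ζ ≠ 0 := by
    intro h
    have h4 := congrArg Complex.re h
    have h5 := div_re_pos hα hz
    simp only [Complex.add_re, Complex.one_re, Complex.zero_re] at h4
    linarith
  have h4 : (Real.exp (t / 2) : ℂ) ≠ 0 := by exact_mod_cast (Real.exp_pos _).ne'
  have h5 : (Real.exp (-t) : ℂ) * Real.exp (t / 2) = Real.exp (-(t / 2)) := by
    rw [← Complex.ofReal_mul, ← Real.exp_add]; ring_nf
  rw [expNegXi, expNegXi, e1, e2, ← h5, hzζ]
  rw [show (α : ℂ) - α * ζ = α * (1 - ζ) by ring, show (α : ℂ) + α * ζ = α * (1 + ζ) by ring]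
  field_simp

end shift

namespace IsCoaxal

variable {rᵢ rₑ α cᵢ cₑ : ℝ} {z : ℂ}

/-- Twice the difference of the `ξ` coordinates of the two circles. -/
def period (α cᵢ cₑ : ℝ) : ℝ := 2 * (xiOf α cᵢ - xiOf α cₑ)

theorem sinh_period (H : IsCoaxal rᵢ rₑ α cᵢ cₑ) :
    Real.sinh (period α cᵢ cₑ / 2) = α * (cₑ - cᵢ) / (rᵢ * rₑ) := by
  have h1 := H.ri_pos
  have h2 := H.re_pos
  rw [period, mul_div_cancel_left₀ _ two_ne_zero, Real.sinh_sub,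
    cosh_xiOf H.alpha_pos h1 H.ci_pos H.ci_sq, cosh_xiOf H.alpha_pos h2 H.ce_pos H.ce_sq,
    sinh_xiOf H.alpha_pos h1 H.ci_pos H.ci_sq, sinh_xiOf H.alpha_pos h2 H.ce_pos H.ce_sq]
  field_simp

theorem cosh_period (H : IsCoaxal rᵢ rₑ α cᵢ cₑ) :
    Real.cosh (period α cᵢ cₑ / 2) = (cᵢ * cₑ - α ^ 2) / (rᵢ * rₑ) := by
  have h1 := H.ri_pos
  have h2 := H.re_pos
  rw [period, mul_div_cancel_left₀ _ two_ne_zero, Real.cosh_sub,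
    cosh_xiOf H.alpha_pos h1 H.ci_pos H.ci_sq, cosh_xiOf H.alpha_pos h2 H.ce_pos H.ce_sq,
    sinh_xiOf H.alpha_pos h1 H.ci_pos H.ci_sq, sinh_xiOf H.alpha_pos h2 H.ce_pos H.ce_sq]
  field_simp

theorem period_pos (H : IsCoaxal rᵢ rₑ α cᵢ cₑ) : 0 < period α cᵢ cₑ := by
  have h1 : 0 < Real.sinh (period α cᵢ cₑ / 2) := by
    rw [H.sinh_period]
    have := H.ri_pos
    have := H.re_pos
    have := H.alpha_pos
    have := H.lt
    exact div_pos (mul_pos H.alpha_pos (by linarith)) (by positivity)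
  have := Real.sinh_pos_iff.mp h1
  linarith

theorem closedBall_subset (H : IsCoaxal rᵢ rₑ α cᵢ cₑ) :
    closedBall (cᵢ : ℂ) rᵢ ⊆ ball (cₑ : ℂ) rₑ := by
  refine closedBall_subset_ball' ?_
  rw [dist_eq_norm, ← Complex.ofReal_sub, Complex.norm_real, Real.norm_eq_abs, abs_sub_comm,
    abs_of_pos (by linarith [H.lt])]
  linarith [H.sub_lt]

theorem re_pos_of_mem (H : IsCoaxal rᵢ rₑ α cᵢ cₑ) (hz : z ∈ ball (cₑ : ℂ) rₑ) : 0 < z.re :=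
  re_pos_of_mem_ball H.alpha_pos H.ce_pos H.ce_sq hz

theorem shift_mem_ball (H : IsCoaxal rᵢ rₑ α cᵢ cₑ) (hz : z ∈ ball (cₑ : ℂ) rₑ) {t : ℝ}
    (ht : 0 ≤ t) : shift α t z ∈ ball (cₑ : ℂ) rₑ := by
  have hre := H.re_pos_of_mem hz
  have h1 := (mem_ball_iff_norm_expNegXi H.alpha_pos H.re_pos H.ce_pos H.ce_sq hre).mp hz
  refine (mem_ball_iff_norm_expNegXi H.alpha_pos H.re_pos H.ce_pos H.ce_sq
    (shift_re_pos H.alpha_pos hre ht)).mpr (lt_of_le_of_lt ?_ h1)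
  rw [expNegXi_shift H.alpha_pos hre ht, norm_mul, Complex.norm_real,
    Real.norm_of_nonneg (Real.exp_pos _).le]
  exact mul_le_of_le_one_left (norm_nonneg _) (Real.exp_le_one_iff.mpr (by linarith))

/-- The shift by `2(ξᵢ - ξₑ)` moves the level `ξₑ` to `2ξᵢ - ξₑ`, which lies beyond `ξᵢ`. -/
theorem shift_period_mem (H : IsCoaxal rᵢ rₑ α cᵢ cₑ) (hz : z ∈ ball (cₑ : ℂ) rₑ) :
    shift α (period α cᵢ cₑ) z ∈ ball (cᵢ : ℂ) rᵢ := by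
  have hre := H.re_pos_of_mem hz
  have hp := H.period_pos
  have h1 := (mem_ball_iff_norm_expNegXi H.alpha_pos H.re_pos H.ce_pos H.ce_sq hre).mp hz
  refine (mem_ball_iff_norm_expNegXi H.alpha_pos H.ri_pos H.ci_pos H.ci_sq
    (shift_re_pos H.alpha_pos hre hp.le)).mpr ?_
  rw [expNegXi_shift H.alpha_pos hre hp.le, norm_mul, Complex.norm_real,
    Real.norm_of_nonneg (Real.exp_pos _).le]
  calc _ < Real.exp (-period α cᵢ cₑ) * Real.exp (-xiOf α cₑ) :=
        mul_lt_mul_of_pos_left h1 (Real.exp_pos _)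
    _ ≤ _ := by
        rw [← Real.exp_add]
        refine Real.exp_le_exp.mpr ?_
        unfold period at hp ⊢
        linarith

/-- Both sides are Möbius maps, and `sinh_period`, `cosh_period` identify their coefficients. The
centre is excluded because there `refl` takes a default value instead of `∞`. -/
theorem shift_period_eq_refl_refl (H : IsCoaxal rᵢ rₑ α cᵢ cₑ) (hz : z ∈ ball (cₑ : ℂ) rₑ)
    (hzc : z ≠ cₑ) : shift α (period α cᵢ cₑ) z = refl cᵢ rᵢ (refl cₑ rₑ z) := by
  have hre := H.re_pos_of_mem hz
  have hα' : (α : ℂ) ≠ 0 := by exact_mod_cast H.alpha_pos.ne'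
  have hri : (rᵢ : ℂ) ≠ 0 := by exact_mod_cast H.ri_pos.ne'
  have hrₑ : (rₑ : ℂ) ≠ 0 := by exact_mod_cast H.re_pos.ne'
  have hE := flowDen_ne_zero (div_re_pos H.alpha_pos hre).le H.period_pos.le
  have hz0 : z - cₑ ≠ 0 := sub_ne_zero.mpr hzc
  have hci2 : (cᵢ : ℂ) ^ 2 = α ^ 2 + rᵢ ^ 2 := by exact_mod_cast H.ci_sq
  have hce2 : (cₑ : ℂ) ^ 2 = α ^ 2 + rₑ ^ 2 := by exact_mod_cast H.ce_sq
  have e1 : refl cᵢ rᵢ (refl cₑ rₑ z) = cᵢ + rᵢ ^ 2 / (cₑ + rₑ ^ 2 / (z - cₑ) - cᵢ) := by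
    simp [refl, reflConj]
  have hden : flowDen (z / α) (period α cᵢ cₑ) =
      ((cₑ - cᵢ) * z + (cᵢ * cₑ - α ^ 2)) / (rᵢ * rₑ) := by
    rw [flowDen, H.sinh_period, H.cosh_period]
    push_cast
    field_simp
    ring
  rw [hden] at hE
  have hE' : ((cₑ : ℂ) - cᵢ) * z + (cᵢ * cₑ - α ^ 2) ≠ 0 := (div_ne_zero_iff.mp hE).1
  have e2 : (cₑ : ℂ) + rₑ ^ 2 / (z - cₑ) - cᵢ =
      ((cₑ - cᵢ) * z + (cᵢ * cₑ - α ^ 2)) / (z - cₑ) := by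
    rw [eq_div_iff hz0, sub_mul, add_mul, div_mul_cancel₀ _ hz0]
    linear_combination -hce2
  have e3 : (cᵢ : ℂ) + rᵢ ^ 2 / (((cₑ - cᵢ) * z + (cᵢ * cₑ - α ^ 2)) / (z - cₑ)) =
      (cᵢ * ((cₑ - cᵢ) * z + (cᵢ * cₑ - α ^ 2)) + rᵢ ^ 2 * (z - cₑ)) /
        ((cₑ - cᵢ) * z + (cᵢ * cₑ - α ^ 2)) := by
    generalize ((cₑ : ℂ) - cᵢ) * z + (cᵢ * cₑ - α ^ 2) = D at hE'
    rw [add_div, mul_div_cancel_right₀ _ hE', div_div_eq_mul_div]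
  have e4 : shift α (period α cᵢ cₑ) z = (α ^ 2 * (cₑ - cᵢ) + z * (cᵢ * cₑ - α ^ 2)) /
      ((cₑ - cᵢ) * z + (cᵢ * cₑ - α ^ 2)) := by
    rw [shift, flow, hden, H.sinh_period, H.cosh_period]
    generalize ((cₑ : ℂ) - cᵢ) * z + (cᵢ * cₑ - α ^ 2) = D at hE'
    push_cast
    field_simp
  rw [e1, e2, e3, e4]
  congr 1
  linear_combination ((z : ℂ) - cₑ) * hci2

end IsCoaxal

theorem xiInt_eq (rᵢ rₑ ε : ℝ) : xiInt rᵢ rₑ ε = xiOf (alpha rᵢ rₑ ε) (cInt rᵢ rₑ ε) := rfl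

theorem xiExt_eq (rᵢ rₑ ε : ℝ) : xiExt rᵢ rₑ ε = xiOf (alpha rᵢ rₑ ε) (cExt rᵢ rₑ ε) := rfl

/-- The configuration of the problem is coaxal. -/
theorem isCoaxal {rᵢ rₑ ε : ℝ} (hri : 0 < rᵢ) (hr : rᵢ < rₑ) (hε : 0 < ε) (hεr : ε < rₑ - rᵢ) :
    IsCoaxal rᵢ rₑ (alpha rᵢ rₑ ε) (cInt rᵢ rₑ ε) (cExt rᵢ rₑ ε) := by
  have hd : 0 < rₑ - rᵢ - ε := by linarith
  have hd' := hd.ne'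
  have hQ : 0 < ε * (2 * rᵢ + ε) * (2 * rₑ - ε) * (2 * rₑ - 2 * rᵢ - ε) :=
    mul_pos (mul_pos (mul_pos hε (by linarith)) (by linarith)) (by linarith)
  have hα2 : alpha rᵢ rₑ ε ^ 2 = ε * (2 * rᵢ + ε) * (2 * rₑ - ε) * (2 * rₑ - 2 * rᵢ - ε) /
      (2 * (rₑ - rᵢ - ε)) ^ 2 := by
    rw [alpha, div_pow, Real.sq_sqrt hQ.le]
  have hci : 0 < cInt rᵢ rₑ ε := by
    rw [cInt]
    refine div_pos ?_ (by linarith)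
    nlinarith
  refine ⟨hri, hri.trans hr, div_pos (Real.sqrt_pos.mpr hQ) (by linarith), hci, ?_, ?_, ?_, ?_, ?_⟩
  · rw [cExt]; linarith
  · rw [hα2, cInt]; field_simp; ring
  · rw [hα2, cExt, cInt]; field_simp; ring
  · rw [cExt]; linarith
  · rw [cExt]; linarith

/-! ### Unfolding the transmission condition -/

/-- The complex gradient at `z` of `u ∘ refl c r`, where `p` is the complex gradient of `u`. -/
def reflGrad (c r : ℝ) (p : ℂ → ℂ) (z : ℂ) : ℂ := conj (p (refl c r z)) * (-(r ^ 2 / (z - c) ^ 2))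

theorem HasCGrad.comp_refl {u : ℂ → ℝ} {p : ℂ → ℂ} {c r : ℝ} {z : ℂ}
    (h : HasCGrad u (p (refl c r z)) (refl c r z)) (hz : z ≠ c) :
    HasCGrad (fun x => u (refl c r x)) (reflGrad c r p z) z :=
  h.comp_anti (hasDerivAt_reflConj hz)

theorem re_mul_reflGrad {c r : ℝ} {p : ℂ → ℂ} {z : ℂ} (hz : z ≠ c) :
    ((z - c) * reflGrad c r p z).re = -((refl c r z - c) * p (refl c r z)).re :=
  radial_comp_refl hz

theorem continuousAt_reflGrad {c r : ℝ} {p : ℂ → ℂ} {z : ℂ} (hz : z ≠ c)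
    (hp : ContinuousAt p (refl c r z)) : ContinuousAt (reflGrad c r p) z := by
  have hz' : z - c ≠ 0 := sub_ne_zero.mpr hz
  refine (Complex.continuous_conj.continuousAt.comp
    (ContinuousAt.comp hp (continuousAt_refl hz))).mul ?_
  exact (ContinuousAt.div continuousAt_const
    (g := fun x : ℂ => (x - c) ^ 2) (by fun_prop) (pow_ne_zero 2 hz')).neg

/-- Two conjugations cancel: `conj ∘ p ∘ conj` is holomorphic and is evaluated at the holomorphic
`reflConj`. -/
theorem differentiableAt_reflGrad {c r : ℝ} {p : ℂ → ℂ} {z : ℂ} (hz : z ≠ c)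
    (hp : DifferentiableAt ℂ p (refl c r z)) : DifferentiableAt ℂ (reflGrad c r p) z := by
  have hz' : z - c ≠ 0 := sub_ne_zero.mpr hz
  refine DifferentiableAt.mul ?_ ?_
  · have h1 := hp.hasDerivAt.conj_conj
    rw [refl, Complex.conj_conj] at h1
    have h2 := h1.comp z (hasDerivAt_reflConj (r := r) hz)
    exact h2.differentiableAt
  · exact (DifferentiableAt.div (differentiableAt_const _)
      (d := fun x : ℂ => (x - c) ^ 2) (by fun_prop) (pow_ne_zero 2 hz')).neg

theorem refl_mem_ball {c r : ℝ} (hr : 0 < r) {z : ℂ} (hz : z ∉ closedBall (c : ℂ) r) :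
    refl c r z ∈ ball (c : ℂ) r := by
  rw [mem_closedBall, dist_eq_norm, not_le] at hz
  rw [mem_ball, dist_eq_norm, norm_refl_sub, div_lt_iff₀ (hr.trans hz), pow_two]
  exact mul_lt_mul_of_pos_left hz hr

theorem norm_reflGrad_le {c r : ℝ} {p : ℂ → ℂ} (hr : 0 < r) {z : ℂ}
    (hz : z ∉ closedBall (c : ℂ) r) : ‖reflGrad c r p z‖ ≤ ‖p (refl c r z)‖ := by
  rw [mem_closedBall, dist_eq_norm, not_le] at hz
  rw [reflGrad, norm_mul, RCLike.norm_conj]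
  refine mul_le_of_le_one_right (norm_nonneg _) ?_
  rw [norm_neg, norm_div, norm_pow, norm_pow, Complex.norm_real, Real.norm_of_nonneg hr.le]
  exact div_le_one_of_le₀ (pow_le_pow_left₀ hr.le hz.le 2) (by positivity)

theorem ne_center_of_notMem_closedBall {c r : ℝ} (hr : 0 < r) {z : ℂ}
    (hz : z ∉ closedBall (c : ℂ) r) : z ≠ c := by
  rintro rfl
  exact hz (mem_closedBall_self hr.le)

/-- The function equal to the identity in a closed disk and to the reflection outside. -/
theorem exists_continuous_fold {c r : ℝ} (hr : 0 < r) : ∃ f : ℂ → ℂ, Continuous f ∧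
    (∀ z ∈ closedBall (c : ℂ) r, f z = z) ∧ (∀ z ∉ closedBall (c : ℂ) r, f z = refl c r z) ∧
    ∀ z, f z ∈ closedBall (c : ℂ) r := by
  have hm : ∀ z : ℂ, max r ‖z - c‖ ≠ 0 := fun z => (hr.trans_le (le_max_left _ _)).ne'
  -- The single formula `c + (r / max r |z - c|)² (z - c)` gives both branches and is visibly
  -- continuous.
  have h1 : ∀ z ∈ closedBall (c : ℂ) r, (c : ℂ) + ((r / max r ‖z - c‖) ^ 2 : ℝ) * (z - c) = z := by
    intro z hz
    rw [mem_closedBall, dist_eq_norm] at hz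
    rw [max_eq_left hz, div_self hr.ne']
    simp
  have h2 : ∀ z ∉ closedBall (c : ℂ) r,
      (c : ℂ) + ((r / max r ‖z - c‖) ^ 2 : ℝ) * (z - c) = refl c r z := by
    intro z hz
    have hz' : z - c ≠ 0 := sub_ne_zero.mpr (ne_center_of_notMem_closedBall hr hz)
    rw [mem_closedBall, dist_eq_norm, not_le] at hz
    have h3 : (conj z - (c : ℂ)) ≠ 0 := by
      have := (map_ne_zero (starRingEnd ℂ)).mpr hz'
      simpa using this
    have h4 : ((‖z - c‖ : ℝ) : ℂ) ^ 2 = (z - c) * (conj z - c) := by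
      rw [← Complex.ofReal_pow, ← Complex.normSq_eq_norm_sq, ← Complex.mul_conj]; simp
    rw [max_eq_right hz.le, div_pow]
    push_cast
    rw [h4]
    simp only [refl, reflConj, map_add, map_div₀, map_pow, Complex.conj_ofReal, map_sub]
    congr 1
    field_simp
  refine ⟨_, ?_, h1, h2, fun z => ?_⟩
  · refine continuous_const.add (Continuous.mul ?_ (by fun_prop))
    exact Complex.continuous_ofReal.comp ((Continuous.div continuous_const (by fun_prop) hm).pow 2)
  · by_cases hz : z ∈ closedBall (c : ℂ) r
    · rwa [h1 z hz]
    · rw [h2 z hz]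
      exact ball_subset_closedBall (refl_mem_ball hr hz)

theorem one_sub_tau {k : ℝ} (hk : 0 < k) : 1 - tau k = 2 / (k + 1) := by
  have : k + 1 ≠ 0 := by linarith
  rw [tau]; field_simp; ring

theorem one_sub_tau_pos {k : ℝ} (hk : 0 < k) : 0 < 1 - tau k := by
  rw [one_sub_tau hk]; positivity

section extension

variable {rᵢ rₑ α cᵢ cₑ k : ℝ} {g u : ℂ → ℝ}

/-- The complex gradient of a solution, expressed by a holomorphic function in the whole disk. -/
theorem IsNeumannSolution.exists_holomorphic (H : IsCoaxal rᵢ rₑ α cᵢ cₑ) (hk : 0 < k)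
    (hu : IsNeumannSolution cₑ rₑ cᵢ rᵢ k g u) :
    ∃ P : ℂ → ℂ, DifferentiableOn ℂ P (ball (cₑ : ℂ) rₑ) ∧
      (∀ z ∈ ball (cᵢ : ℂ) rᵢ, HasCGrad u (P z) z) ∧
      ∀ z ∈ ball (cₑ : ℂ) rₑ \ closedBall (cᵢ : ℂ) rᵢ,
        HasCGrad u ((P z - tau k * reflGrad cᵢ rᵢ P z) / (1 - tau k)) z := by
  set τ := tau k with hτ
  have hτ1 : (1 - τ : ℂ) ≠ 0 := by exact_mod_cast (one_sub_tau_pos hk).ne'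
  set Bᵢ := ball (cᵢ : ℂ) rᵢ with hBᵢ
  set A := ball (cₑ : ℂ) rₑ \ closedBall (cᵢ : ℂ) rᵢ with hA
  have hAo : IsOpen A := isOpen_ball.sdiff isClosed_closedBall
  obtain ⟨p, hpd, hpu⟩ : ∃ p : ℂ → ℂ, DifferentiableOn ℂ p (Bᵢ ∪ A) ∧
      ∀ z ∈ Bᵢ ∪ A, HasCGrad u (p z) z := ⟨_, exists_hasCGrad_of_harmonic hu.harmonic⟩
  have hUo : IsOpen (Bᵢ ∪ A) := isOpen_ball.union hAo
  have hpdAt : ∀ z ∈ Bᵢ ∪ A, DifferentiableAt ℂ p z := fun z hz =>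
    hpd.differentiableAt (hUo.mem_nhds hz)
  obtain ⟨f, hfc, hf1, hf2, hf3⟩ := exists_continuous_fold (c := cᵢ) H.ri_pos
  -- Inside, the fold is the identity and `W = u`; outside, it adds the reflected values with weight
  -- `τ`.
  set W : ℂ → ℝ := fun z => (1 - τ) * u z + τ * u (f z) with hW
  have hWc : ContinuousOn W (ball (cₑ : ℂ) rₑ) :=
    (continuousOn_const.mul hu.continuous).add (continuousOn_const.mul
      (hu.continuous.comp hfc.continuousOn fun z _ => H.closedBall_subset (hf3 z)))
  classical
  set p' : ℂ → ℂ := fun z => if z ∈ Bᵢ then p z else (1 - τ) * p z + τ * reflGrad cᵢ rᵢ p z with hp'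
  have hp'i : ∀ z ∈ Bᵢ, p' z = p z := fun z hz => if_pos hz
  have hp'e : ∀ z ∈ A, p' z = (1 - τ) * p z + τ * reflGrad cᵢ rᵢ p z := fun z hz =>
    if_neg fun h => hz.2 (ball_subset_closedBall h)
  have hrefl : ∀ z ∈ A, refl cᵢ rᵢ z ∈ Bᵢ := fun z hz => refl_mem_ball H.ri_pos hz.2
  have hne : ∀ z ∈ A, z ≠ cᵢ := fun z hz => ne_center_of_notMem_closedBall H.ri_pos hz.2
  have hp'd : ∀ z ∈ Bᵢ ∪ A, DifferentiableAt ℂ p' z := by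
    rintro z (hz | hz)
    · exact (hpdAt z (.inl hz)).congr_of_eventuallyEq
        (eventually_of_mem (isOpen_ball.mem_nhds hz) hp'i)
    · refine DifferentiableAt.congr_of_eventuallyEq ?_
        (eventually_of_mem (hAo.mem_nhds hz) hp'e)
      exact ((hpdAt z (.inr hz)).const_mul _).add
        ((differentiableAt_reflGrad (hne z hz) (hpdAt _ (.inl (hrefl z hz)))).const_mul _)
  have hWi : ∀ z ∈ Bᵢ, W z = u z := fun z hz => by
    simp only [hW, hf1 z (ball_subset_closedBall hz)]; ring
  have hWp : ∀ z ∈ Bᵢ ∪ A, HasCGrad W (p' z) z := by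
    rintro z (hz | hz)
    · rw [hp'i z hz]
      exact (hpu z (.inl hz)).congr (eventually_of_mem (isOpen_ball.mem_nhds hz) hWi)
    · rw [hp'e z hz]
      have h1 := ((hpu z (.inr hz)).const_mul (1 - τ)).add
        (((hpu _ (.inl (hrefl z hz))).comp_refl (hne z hz)).const_mul τ)
      have e : ∀ y ∈ A, W y = (1 - τ) * u y + τ * u (refl cᵢ rᵢ y) := fun y hy => by
        simp only [hW, hf2 y hy.2]
      have h2 := h1.congr (eventually_of_mem (hAo.mem_nhds hz) e)
      push_cast at h2
      exact h2
  -- The largest disk concentric with `Bᵢ` inside `Bₑ`: the extension across the circle needs a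
  -- concentric annulus.
  set R₀ := rₑ - (cₑ - cᵢ) with hR₀
  have hsub : ball (cᵢ : ℂ) R₀ ⊆ ball (cₑ : ℂ) rₑ := by
    refine ball_subset_ball' ?_
    rw [dist_eq_norm, ← Complex.ofReal_sub, Complex.norm_real, Real.norm_eq_abs, abs_sub_comm,
      abs_of_pos (by linarith [H.lt])]
    linarith
  have hrR : rᵢ < R₀ := by linarith [H.sub_lt]
  have hN : ∀ x ∈ sphere (cᵢ : ℂ) rᵢ, ∃ l : ℝ,
      Tendsto (fun z => ((z - cᵢ) * p' z).re) (𝓝[Bᵢ ∪ (ball (cᵢ : ℂ) R₀ \ closedBall (cᵢ : ℂ) rᵢ)] x)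
        (𝓝 l) := by
    intro x hx
    have hxr : ‖x - cᵢ‖ = rᵢ := mem_sphere_iff_norm.mp hx
    have hxc : x ≠ cᵢ := by
      intro h; rw [h, sub_self, norm_zero] at hxr; exact H.ri_pos.ne hxr
    obtain ⟨l, hl1, hl2⟩ := hu.flux x hx
    have hnorm : Tendsto (fun z : ℂ => ‖z - cᵢ‖) (𝓝 x) (𝓝 rᵢ) := by
      have : Continuous fun z : ℂ => ‖z - cᵢ‖ := by fun_prop
      simpa [hxr] using this.tendsto x
    have hrad : ∀ z : ℂ, z ≠ cᵢ → z ∈ Bᵢ ∪ A →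
        ((z - cᵢ) * p z).re = ‖z - cᵢ‖ * normalDeriv cᵢ u z := by
      intro z hzc hz
      rw [(hpu z hz).normalDeriv_eq, ← mul_assoc, mul_inv_cancel₀, one_mul]
      exact norm_ne_zero_iff.mpr (sub_ne_zero.mpr hzc)
    have hev : ∀ᶠ z : ℂ in 𝓝 x, z ≠ cᵢ := isOpen_ne.mem_nhds hxc
    have t1 : Tendsto (fun z => ((z - cᵢ) * p z).re) (𝓝[Bᵢ] x) (𝓝 (rᵢ * l)) := by
      refine ((hnorm.mono_left nhdsWithin_le_nhds).mul hl1).congr' ?_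
      filter_upwards [self_mem_nhdsWithin, nhdsWithin_le_nhds hev] with z hz hzc
      rw [hrad z hzc (.inl hz)]
    have t2 : Tendsto (fun z => ((z - cᵢ) * p z).re) (𝓝[A] x) (𝓝 (rᵢ * (k * l))) := by
      refine ((hnorm.mono_left nhdsWithin_le_nhds).mul hl2).congr' ?_
      filter_upwards [self_mem_nhdsWithin] with z hz
      rw [hrad z (hne z hz) (.inr hz)]
    have t3 : Tendsto (refl cᵢ rᵢ) (𝓝[A] x) (𝓝[Bᵢ] x) := by
      refine tendsto_nhdsWithin_iff.mpr ⟨?_, ?_⟩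
      · have := (continuousAt_refl (r := rᵢ) hxc).tendsto
        rw [refl_of_mem_sphere H.ri_pos hxr] at this
        exact this.mono_left nhdsWithin_le_nhds
      · filter_upwards [self_mem_nhdsWithin] with z hz using hrefl z hz
    refine ⟨rᵢ * l, ?_⟩
    rw [nhdsWithin_union]
    refine Tendsto.sup ?_ ?_
    · refine t1.congr' ?_
      filter_upwards [self_mem_nhdsWithin] with z hz
      rw [hp'i z hz]
    · have hAA : ball (cᵢ : ℂ) R₀ \ closedBall (cᵢ : ℂ) rᵢ ⊆ A := sdiff_subset_sdiff_left hsub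
      refine Tendsto.mono_left ?_ (nhdsWithin_mono x hAA)
      have t4 := (t2.const_mul (1 - τ)).sub ((t1.comp t3).const_mul τ)
      -- The weights are chosen for this identity: reflection reverses the radial derivative, and
      -- `(1 - τ) k - τ = 1`.
      have e : (1 - τ) * (rᵢ * (k * l)) - τ * (rᵢ * l) = rᵢ * l := by
        have : k + 1 ≠ 0 := by linarith
        rw [hτ, tau]; field_simp; ring
      rw [e] at t4
      refine t4.congr' ?_
      filter_upwards [self_mem_nhdsWithin] with z hz
      have e1 : (z - cᵢ) * p' z = ((1 - τ : ℝ) : ℂ) * ((z - cᵢ) * p z) +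
          (τ : ℂ) * ((z - cᵢ) * reflGrad cᵢ rᵢ p z) := by
        rw [hp'e z hz]; push_cast; ring
      rw [e1, Complex.add_re, Complex.re_ofReal_mul, Complex.re_ofReal_mul,
        re_mul_reflGrad (hne z hz)]
      simp only [Function.comp]
      ring
  have hUsub : Bᵢ ∪ (ball (cᵢ : ℂ) R₀ \ closedBall (cᵢ : ℂ) rᵢ) ⊆ Bᵢ ∪ A :=
    union_subset_union_right _ (sdiff_subset_sdiff_left hsub)
  obtain ⟨P₁, hP₁d, hP₁⟩ := exists_holomorphic_extension H.ri_pos hrR rfl (hWc.mono hsub)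
    (fun z hz => (hp'd z (hUsub hz)).differentiableWithinAt) (fun z hz => hWp z (hUsub hz)) hN
  set P : ℂ → ℂ := fun z => if z ∈ ball (cᵢ : ℂ) R₀ then P₁ z else p' z with hP
  have hPU : ∀ z ∈ Bᵢ ∪ A, P z = p' z := by
    intro z hz
    by_cases h : z ∈ ball (cᵢ : ℂ) R₀
    · rw [hP]; beta_reduce
      rw [if_pos h]
      refine hP₁ ?_
      rcases hz with hz | hz
      · exact .inl hz
      · exact .inr ⟨h, hz.2⟩
    · exact if_neg h
  refine ⟨P, fun z hz => DifferentiableAt.differentiableWithinAt ?_, fun z hz => ?_, fun z hz => ?_⟩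
  · by_cases h : z ∈ ball (cᵢ : ℂ) R₀
    · exact (hP₁d.differentiableAt (isOpen_ball.mem_nhds h)).congr_of_eventuallyEq
        (eventually_of_mem (isOpen_ball.mem_nhds h) fun y hy => if_pos hy)
    · have hzA : z ∈ Bᵢ ∪ A := by
        refine .inr ⟨hz, fun h' => h ?_⟩
        exact closedBall_subset_ball hrR h'
      exact (hp'd z hzA).congr_of_eventuallyEq (eventually_of_mem (hUo.mem_nhds hzA) hPU)
  · rw [hPU z (.inl hz), hp'i z hz]
    exact hpu z (.inl hz)
  · have e1 : reflGrad cᵢ rᵢ P z = reflGrad cᵢ rᵢ p z := by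
      rw [reflGrad, hPU _ (.inl (hrefl z hz)), hp'i _ (hrefl z hz), reflGrad]
    have e2 : (P z - τ * reflGrad cᵢ rᵢ P z) / (1 - τ) = p z := by
      rw [e1, hPU z (.inr hz), hp'e z hz, add_sub_cancel_right, mul_div_cancel_left₀ _ hτ1]
    rw [e2]
    exact hpu z (.inr hz)

end extension

/-! ### The functional equation of the unfolded gradient and its iterated series -/

section representation

variable {rᵢ rₑ α cᵢ cₑ k x₀ : ℝ} {g u : ℂ → ℝ} {P : ℂ → ℂ}

open IsCoaxal (period)

theorem differentiableAt_flowDer_div (hα : 0 < α) {z : ℂ} (hz : 0 < z.re) {t : ℝ} (ht : 0 ≤ t) :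
    DifferentiableAt ℂ (fun z : ℂ => flowDer (z / α) t) z := by
  have hE := flowDen_ne_zero (div_re_pos hα hz).le ht
  have h1 : DifferentiableAt ℂ (fun z : ℂ => flowDen (z / α) t ^ 2) z := by
    unfold flowDen; fun_prop
  exact (differentiableAt_const (1 : ℂ)).div h1 (pow_ne_zero 2 hE)

/-- The Neumann boundary condition in terms of the holomorphic function of `exists_holomorphic`. -/
theorem IsNeumannSolution.tendsto_radial (H : IsCoaxal rᵢ rₑ α cᵢ cₑ) (hk : 0 < k)
    (hu : IsNeumannSolution cₑ rₑ cᵢ rᵢ k g u) (hP : DifferentiableOn ℂ P (ball (cₑ : ℂ) rₑ))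
    (hPi : ∀ z ∈ ball (cᵢ : ℂ) rᵢ, HasCGrad u (P z) z)
    (hPe : ∀ z ∈ ball (cₑ : ℂ) rₑ \ closedBall (cᵢ : ℂ) rᵢ,
      HasCGrad u ((P z - tau k * reflGrad cᵢ rᵢ P z) / (1 - tau k)) z)
    {x : ℂ} (hx : x ∈ sphere (cₑ : ℂ) rₑ) :
    Tendsto (fun z => ((z - cₑ) * (P z + tau k * (flowDer (z / α) (period α cᵢ cₑ) *
      P (shift α (period α cᵢ cₑ) z)))).re) (𝓝[ball (cₑ : ℂ) rₑ] x)
      (𝓝 ((1 - tau k) * (rₑ * g x))) := by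
  set τ := tau k
  set h := period α cᵢ cₑ
  set B := ball (cₑ : ℂ) rₑ with hB
  have hτ1 : (1 - τ : ℂ) ≠ 0 := by exact_mod_cast (one_sub_tau_pos hk).ne'
  have hxr : ‖x - cₑ‖ = rₑ := mem_sphere_iff_norm.mp hx
  have hxc : x ≠ cₑ := by
    intro h; rw [h, sub_self, norm_zero] at hxr; exact H.re_pos.ne hxr
  have hxi : x ∉ closedBall (cᵢ : ℂ) rᵢ := fun h => by
    have := H.closedBall_subset h
    rw [mem_ball, dist_eq_norm, hxr] at this
    exact lt_irrefl _ this
  set K := reflGrad cᵢ rᵢ P with hK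
  have hKx : ContinuousAt K x :=
    continuousAt_reflGrad (ne_center_of_notMem_closedBall H.ri_pos hxi)
      (hP.continuousOn.continuousAt (isOpen_ball.mem_nhds
        (H.closedBall_subset (ball_subset_closedBall (refl_mem_ball H.ri_pos hxi)))))
  have hKv : ∀ y ∉ closedBall (cᵢ : ℂ) rᵢ, HasCGrad (fun x => u (refl cᵢ rᵢ x)) (K y) y :=
    fun y hy => (hPi _ (refl_mem_ball H.ri_pos hy)).comp_refl
      (ne_center_of_notMem_closedBall H.ri_pos hy)
  have hRx : Tendsto (refl cₑ rₑ) (𝓝 x) (𝓝 x) := by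
    have := (continuousAt_refl (r := rₑ) hxc).tendsto
    rwa [refl_of_mem_sphere H.re_pos hxr] at this
  have hout : ∀ᶠ z : ℂ in 𝓝 x, z ∉ closedBall (cᵢ : ℂ) rᵢ :=
    isClosed_closedBall.isOpen_compl.mem_nhds hxi
  have hev : ∀ᶠ z : ℂ in 𝓝 x, z ≠ cₑ := isOpen_ne.mem_nhds hxc
  have hN : Tendsto (fun y => ((y - cₑ) * K y).re) (𝓝 x) (𝓝 ((x - cₑ) * K x).re) :=
    (Complex.continuous_re.continuousAt.comp
      ((continuousAt_id.sub continuousAt_const).mul hKx)).tendsto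
  have hnorm : Tendsto (fun z : ℂ => ‖z - cₑ‖) (𝓝 x) (𝓝 rₑ) := by
    have : Continuous fun z : ℂ => ‖z - cₑ‖ := by fun_prop
    simpa [hxr] using this.tendsto x
  -- The reflection fixes `x`, so the radial components of `K` at a point and at its reflection
  -- cancel in the limit; only the Neumann datum remains.
  have t1 := (((hnorm.mono_left (nhdsWithin_le_nhds (s := B))).mul (hu.neumann x hx)).const_mul
    (1 - τ)).add (((hN.sub (hN.comp hRx)).const_mul τ).mono_left (nhdsWithin_le_nhds (s := B)))
  rw [sub_self, mul_zero, add_zero] at t1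
  refine t1.congr' ?_
  filter_upwards [self_mem_nhdsWithin, nhdsWithin_le_nhds hout, nhdsWithin_le_nhds hev,
    nhdsWithin_le_nhds (hRx.eventually hout)] with z hz hzi hzc hzR
  have hre := H.re_pos_of_mem hz
  have hp := hPe z ⟨hz, hzi⟩
  have hcg1 : HasCGrad (fun y => u (shift α h y)) (P (shift α h z) * flowDer (z / α) h) z :=
    (hPi _ (H.shift_period_mem hz)).comp_holo (hasDerivAt_shift H.alpha_pos hre H.period_pos.le)
  have hcg2 : HasCGrad (fun y => u (refl cᵢ rᵢ (refl cₑ rₑ y))) (reflGrad cₑ rₑ K z) z :=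
    (hKv _ hzR).comp_refl hzc
  -- Both are complex gradients of `u ∘ T`: one by the holomorphic chain rule, the other as a double
  -- reflection, whose radial part is known.
  have heq : P (shift α h z) * flowDer (z / α) h = reflGrad cₑ rₑ K z := by
    refine hcg1.unique (hcg2.congr ?_)
    filter_upwards [isOpen_ball.mem_nhds hz, isOpen_ne.mem_nhds hzc] with y hy hyc
    rw [H.shift_period_eq_refl_refl hy hyc]
  have e1 : (z - cₑ) * (P z + τ * (flowDer (z / α) h * P (shift α h z))) =
      ((1 - τ : ℝ) : ℂ) * ((z - cₑ) * ((P z - τ * K z) / (1 - τ))) + (τ : ℂ) * ((z - cₑ) * K z) +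
        (τ : ℂ) * ((z - cₑ) * reflGrad cₑ rₑ K z) := by
    rw [← heq]
    push_cast
    field_simp
    ring
  rw [e1, Complex.add_re, Complex.add_re, Complex.re_ofReal_mul, Complex.re_ofReal_mul,
    Complex.re_ofReal_mul, re_mul_reflGrad hzc, hp.normalDeriv_eq]
  rw [← mul_assoc ‖z - cₑ‖, mul_inv_cancel₀ (norm_ne_zero_iff.mpr (sub_ne_zero.mpr hzc)), one_mul]
  simp only [Function.comp]
  ring

/-- The left side times `z - cₑ` is holomorphic, vanishes at the centre, and its real part has the
boundary values `(1 - τ) rₑ g`, of mean zero. The Schwarz formula determines it, and its quotient by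
`z - cₑ` is a Cauchy integral, the gradient of the layer potential. -/
theorem IsNeumannSolution.functional_equation (H : IsCoaxal rᵢ rₑ α cᵢ cₑ) (hk : 0 < k)
    (hx₀ : cₑ = x₀ + rₑ) (hg : Continuous fun t : ℝ => g (circleMap rₑ rₑ t))
    (hg0 : ∫ t in (0 : ℝ)..(2 * Real.pi), g (circleMap rₑ rₑ t) = 0)
    (hu : IsNeumannSolution cₑ rₑ cᵢ rᵢ k (fun z => g (z - x₀)) u)
    (hP : DifferentiableOn ℂ P (ball (cₑ : ℂ) rₑ))
    (hPi : ∀ z ∈ ball (cᵢ : ℂ) rᵢ, HasCGrad u (P z) z)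
    (hPe : ∀ z ∈ ball (cₑ : ℂ) rₑ \ closedBall (cᵢ : ℂ) rᵢ,
      HasCGrad u ((P z - tau k * reflGrad cᵢ rᵢ P z) / (1 - tau k)) z)
    {z : ℂ} (hz : z ∈ ball (cₑ : ℂ) rₑ) :
    P z + tau k * (flowDer (z / α) (period α cᵢ cₑ) * P (shift α (period α cᵢ cₑ) z)) =
      (1 - tau k) * layerGrad rₑ g (z - x₀) := by
  set τ := tau k
  set h := period α cᵢ cₑ
  set B := ball (cₑ : ℂ) rₑ with hB
  set V : ℂ → ℂ := fun z => P z + τ * (flowDer (z / α) h * P (shift α h z)) with hV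
  have hcirc : ∀ t : ℝ, circleMap (cₑ : ℂ) rₑ t - x₀ = circleMap (rₑ : ℂ) rₑ t := fun t => by
    simp only [circleMap, hx₀]; push_cast; ring
  have hPat : ∀ y ∈ B, DifferentiableAt ℂ P y := fun y hy =>
    hP.differentiableAt (isOpen_ball.mem_nhds hy)
  have hVd : ∀ y ∈ B, DifferentiableAt ℂ V y := by
    intro y hy
    have hre := H.re_pos_of_mem hy
    have hp := H.period_pos.le
    refine (hPat y hy).add (DifferentiableAt.const_mul ?_ _)
    exact (differentiableAt_flowDer_div H.alpha_pos hre hp).mul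
      ((hPat _ (H.shift_mem_ball hy hp)).comp y
        (hasDerivAt_shift H.alpha_pos hre hp).differentiableAt)
  set φ : ℂ → ℝ := fun x => (1 - τ) * (rₑ * g (x - x₀)) with hφ
  have hφc : Continuous fun t : ℝ => φ (circleMap (cₑ : ℂ) rₑ t) := by
    simp only [hφ, hcirc]
    exact continuous_const.mul (continuous_const.mul hg)
  have hφ0 : ∫ t in (0 : ℝ)..(2 * Real.pi), φ (circleMap (cₑ : ℂ) rₑ t) = 0 := by
    simp only [hφ, hcirc, intervalIntegral.integral_const_mul, hg0, mul_zero]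
  have hF : ∀ y ∈ B, (y - cₑ) * V y =
      (y - cₑ) / Real.pi * cauchyCircle cₑ rₑ (fun t => (φ (circleMap cₑ rₑ t) : ℂ)) y := by
    intro y hy
    refine eq_cauchyCircle_of_tendsto_re (F := fun z => (z - cₑ) * V z) H.re_pos
      (fun y hy => DifferentiableAt.differentiableWithinAt ?_) (by simp) hφc hφ0
      (fun ζ hζ => hu.tendsto_radial H hk hP hPi hPe hζ) hy
    exact DifferentiableAt.mul (by fun_prop) (hVd y hy)
  set Q : ℂ → ℂ := fun y =>
    1 / Real.pi * cauchyCircle cₑ rₑ (fun t => (φ (circleMap cₑ rₑ t) : ℂ)) y with hQ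
  have hne : ∀ y ∈ B, y ≠ cₑ → V y = Q y := by
    intro y hy hyc
    have h1 := hF y hy
    rw [div_mul_eq_mul_div, mul_div_assoc] at h1
    rw [mul_left_cancel₀ (sub_ne_zero.mpr hyc) h1, hQ]
    ring
  have hQc : ∀ y ∈ B, ContinuousAt Q y := fun y hy =>
    continuousAt_const.mul (hasDerivAt_cauchyCircle (Complex.continuous_ofReal.comp hφc)
      hy).continuousAt
  -- Division by `z - cₑ` loses the centre, which is recovered by continuity.
  have hVQ : V z = Q z := by
    by_cases hzc : z = cₑ
    · have h1 : V =ᶠ[𝓝[≠] z] Q := by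
        filter_upwards [nhdsWithin_le_nhds (isOpen_ball.mem_nhds hz), self_mem_nhdsWithin]
          with y hy hyc
        exact hne y hy (by rw [← hzc]; exact hyc)
      exact (((hVd z hz).continuousAt.eventuallyEq_nhds_iff_eventuallyEq_nhdsNE
        (hQc z hz)).mp h1).eq_of_nhds
    · exact hne z hz hzc
  refine hVQ.trans ?_
  simp only [hQ, layerGrad, cauchyCircle]
  rw [← intervalIntegral.integral_const_mul, ← intervalIntegral.integral_const_mul,
    ← intervalIntegral.integral_const_mul]
  refine intervalIntegral.integral_congr fun t _ => ?_
  rw [← hcirc t]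
  simp only [hφ]
  push_cast
  rw [show circleMap (cₑ : ℂ) rₑ t - x₀ - (z - x₀) = circleMap (cₑ : ℂ) rₑ t - z by ring]
  ring

theorem iterate_functional_equation (H : IsCoaxal rᵢ rₑ α cᵢ cₑ) {σ : ℂ} {G : ℂ → ℂ}
    (hPG : ∀ z ∈ ball (cₑ : ℂ) rₑ, P z + σ * (flowDer (z / α) (period α cᵢ cₑ) *
      P (shift α (period α cᵢ cₑ) z)) = G z)
    {z : ℂ} (hz : z ∈ ball (cₑ : ℂ) rₑ) (N : ℕ) :
    P z = ∑ n ∈ Finset.range N, (-σ) ^ n * (flowDer (z / α) (n * period α cᵢ cₑ) *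
      G (shift α (n * period α cᵢ cₑ) z)) + (-σ) ^ N *
        (flowDer (z / α) (N * period α cᵢ cₑ) * P (shift α (N * period α cᵢ cₑ) z)) := by
  set h := period α cᵢ cₑ
  have hh := H.period_pos.le
  have hre := H.re_pos_of_mem hz
  induction N with
  | zero => simp [flowDer, flowDen, shift_zero H.alpha_pos]
  | succ N ih =>
    have hN : (0 : ℝ) ≤ N * h := mul_nonneg N.cast_nonneg hh
    have e : ((N + 1 : ℕ) : ℝ) * h = N * h + h := by push_cast; ring
    have h1 := hPG _ (H.shift_mem_ball hz hN)
    rw [shift_div H.alpha_pos, shift_shift H.alpha_pos hre hN hh] at h1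
    rw [Finset.sum_range_succ, ← h1, e, flowDer_add (div_re_pos H.alpha_pos hre).le hN]
    conv_lhs => rw [ih]
    ring

/-- `P` is not known to be bounded near `∂Bₑ`, but after one period every orbit lies in the compact
closure of `Bᵢ`. There `P` is bounded, and the factor `‖σ‖ ^ N` removes the remainder. -/
theorem tendsto_sum_of_functional_equation (H : IsCoaxal rᵢ rₑ α cᵢ cₑ) {σ : ℂ} {G : ℂ → ℂ}
    (hσ : ‖σ‖ < 1) (hP : ContinuousOn P (ball (cₑ : ℂ) rₑ))
    (hPG : ∀ z ∈ ball (cₑ : ℂ) rₑ, P z + σ * (flowDer (z / α) (period α cᵢ cₑ) *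
      P (shift α (period α cᵢ cₑ) z)) = G z)
    {z : ℂ} (hz : z ∈ ball (cₑ : ℂ) rₑ) :
    Tendsto (fun N : ℕ => ∑ n ∈ Finset.range N, (-σ) ^ n *
      (flowDer (z / α) (n * period α cᵢ cₑ) * G (shift α (n * period α cᵢ cₑ) z))) atTop
      (𝓝 (P z)) := by
  set h := period α cᵢ cₑ
  have hh := H.period_pos.le
  have hre := H.re_pos_of_mem hz
  obtain ⟨M, hM⟩ := (isCompact_closedBall (cᵢ : ℂ) rᵢ).exists_bound_of_continuousOn
    (hP.mono H.closedBall_subset)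
  have hrem : Tendsto (fun N : ℕ => (-σ) ^ N *
      (flowDer (z / α) (N * h) * P (shift α (N * h) z))) atTop (𝓝 0) := by
    have h1 : Tendsto (fun N : ℕ => ‖σ‖ ^ N * M) atTop (𝓝 0) := by
      simpa using (tendsto_pow_atTop_nhds_zero_of_lt_one (norm_nonneg σ) hσ).mul_const M
    refine squeeze_zero_norm' ?_ h1
    filter_upwards [eventually_ge_atTop 1] with N hN
    obtain ⟨m, rfl⟩ : ∃ m, N = m + 1 := ⟨N - 1, by omega⟩
    have hm : (0 : ℝ) ≤ m * h := mul_nonneg m.cast_nonneg hh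
    have e : ((m + 1 : ℕ) : ℝ) * h = m * h + h := by push_cast; ring
    have hmem : shift α ((m + 1 : ℕ) * h) z ∈ ball (cᵢ : ℂ) rᵢ := by
      rw [e, ← shift_shift H.alpha_pos hre hm hh]
      exact H.shift_period_mem (H.shift_mem_ball hz hm)
    rw [norm_mul, norm_mul, norm_pow, norm_neg]
    refine mul_le_mul_of_nonneg_left ?_ (by positivity)
    refine (mul_le_of_le_one_left (norm_nonneg _) (norm_flowDer_le_one
      (div_re_pos H.alpha_pos hre).le (by rw [e]; positivity))).trans
      (hM _ (ball_subset_closedBall hmem))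
  have h2 := (tendsto_const_nhds (x := P z)).sub hrem
  rw [sub_zero] at h2
  refine h2.congr fun N => ?_
  conv_lhs => rw [iterate_functional_equation H hPG hz N]
  ring

end representation

/-! ### Constants that are uniform in the distance of the circles -/

/-- Equivalent to `(1 - y) sinh y ≤ y` given `sinh y ≥ y`. For `y < 1` this follows from `1 - y ≤
e^{-y}`, used once for each exponential in `sinh`. -/
theorem abs_inv_sub_inv_sinh_le {y : ℝ} (hy : 0 < y) : |1 / y - 1 / Real.sinh y| ≤ 1 := by
  have h1 : y ≤ Real.sinh y := Real.self_le_sinh_iff.mpr hy.le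
  have h2 : 0 < Real.sinh y := hy.trans_le h1
  have h3 : (1 - y) * Real.sinh y ≤ y := by
    rcases le_or_gt 1 y with h | h
    · have := mul_nonneg (sub_nonneg.mpr h) h2.le
      linarith
    · have e1 : 1 - y ≤ Real.exp (-y) := by have := Real.add_one_le_exp (-y); linarith
      have e2 : (1 - y) * Real.exp y ≤ 1 := by
        calc (1 - y) * Real.exp y ≤ Real.exp (-y) * Real.exp y :=
              mul_le_mul_of_nonneg_right e1 (Real.exp_pos _).le
          _ = 1 := by rw [← Real.exp_add]; simp
      have e3 := mul_le_mul_of_nonneg_left e1 (sub_nonneg.mpr h.le)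
      rw [Real.sinh_eq]
      nlinarith
  have e : 1 / y - 1 / Real.sinh y = (Real.sinh y - y) / (y * Real.sinh y) := by
    field_simp
  rw [e, abs_of_nonneg (div_nonneg (by linarith) (by positivity)), div_le_one (by positivity)]
  linarith

section uniform

variable {rᵢ rₑ ε : ℝ}

open IsCoaxal (period)

theorem alpha_mul_eq (hε : 0 < ε) (hεr : ε < rₑ - rᵢ) :
    alpha rᵢ rₑ ε * (rₑ - rᵢ - ε) =
      Real.sqrt ε * Real.sqrt ((2 * rᵢ + ε) * (2 * rₑ - ε) * (2 * rₑ - 2 * rᵢ - ε)) / 2 := by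
  have hd : rₑ - rᵢ - ε ≠ 0 := by linarith
  rw [alpha, ← Real.sqrt_mul hε.le]
  field_simp

theorem sinh_period_eq (hri : 0 < rᵢ) (hr : rᵢ < rₑ) (hε : 0 < ε) (hεr : ε < rₑ - rᵢ) :
    Real.sinh (period (alpha rᵢ rₑ ε) (cInt rᵢ rₑ ε) (cExt rᵢ rₑ ε) / 2) =
      alpha rᵢ rₑ ε * (rₑ - rᵢ - ε) / (rᵢ * rₑ) := by
  rw [(isCoaxal hri hr hε hεr).sinh_period, cExt]
  ring

set_option maxHeartbeats 400000 in
/-- Bounds, uniform in `ε`, for the parameters of the coaxal system. -/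
theorem exists_uniform_bounds (hri : 0 < rᵢ) (hr : rᵢ < rₑ) : ∃ C : ℝ, 0 ≤ C ∧
    ∀ ε, 0 < ε → ε < rₑ - rᵢ → ∀ α h h', α = alpha rᵢ rₑ ε →
      h = period (alpha rᵢ rₑ ε) (cInt rᵢ rₑ ε) (cExt rᵢ rₑ ε) →
      h' = 4 * Real.sqrt ε / rStar rᵢ rₑ →
      min (2 * rₑ) (2 * α) / Real.sinh (h / 2) ≤ C ∧
      |1 / h - rStar rᵢ rₑ ^ 2 / (4 * α)| ≤ C ∧ |1 / h - 1 / h'| ≤ C ∧ h' / h ≤ C := by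
  have hre : 0 < rₑ := hri.trans hr
  set D := rₑ - rᵢ with hD
  have hD0 : 0 < D := by linarith
  set q₀ := 4 * rᵢ * rₑ * D with hq₀
  have hq₀0 : 0 < q₀ := by positivity
  set s₀ := Real.sqrt q₀ with hs₀
  have hs₀0 : 0 < s₀ := Real.sqrt_pos.mpr hq₀0
  have hs₀2 : s₀ ^ 2 = q₀ := Real.sq_sqrt hq₀0.le
  set ρ := rStar rᵢ rₑ with hρ
  have hρ2 : ρ ^ 2 = 2 * rᵢ * rₑ / D := by rw [hρ, rStar, Real.sq_sqrt (by positivity)]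
  have hρ0 : 0 < ρ := Real.sqrt_pos.mpr (by positivity)
  set L := 4 * rᵢ * rₑ + 4 * D ^ 2 with hL
  have hL0 : 0 < L := by positivity
  -- `C₁`, …, `C₄` bound the four quantities of the statement in order, and their sum serves for
  -- all. The `1/2` is the cost of replacing `h` by `2 sinh (h/2)`.
  set C₁ := 4 * rᵢ * rₑ / D + 2 * rₑ * (2 * rᵢ * rₑ) / (Real.sqrt (D / 2) * s₀) with hC₁
  set C₂ := 1 / 2 + rᵢ * rₑ * Real.sqrt D / (s₀ * D) with hC₂
  set C₃ := 1 / 2 + rᵢ * rₑ * (L * Real.sqrt D / s₀ ^ 3) with hC₃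
  set C₄ := 1 + 4 * Real.sqrt D / ρ * C₃ with hC₄
  have p1 : 0 ≤ C₁ := by positivity
  have p2 : 0 ≤ C₂ := by positivity
  have p3 : 0 ≤ C₃ := by positivity
  have p4 : 0 ≤ C₄ := by positivity
  clear_value D q₀ s₀ ρ L C₁ C₂ C₃ C₄
  refine ⟨C₁ + C₂ + C₃ + C₄, by positivity, fun ε hε hεr α h h' hα hh hh' => ?_⟩
  have hεr' : ε < rₑ - rᵢ := hD ▸ hεr
  set d := D - ε with hd
  have hd0 : 0 < d := by linarith
  set e := Real.sqrt ε with he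
  have he0 : 0 < e := Real.sqrt_pos.mpr hε
  have he2 : e ^ 2 = ε := Real.sq_sqrt hε.le
  have heD : e ≤ Real.sqrt D := Real.sqrt_le_sqrt hεr.le
  set Q := (2 * rᵢ + ε) * (2 * rₑ - ε) * (2 * rₑ - 2 * rᵢ - ε) with hQ
  have hQe : Q = 4 * rᵢ * rₑ * (2 * D - ε) + ε * (2 * D - ε) ^ 2 := by rw [hQ, hD]; ring
  have hQq : q₀ ≤ Q := by
    rw [hQe, hq₀]
    have : 0 ≤ ε * (2 * D - ε) ^ 2 := by positivity
    have : 0 ≤ 4 * rᵢ * rₑ * (D - ε) := by positivity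
    nlinarith
  set s := Real.sqrt Q with hs
  have hss : s₀ ≤ s := by rw [hs₀]; exact Real.sqrt_le_sqrt hQq
  have hs0 : 0 < s := hs₀0.trans_le hss
  have hs2 : s ^ 2 = Q := Real.sq_sqrt (hq₀0.le.trans hQq)
  have hH := isCoaxal hri hr hε hεr'
  have hα0 : 0 < α := hα ▸ hH.alpha_pos
  have hh0 : 0 < h := hh ▸ hH.period_pos
  have hαd : α * d = e * s / 2 := by rw [hα, hd, hD]; rw [alpha_mul_eq hε hεr', ← he, ← hQ, ← hs]
  set S := Real.sinh (h / 2) with hS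
  have hSα : S = α * d / (rᵢ * rₑ) := by
    rw [hS, hh, hα, hd, hD]; exact sinh_period_eq hri hr hε hεr'
  have hSe : S = e * s / (2 * rᵢ * rₑ) := by rw [hSα, hαd]; field_simp
  have hS0 : 0 < S := by rw [hSe]; positivity
  have hh'0 : 0 < h' := by rw [hh']; positivity
  clear_value d e Q s S
  have k0 : |1 / h - 1 / (2 * S)| ≤ 1 / 2 := by
    have h1 := abs_inv_sub_inv_sinh_le (half_pos hh0)
    have e1 : 1 / h - 1 / (2 * S) = 1 / 2 * (1 / (h / 2) - 1 / S) := by field_simp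
    rw [← hS] at h1
    rw [e1, abs_mul, abs_of_pos (by norm_num : (0 : ℝ) < 1 / 2)]
    linarith
  -- For small `ε` both `α` and `sinh (h/2)` are of order `√ε` and `2α` is used. Near `ε = rₑ - rᵢ`
  -- the pole `α` is unbounded, and `2rₑ` is used instead.
  have k1 : min (2 * rₑ) (2 * α) / S ≤ C₁ := by
    rcases le_or_gt ε (D / 2) with hle | hgt
    · have h1 : 2 * α / S ≤ 4 * rᵢ * rₑ / D := by
        rw [hSα, div_le_div_iff₀ (by positivity) hD0]
        have : 4 * rᵢ * rₑ * (α * d / (rᵢ * rₑ)) = 4 * α * d := by field_simp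
        rw [this]
        have h3 := mul_le_mul_of_nonneg_left (show D ≤ 2 * d by linarith) hα0.le
        linarith
      have h2 : 0 ≤ 2 * rₑ * (2 * rᵢ * rₑ) / (Real.sqrt (D / 2) * s₀) := by positivity
      refine (div_le_div_of_nonneg_right (min_le_right _ _) hS0.le).trans ?_
      linarith
    · have h1 : Real.sqrt (D / 2) ≤ e := by rw [he]; exact Real.sqrt_le_sqrt hgt.le
      have h2 : Real.sqrt (D / 2) * s₀ / (2 * rᵢ * rₑ) ≤ S := by
        rw [hSe]; gcongr
      have h3 : 2 * rₑ / S ≤ 2 * rₑ * (2 * rᵢ * rₑ) / (Real.sqrt (D / 2) * s₀) := by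
        have h4 : 0 < Real.sqrt (D / 2) := Real.sqrt_pos.mpr (by linarith)
        refine (div_le_div_of_nonneg_left (by positivity) (by positivity) h2).trans_eq ?_
        field_simp
      have h4 : 0 ≤ 4 * rᵢ * rₑ / D := by positivity
      refine (div_le_div_of_nonneg_right (min_le_left _ _) hS0.le).trans ?_
      linarith
  have k2 : |1 / h - ρ ^ 2 / (4 * α)| ≤ C₂ := by
    have e1 : 1 / (2 * S) - ρ ^ 2 / (4 * α) = rᵢ * rₑ * e / (s * D) := by
      have e2 : 1 / (2 * S) - ρ ^ 2 / (4 * α) = rᵢ * rₑ * e ^ 2 / (2 * (α * d) * D) := by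
        rw [hSα, hρ2, he2]
        field_simp
        rw [hd]; ring
      rw [e2, hαd]
      field_simp
    have h1 : |1 / (2 * S) - ρ ^ 2 / (4 * α)| ≤ rᵢ * rₑ * Real.sqrt D / (s₀ * D) := by
      rw [e1, abs_of_nonneg (by positivity)]
      gcongr
    calc _ ≤ |1 / h - 1 / (2 * S)| + |1 / (2 * S) - ρ ^ 2 / (4 * α)| := abs_sub_le _ _ _
      _ ≤ _ := (add_le_add k0 h1).trans_eq hC₂.symm
  have k3 : |1 / h - 1 / h'| ≤ C₃ := by
    -- `b` is the value of `s = √Q` at `ε = 0`. Thus `b - s = O(ε)`, which outweighs the factor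
    -- `1/√ε` in front.
    set b := 4 * rᵢ * rₑ / ρ with hb
    have hb0 : 0 < b := by positivity
    have hb2 : b ^ 2 = 2 * q₀ := by rw [hb, div_pow, hρ2, hq₀]; field_simp; ring
    have hbs : s₀ ≤ b := by
      refine le_of_sq_le_sq ?_ hb0.le
      rw [hb2, hs₀2]; linarith
    have hab : |b - s| ≤ L * ε / s₀ := by
      have e1 : (b - s) * (b + s) = ε * (4 * rᵢ * rₑ - (2 * D - ε) ^ 2) := by
        have : (b - s) * (b + s) = b ^ 2 - s ^ 2 := by ring
        rw [this, hb2, hs2, hQe, hq₀]; ring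
      have e2 : |b - s| * (b + s) ≤ ε * L := by
        rw [← abs_of_pos (add_pos hb0 hs0), ← abs_mul, e1, abs_mul, abs_of_pos hε]
        refine mul_le_mul_of_nonneg_left ?_ hε.le
        have e3 : (2 * D - ε) ^ 2 ≤ (2 * D) ^ 2 :=
          pow_le_pow_left₀ (by linarith) (by linarith) 2
        have e4 := sq_nonneg (2 * D - ε)
        have e5 := mul_pos hri hre
        rw [abs_le, hL]
        constructor <;> linarith [sq_nonneg D]
      rw [le_div_iff₀ hs₀0]
      have := mul_le_mul_of_nonneg_left (show s₀ ≤ b + s by linarith) (abs_nonneg (b - s))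
      linarith
    have e1 : 1 / (2 * S) - 1 / h' = rᵢ * rₑ * ((b - s) / (e * s * b)) := by
      have e2 : 1 / h' = rᵢ * rₑ / (e * b) := by rw [hh', hb]; field_simp
      rw [e2, hSe]; field_simp
    have h1 : |1 / (2 * S) - 1 / h'| ≤ rᵢ * rₑ * (L * Real.sqrt D / s₀ ^ 3) := by
      rw [e1, abs_mul, abs_of_pos (by positivity), abs_div, abs_of_pos (by positivity : 0 < e * s * b)]
      refine mul_le_mul_of_nonneg_left ?_ (by positivity)
      calc |b - s| / (e * s * b) ≤ (L * ε / s₀) / (e * s₀ * s₀) := by gcongr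
        _ = L * e / s₀ ^ 3 := by rw [← he2]; field_simp
        _ ≤ _ := by gcongr
    calc _ ≤ |1 / h - 1 / (2 * S)| + |1 / (2 * S) - 1 / h'| := abs_sub_le _ _ _
      _ ≤ _ := (add_le_add k0 h1).trans_eq hC₃.symm
  have k4 : h' / h ≤ C₄ := by
    have h1 : h' ≤ 4 * Real.sqrt D / ρ := by rw [hh']; gcongr
    have h2 : 1 / h ≤ 1 / h' + C₃ := by linarith [(abs_le.mp k3).2]
    calc h' / h = h' * (1 / h) := by ring
      _ ≤ h' * (1 / h' + C₃) := by gcongr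
      _ = 1 + h' * C₃ := by field_simp
      _ ≤ 1 + 4 * Real.sqrt D / ρ * C₃ := by gcongr
      _ = C₄ := hC₄.symm
  exact ⟨by linarith, by linarith, by linarith, by linarith⟩

end uniform

/-! ### Estimates of the series for both signs of the reflection coefficient -/

section bounds

variable {rᵢ rₑ α cᵢ cₑ k x₀ : ℝ} {g u : ℂ → ℝ} {P f : ℂ → ℂ} {z : ℂ}

open IsCoaxal (period)

theorem abs_tau_lt_one (hk : 0 < k) : |tau k| < 1 := by
  rw [tau, abs_lt, lt_div_iff₀ (by linarith), div_lt_one (by linarith)]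
  constructor <;> linarith

theorem pole_mem_ball {c r : ℝ} (hα : 0 < α) (hr : 0 < r) (hc : 0 < c)
    (h : c ^ 2 = α ^ 2 + r ^ 2) : (α : ℂ) ∈ ball (c : ℂ) r := by
  have h1 := lt_center hr hc h
  rw [mem_ball, dist_eq_norm, ← Complex.ofReal_sub, Complex.norm_real, Real.norm_eq_abs,
    abs_sub_comm, abs_of_pos (by linarith)]
  refine lt_of_pow_lt_pow_left₀ 2 hr.le ?_
  nlinarith

theorem IsCoaxal.sub_mem (H : IsCoaxal rᵢ rₑ α cᵢ cₑ) (hx₀ : cₑ = x₀ + rₑ)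
    (hz : z ∈ ball (cₑ : ℂ) rₑ) {t : ℝ} (ht : 0 ≤ t) :
    shift α t z - x₀ ∈ ball (rₑ : ℂ) rₑ := by
  have h1 := H.shift_mem_ball hz ht
  rw [mem_ball, dist_eq_norm] at h1 ⊢
  have e : (cₑ : ℂ) = x₀ + rₑ := by exact_mod_cast hx₀
  rwa [e, ← sub_sub] at h1

theorem norm_lt_of_mem_ball {r : ℝ} (hz : z ∈ ball (r : ℂ) r) : ‖z‖ < 2 * r := by
  rw [mem_ball, dist_eq_norm] at hz
  have h1 := norm_add_le (z - r) (r : ℂ)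
  have hr : 0 < r := (norm_nonneg _).trans_lt hz
  rw [sub_add_cancel, Complex.norm_real, Real.norm_of_nonneg hr.le] at h1
  linarith

/-- Bounds in the case of a positive reflection coefficient, where the series alternates. -/
theorem norm_le_of_tendsto_alternating (H : IsCoaxal rᵢ rₑ α cᵢ cₑ) (hx₀ : cₑ = x₀ + rₑ) {K : ℝ≥0}
    {M : ℝ} (hf : LipschitzOnWith K f (ball (rₑ : ℂ) rₑ))
    (hM : ∀ x ∈ ball (rₑ : ℂ) rₑ, ‖f x‖ ≤ M) {τ : ℝ} (hτ0 : 0 ≤ τ) (hτ1 : τ ≤ 1)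
    (hz : z ∈ ball (cₑ : ℂ) rₑ) {Y : ℂ}
    (hY : Tendsto (fun N : ℕ => ∑ n ∈ Finset.range N, (-(τ : ℂ)) ^ n *
      (flowDer (z / α) (n * period α cᵢ cₑ) * f (shift α (n * period α cᵢ cₑ) z - x₀))) atTop
      (𝓝 Y)) : ‖Y‖ ≤ 2 * M + (4 * M + 4 * rₑ * K) := by
  set h := period α cᵢ cₑ
  set ζ := z / (α : ℂ) with hζdef
  have hh := H.period_pos
  have hα := H.alpha_pos
  have hre := H.re_pos_of_mem hz
  have hζ := (div_re_pos hα hre).le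
  have hn : ∀ n : ℕ, (0 : ℝ) ≤ n * h := fun n => mul_nonneg n.cast_nonneg hh.le
  have hmem : ∀ n : ℕ, shift α (n * h) z - x₀ ∈ ball (rₑ : ℂ) rₑ := fun n => H.sub_mem hx₀ hz (hn n)
  have hM0 : 0 ≤ M := (norm_nonneg _).trans (hM _ (hmem 0))
  -- Undoing the scaling by `α`, the orbit length is at most twice `|α - z|`, and the pole and `z`
  -- both lie in `Bₑ`.
  have hαz : α * ‖1 - ζ‖ ≤ 2 * rₑ := by
    have e : (α : ℂ) * (1 - ζ) = α - z := by
      have : (α : ℂ) ≠ 0 := by exact_mod_cast hα.ne'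
      rw [hζdef, mul_sub, mul_div_cancel₀ _ this, mul_one]
    calc α * ‖1 - ζ‖ = ‖(α : ℂ) * (1 - ζ)‖ := by
          rw [norm_mul, Complex.norm_real, Real.norm_of_nonneg hα.le]
      _ = dist (α : ℂ) z := by rw [e, dist_eq_norm]
      _ ≤ dist (α : ℂ) cₑ + dist z cₑ := dist_triangle_right _ _ _
      _ ≤ 2 * rₑ := by
          have h1 := mem_ball.mp (pole_mem_ball hα H.re_pos H.ce_pos H.ce_sq)
          have h2 := mem_ball.mp hz
          linarith
  refine le_of_tendsto hY.norm (.of_forall fun N => ?_)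
  refine norm_alternating_sum_le hτ0 hτ1 (fun n => ?_) (fun N => ?_) N
  · rw [norm_mul]
    exact (mul_le_of_le_one_left (norm_nonneg _) (norm_flowDer_le_one hζ (hn n))).trans
      (hM _ (hmem n))
  · have hstep : ∀ n : ℕ, ‖flowDer ζ ((n + 1 : ℕ) * h) * f (shift α ((n + 1 : ℕ) * h) z - x₀) -
        flowDer ζ (n * h) * f (shift α (n * h) z - x₀)‖ ≤
        M * ‖flowDer ζ (n * h) - flowDer ζ ((n + 1 : ℕ) * h)‖ +
          K * α * ‖flow ζ (n * h) - flow ζ ((n + 1 : ℕ) * h)‖ := by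
      intro n
      have e : flowDer ζ ((n + 1 : ℕ) * h) * f (shift α ((n + 1 : ℕ) * h) z - x₀) -
          flowDer ζ (n * h) * f (shift α (n * h) z - x₀) =
          -((flowDer ζ (n * h) - flowDer ζ ((n + 1 : ℕ) * h)) * f (shift α ((n + 1 : ℕ) * h) z - x₀)) -
          flowDer ζ (n * h) * (f (shift α (n * h) z - x₀) - f (shift α ((n + 1 : ℕ) * h) z - x₀)) := by
        ring
      have h2 : ‖f (shift α (n * h) z - x₀) - f (shift α ((n + 1 : ℕ) * h) z - x₀)‖ ≤
          K * α * ‖flow ζ (n * h) - flow ζ ((n + 1 : ℕ) * h)‖ := by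
        refine (hf.norm_sub_le (hmem n) (hmem (n + 1))).trans_eq ?_
        rw [sub_sub_sub_cancel_right, shift, shift, ← mul_sub, norm_mul, Complex.norm_real,
          Real.norm_of_nonneg hα.le, mul_assoc]
      rw [e]
      refine (norm_sub_le _ _).trans (add_le_add ?_ ?_)
      · rw [norm_neg, norm_mul, mul_comm]
        exact mul_le_mul_of_nonneg_right (hM _ (hmem (n + 1))) (norm_nonneg _)
      · rw [norm_mul]
        exact (mul_le_of_le_one_left (norm_nonneg _) (norm_flowDer_le_one hζ (hn n))).trans h2
    refine (Finset.sum_le_sum fun n _ => hstep n).trans ?_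
    rw [Finset.sum_add_distrib, ← Finset.mul_sum, ← Finset.mul_sum]
    have h3 := mul_le_mul_of_nonneg_left (sum_norm_flowDer_sub_le hζ hh N) hM0
    have h4 := mul_le_mul_of_nonneg_left (sum_norm_flow_sub_le hζ hh N)
      (mul_nonneg K.coe_nonneg hα.le)
    have h5 := mul_le_mul_of_nonneg_left hαz K.coe_nonneg
    nlinarith

/-- In the case of a negative reflection coefficient, the series is close to a multiple of
`flowSum`. -/
theorem norm_sub_flowSum_le_of_tendsto (H : IsCoaxal rᵢ rₑ α cᵢ cₑ) (hx₀ : cₑ = x₀ + rₑ) {K : ℝ≥0}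
    {c₀ : ℂ} (hc₀ : ∀ x ∈ ball (rₑ : ℂ) rₑ, ‖f x - c₀‖ ≤ K * ‖x‖) {s : ℝ} (hs0 : 0 < s) (hs1 : s < 1)
    (hz : z ∈ ball (cₑ : ℂ) rₑ) {Y : ℂ}
    (hY : Tendsto (fun N : ℕ => ∑ n ∈ Finset.range N, (s : ℂ) ^ n *
      (flowDer (z / α) (n * period α cᵢ cₑ) * f (shift α (n * period α cᵢ cₑ) z - x₀))) atTop
      (𝓝 Y)) :
    ‖Y - c₀ * flowSum (z / α) (period α cᵢ cₑ) s‖ ≤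
      K * (2 * rₑ + 2 * (min (2 * rₑ) (2 * α) / Real.sinh (period α cᵢ cₑ / 2))) := by
  set h := period α cᵢ cₑ
  set ζ := z / (α : ℂ) with hζdef
  have hh := H.period_pos
  have hα := H.alpha_pos
  have hre := H.re_pos_of_mem hz
  have hζ := (div_re_pos hα hre).le
  have hn : ∀ n : ℕ, (0 : ℝ) ≤ n * h := fun n => mul_nonneg n.cast_nonneg hh.le
  have hmem : ∀ n : ℕ, shift α (n * h) z - x₀ ∈ ball (rₑ : ℂ) rₑ := fun n => H.sub_mem hx₀ hz (hn n)
  have hsinh : 0 < Real.sinh (h / 2) := Real.sinh_pos_iff.mpr (half_pos hh)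
  set m := ‖ζ‖ with hm
  have hm0 : 0 ≤ m := norm_nonneg _
  set μ := min (2 * rₑ) (2 * α) with hμ
  have hμ0 : 0 ≤ μ := le_min (by linarith [H.re_pos]) (by linarith)
  -- One bound uses that the orbit stays in a disk of diameter `2rₑ`, the other that the flow grows
  -- at most like `1 + m` and that `0 ≤ x₀ ≤ α`. The factor `1 + m` cancels in
  -- `sum_norm_flowDer_le`.
  have hb : ∀ n : ℕ, ‖shift α (n * h) z - x₀‖ ≤ (1 + m) * μ := by
    intro n
    rw [hμ, mul_min_of_nonneg _ _ (by linarith)]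
    refine le_min ?_ ?_
    · have h1 := (norm_lt_of_mem_ball (hmem n)).le
      nlinarith [H.re_pos]
    · have h1 : ‖shift α (n * h) z‖ ≤ α * (1 + m) := by
        rw [shift, norm_mul, Complex.norm_real, Real.norm_of_nonneg hα.le]
        exact mul_le_mul_of_nonneg_left (norm_flow_le hζ (hn n)) hα.le
      have h2 : ‖(x₀ : ℂ)‖ ≤ α := by
        rw [Complex.norm_real, Real.norm_eq_abs]
        have h3 := H.ce_sq
        have h4 := H.ce_pos
        have h5 := H.re_pos
        have h6 : rₑ ≤ cₑ := le_of_sq_le_sq (by nlinarith) h4.le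
        have h7 : cₑ ≤ α + rₑ := le_of_sq_le_sq (by nlinarith) (by linarith)
        rw [abs_le]; constructor <;> linarith
      have h3 := norm_sub_le (shift α (n * h) z) (x₀ : ℂ)
      nlinarith
  have t1 := hY.sub ((summable_flowSum hζ hh hs0 hs1).hasSum.tendsto_sum_nat.const_mul c₀)
  refine le_of_tendsto t1.norm (eventually_atTop.mpr ⟨1, fun N hN => ?_⟩)
  obtain ⟨N, rfl⟩ : ∃ m, N = m + 1 := ⟨N - 1, by omega⟩
  rw [Finset.mul_sum, ← Finset.sum_sub_distrib]
  have hterm : ∀ n : ℕ, ‖(s : ℂ) ^ n * (flowDer ζ (n * h) * f (shift α (n * h) z - x₀)) -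
      c₀ * ((s : ℂ) ^ n * flowDer ζ (n * h))‖ ≤
        ‖flowDer ζ (n * h)‖ * (K * ‖shift α (n * h) z - x₀‖) := by
    intro n
    have e : (s : ℂ) ^ n * (flowDer ζ (n * h) * f (shift α (n * h) z - x₀)) -
      c₀ * ((s : ℂ) ^ n * flowDer ζ (n * h)) =
      (s : ℂ) ^ n * (flowDer ζ (n * h) * (f (shift α (n * h) z - x₀) - c₀)) := by ring
    rw [e, norm_mul, norm_mul, norm_pow, Complex.norm_real, Real.norm_of_nonneg hs0.le]
    refine (mul_le_of_le_one_left (by positivity) (pow_le_one₀ hs0.le hs1.le)).trans ?_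
    exact mul_le_mul_of_nonneg_left (hc₀ _ (hmem n)) (norm_nonneg _)
  refine (norm_sum_le _ _).trans ((Finset.sum_le_sum fun n _ => hterm n).trans ?_)
  -- The term `n = 0` is estimated separately by the diameter of the disk, since the summed bound
  -- for `flowDer` starts at `n = 1`.
  rw [Finset.sum_range_succ', add_comm, mul_add]
  refine add_le_add ?_ ?_
  · refine (mul_le_of_le_one_left (by positivity) (norm_flowDer_le_one hζ (hn 0))).trans ?_
    exact mul_le_mul_of_nonneg_left (norm_lt_of_mem_ball (hmem 0)).le K.coe_nonneg
  · calc ∑ n ∈ Finset.range N, ‖flowDer ζ ((n + 1 : ℕ) * h)‖ *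
          (K * ‖shift α ((n + 1 : ℕ) * h) z - x₀‖)
        ≤ ∑ n ∈ Finset.range N, ‖flowDer ζ ((n + 1 : ℕ) * h)‖ * (K * ((1 + m) * μ)) :=
          Finset.sum_le_sum fun n _ => by
            have := hb (n + 1)
            gcongr
      _ = (∑ n ∈ Finset.range N, ‖flowDer ζ ((n + 1 : ℕ) * h)‖) * (K * ((1 + m) * μ)) := by
          rw [Finset.sum_mul]
      _ ≤ 2 / ((1 + m) * Real.sinh (h / 2)) * (K * ((1 + m) * μ)) :=
          mul_le_mul_of_nonneg_right (sum_norm_flowDer_le hζ hh N) (by positivity)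
      _ = K * (2 * (μ / Real.sinh (h / 2))) := by
          have : (1 + m) ≠ 0 := by positivity
          field_simp

/-- The series for the complex gradient of a solution. -/
theorem IsNeumannSolution.tendsto_sum (H : IsCoaxal rᵢ rₑ α cᵢ cₑ) (hk : 0 < k)
    (hx₀ : cₑ = x₀ + rₑ) (hg : Continuous fun t : ℝ => g (circleMap rₑ rₑ t))
    (hg0 : ∫ t in (0 : ℝ)..(2 * Real.pi), g (circleMap rₑ rₑ t) = 0)
    (hu : IsNeumannSolution cₑ rₑ cᵢ rᵢ k (fun z => g (z - x₀)) u)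
    (hP : DifferentiableOn ℂ P (ball (cₑ : ℂ) rₑ))
    (hPi : ∀ z ∈ ball (cᵢ : ℂ) rᵢ, HasCGrad u (P z) z)
    (hPe : ∀ z ∈ ball (cₑ : ℂ) rₑ \ closedBall (cᵢ : ℂ) rᵢ,
      HasCGrad u ((P z - tau k * reflGrad cᵢ rᵢ P z) / (1 - tau k)) z)
    (hz : z ∈ ball (cₑ : ℂ) rₑ) :
    Tendsto (fun N : ℕ => ∑ n ∈ Finset.range N, (-(tau k : ℂ)) ^ n *
      (flowDer (z / α) (n * period α cᵢ cₑ) *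
        layerGrad rₑ g (shift α (n * period α cᵢ cₑ) z - x₀))) atTop
      (𝓝 (P z / (1 - tau k))) := by
  have hτ1 : (1 - tau k : ℂ) ≠ 0 := by exact_mod_cast (one_sub_tau_pos hk).ne'
  have hσ : ‖(tau k : ℂ)‖ < 1 := by
    rw [Complex.norm_real, Real.norm_eq_abs]; exact abs_tau_lt_one hk
  have h1 := (tendsto_sum_of_functional_equation H hσ hP.continuousOn
    (fun z hz => hu.functional_equation H hk hx₀ hg hg0 hP hPi hPe hz) hz).div_const
    (1 - tau k : ℂ)
  refine h1.congr fun N => ?_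
  rw [Finset.sum_div]
  refine Finset.sum_congr rfl fun n _ => ?_
  field_simp

end bounds

/-! ### The gradient bound for `k > 1` and the form of the singular function -/

section main

variable {rᵢ rₑ α cᵢ cₑ k x₀ : ℝ} {g u : ℂ → ℝ} {P f : ℂ → ℂ} {z : ℂ}

open IsCoaxal (period)

/-- The interface is a circle, hence a null set, so a pointwise bound off it suffices. -/
theorem eLpNorm_gradient_le {c : ℂ} {r : ℝ} (hr : r ≠ 0) {B : Set ℂ} (hB : MeasurableSet B)
    {v : ℂ → ℝ} {C : ℝ} (hv : ∀ z ∈ B, z ∉ sphere c r → ∃ p, HasCGrad v p z ∧ ‖p‖ ≤ C) :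
    eLpNorm (gradient v) ⊤ (volume.restrict B) ≤ C.toNNReal := by
  rw [eLpNorm_exponent_top]
  refine eLpNormEssSup_le_of_ae_bound ?_
  have h1 : ∀ᵐ z : ℂ, z ∉ sphere c r :=
    measure_eq_zero_iff_ae_notMem.mp (Measure.addHaar_sphere_of_ne_zero volume c hr)
  filter_upwards [ae_restrict_mem hB, ae_restrict_of_ae h1] with z hz hzs
  obtain ⟨p, hp, hpC⟩ := hv z hz hzs
  exact hp.norm_gradient_le.trans hpC

/-- A Lipschitz extension of the gradient to the whole plane has a value at the boundary point `0`,
which is the limit from inside. The price is a dimensional factor in the constant. -/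
theorem exists_layerGrad_limit {R : ℝ} (hR : 0 < R) {δ : ℝ≥0} (hδ : 0 < δ)
    (hg : HolderC1OnCircle (R : ℂ) R δ g) : ∃ (K : ℝ≥0) (M : ℝ) (c₀ : ℂ),
      LipschitzOnWith K (layerGrad R g) (ball (R : ℂ) R) ∧
      Tendsto (layerGrad R g) (𝓝[ball (R : ℂ) R] 0) (𝓝 c₀) ∧
      (∀ x ∈ ball (R : ℂ) R, ‖layerGrad R g x - c₀‖ ≤ K * ‖x‖) ∧
      ∀ x ∈ ball (R : ℂ) R, ‖layerGrad R g x‖ ≤ M := by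
  obtain ⟨K, hK⟩ := exists_lipschitz_layerGrad hR hδ hg
  obtain ⟨F, hF, hFeq⟩ := hK.extend_finite_dimension
  set K' := lipschitzExtensionConstant ℂ * K
  have h1 : ∀ x ∈ ball (R : ℂ) R, ‖layerGrad R g x - F 0‖ ≤ K' * ‖x‖ := fun x hx => by
    rw [hFeq hx]
    simpa using hF.norm_sub_le x 0
  refine ⟨K', ‖F 0‖ + K' * (2 * R), F 0, ?_, ?_, h1, fun x hx => ?_⟩
  · exact fun x hx y hy => by rw [hFeq hx, hFeq hy]; exact hF x y
  · refine ((hF.continuous.tendsto 0).mono_left nhdsWithin_le_nhds).congr' ?_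
    filter_upwards [self_mem_nhdsWithin] with x hx using (hFeq hx).symm
  · have h2 := norm_add_le (F 0) (layerGrad R g x - F 0)
    rw [add_sub_cancel] at h2
    have h3 := mul_le_mul_of_nonneg_left (norm_lt_of_mem_ball hx).le K'.coe_nonneg
    linarith [h1 x hx]

/-- `Y` is compared with the two summands in the gradient of `q`. The first, at `flow z h`, arises
from the series without its initial term; the second, at `z`, is weighted by `s`. -/
theorem norm_sub_flowInt_le (hz : 0 ≤ z.re) {h s b κ A B : ℝ} (hh : 0 < h) (hs0 : 0 < s)
    (hs1 : s < 1) {Y c₀ : ℂ} (hA : ‖Y - c₀ * flowSum z h s‖ ≤ A)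
    (hB : ∀ w : ℂ, 0 ≤ w.re → ‖flowSum w h s - κ * flowInt w b‖ ≤ B) :
    ‖Y - s * κ * c₀ * (flowDer z h * flowInt (flow z h) b)‖ ≤ A + ‖c₀‖ * (1 + B) ∧
      ‖s * (Y - κ * c₀ * flowInt z b)‖ ≤ A + ‖c₀‖ * (1 + B) := by
  have hfl := flow_re_nonneg hz hh.le
  have hB0 : 0 ≤ B := (norm_nonneg _).trans (hB z hz)
  have hns : ‖(s : ℂ)‖ = s := by rw [Complex.norm_real, Real.norm_of_nonneg hs0.le]
  constructor
  · have e : Y - s * κ * c₀ * (flowDer z h * flowInt (flow z h) b) =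
        (Y - c₀ * flowSum z h s) + c₀ * (1 + s * (flowDer z h *
          (flowSum (flow z h) h s - κ * flowInt (flow z h) b))) := by
      rw [flowSum_eq hz hh hs0 hs1]; ring
    rw [e]
    refine (norm_add_le _ _).trans (add_le_add hA ?_)
    rw [norm_mul]
    refine mul_le_mul_of_nonneg_left ((norm_add_le _ _).trans ?_) (norm_nonneg _)
    rw [norm_one, norm_mul, norm_mul, hns]
    have h1 := hB _ hfl
    have h2 := mul_le_of_le_one_left (norm_nonneg (flowSum (flow z h) h s - κ * flowInt (flow z h) b))
      (norm_flowDer_le_one hz hh.le)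
    have h3 := mul_le_of_le_one_left (mul_nonneg (norm_nonneg (flowDer z h))
      (norm_nonneg (flowSum (flow z h) h s - κ * flowInt (flow z h) b))) hs1.le
    linarith
  · have e : Y - κ * c₀ * flowInt z b =
        (Y - c₀ * flowSum z h s) + c₀ * (flowSum z h s - κ * flowInt z b) := by ring
    rw [norm_mul, hns]
    refine (mul_le_of_le_one_left (norm_nonneg _) hs1.le).trans ?_
    rw [e]
    refine (norm_add_le _ _).trans (add_le_add hA ?_)
    rw [norm_mul]
    exact mul_le_mul_of_nonneg_left (by linarith [hB z hz]) (norm_nonneg _)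

theorem mem_of_notMem_sphere (hz : z ∈ ball (cₑ : ℂ) rₑ)
    (hzs : z ∉ sphere (cᵢ : ℂ) rᵢ) :
    z ∈ ball (cᵢ : ℂ) rᵢ ∨ z ∈ ball (cₑ : ℂ) rₑ \ closedBall (cᵢ : ℂ) rᵢ := by
  by_cases h : z ∈ closedBall (cᵢ : ℂ) rᵢ
  · rw [← ball_union_sphere] at h
    exact .inl (h.resolve_right hzs)
  · exact .inr ⟨hz, h⟩

/-- The gradient bound for `k > 1`. -/
theorem IsNeumannSolution.exists_hasCGrad_of_one_lt (H : IsCoaxal rᵢ rₑ α cᵢ cₑ) (hk : 1 < k)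
    (hx₀ : cₑ = x₀ + rₑ) (hg : Continuous fun t : ℝ => g (circleMap rₑ rₑ t))
    (hg0 : ∫ t in (0 : ℝ)..(2 * Real.pi), g (circleMap rₑ rₑ t) = 0)
    (hu : IsNeumannSolution cₑ rₑ cᵢ rᵢ k (fun z => g (z - x₀)) u) {K : ℝ≥0} {M : ℝ}
    (hf : LipschitzOnWith K (layerGrad rₑ g) (ball (rₑ : ℂ) rₑ))
    (hM : ∀ x ∈ ball (rₑ : ℂ) rₑ, ‖layerGrad rₑ g x‖ ≤ M) (hz : z ∈ ball (cₑ : ℂ) rₑ)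
    (hzs : z ∉ sphere (cᵢ : ℂ) rᵢ) :
    ∃ p, HasCGrad u p z ∧ ‖p‖ ≤ 2 * (2 * M + (4 * M + 4 * rₑ * K)) := by
  have hk0 : 0 < k := by linarith
  obtain ⟨P, hP, hPi, hPe⟩ := hu.exists_holomorphic H hk0
  have hτ0 : 0 ≤ tau k := div_nonneg (by linarith) (by linarith)
  have hτ1 : tau k < 1 := (abs_lt.mp (abs_tau_lt_one hk0)).2
  have hτp := one_sub_tau_pos hk0
  set τ := tau k
  set C := 2 * M + (4 * M + 4 * rₑ * K)
  have hn : ‖(1 - τ : ℂ)‖ = 1 - τ := by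
    rw [← Complex.ofReal_one, ← Complex.ofReal_sub, Complex.norm_real, Real.norm_of_nonneg hτp.le]
  -- The factor `1 - τ` is kept: it compensates the division by `1 - τ` outside `Bᵢ`, which would
  -- otherwise be unbounded as `k → ∞`.
  have hPC : ∀ y ∈ ball (cₑ : ℂ) rₑ, ‖P y‖ ≤ (1 - τ) * C := fun y hy => by
    have h1 := norm_le_of_tendsto_alternating H hx₀ hf hM hτ0 hτ1.le hy
      (hu.tendsto_sum H hk0 hx₀ hg hg0 hP hPi hPe hy)
    rwa [norm_div, hn, div_le_iff₀ hτp, mul_comm] at h1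
  have hC0 : 0 ≤ C := by
    have := (norm_nonneg _).trans (hPC z hz)
    exact nonneg_of_mul_nonneg_right this hτp
  rcases mem_of_notMem_sphere hz hzs with hzi | hze
  · refine ⟨P z, hPi z hzi, (hPC z hz).trans ?_⟩
    nlinarith
  · refine ⟨_, hPe z hze, ?_⟩
    rw [norm_div, hn, div_le_iff₀ hτp]
    have h1 := (norm_reflGrad_le (p := P) H.ri_pos hze.2).trans
      (hPC _ (H.closedBall_subset (ball_subset_closedBall (refl_mem_ball H.ri_pos hze.2))))
    have h2 := norm_sub_le (P z) (τ * reflGrad cᵢ rᵢ P z)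
    rw [norm_mul, Complex.norm_real, Real.norm_of_nonneg hτ0] at h2
    have h3 := mul_le_of_le_one_left (norm_nonneg (reflGrad cᵢ rᵢ P z)) hτ1.le
    linarith [hPC z hz]

/-- The singular part of the solution for `k < 1`. -/
theorem q_eq {ε β : ℝ} (H : IsCoaxal rᵢ rₑ (alpha rᵢ rₑ ε) (cInt rᵢ rₑ ε) (cExt rᵢ rₑ ε)) :
    (∀ z ∈ closedBall (cInt rᵢ rₑ ε : ℂ) rᵢ, q rᵢ rₑ ε β z =
      -lerch (Real.exp (-period (alpha rᵢ rₑ ε) (cInt rᵢ rₑ ε) (cExt rᵢ rₑ ε)) *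
        expNegXi (alpha rᵢ rₑ ε) z) β -
      lerch (Real.exp (-0) * expNegXi (alpha rᵢ rₑ ε) z) β) ∧
    ∀ z ∈ ball (cExt rᵢ rₑ ε : ℂ) rₑ \ closedBall (cInt rᵢ rₑ ε : ℂ) rᵢ, q rᵢ rₑ ε β z =
      -lerch (Real.exp (-period (alpha rᵢ rₑ ε) (cInt rᵢ rₑ ε) (cExt rᵢ rₑ ε)) *
        expNegXi (alpha rᵢ rₑ ε) z) β -
      lerch (Real.exp (-0) * expNegXi (alpha rᵢ rₑ ε) (refl (cInt rᵢ rₑ ε) rᵢ z)) β := by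
  have hcl : closure (BInt rᵢ rₑ ε) = closedBall (cInt rᵢ rₑ ε : ℂ) rᵢ :=
    closure_ball _ H.ri_pos.ne'
  have hper : -2 * (xiInt rᵢ rₑ ε - xiExt rᵢ rₑ ε) =
      -period (alpha rᵢ rₑ ε) (cInt rᵢ rₑ ε) (cExt rᵢ rₑ ε) := by
    rw [xiInt_eq, xiExt_eq, period]; ring
  -- `exp (-0)` presents the second summand as the case of zero shift of
  -- `hasDerivAt_lerch_expNegXi`.
  have h0 : (Real.exp (-0) : ℂ) = 1 := by simp
  refine ⟨fun z hz => ?_, fun z hz => ?_⟩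
  · have h1 : z ∉ BExt rᵢ rₑ ε \ closure (BInt rᵢ rₑ ε) := fun h => h.2 (hcl ▸ hz)
    simp only [q, if_neg h1, hper, h0, one_mul]
  · have h1 : z ∈ BExt rᵢ rₑ ε \ closure (BInt rᵢ rₑ ε) := by rw [hcl]; exact hz
    have h2 := expNegXi_refl H.alpha_pos H.ri_pos H.ci_pos H.ci_sq
      (ne_center_of_notMem_closedBall H.ri_pos hz.2)
      (fun h => hz.2 (ball_subset_closedBall (h ▸ pole_mem_ball H.alpha_pos H.ri_pos H.ci_pos H.ci_sq)))
    rw [← xiInt_eq] at h2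
    simp only [q, if_pos h1, hper, h0, one_mul, h2]

end main

/-! ### Subtraction of the singular part for `k < 1` -/

section remainder

variable {rᵢ rₑ ε k : ℝ} {g u : ℂ → ℝ}

open IsCoaxal (period)

/-- The remainder estimate for `k < 1`. -/
theorem IsNeumannSolution.remainder_of_lt_one (hri : 0 < rᵢ) (hr : rᵢ < rₑ) (hε : 0 < ε)
    (hεr : ε < rₑ - rᵢ) (hk0 : 0 < k) (hk1 : k < 1)
    (hg : Continuous fun t : ℝ => g (circleMap rₑ rₑ t))
    (hg0 : ∫ t in (0 : ℝ)..(2 * Real.pi), g (circleMap rₑ rₑ t) = 0)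
    (hu : IsNeumannSolution (cExt rᵢ rₑ ε : ℂ) rₑ (cInt rᵢ rₑ ε : ℂ) rᵢ k
      (fun z => g (z - (xShift rᵢ rₑ ε : ℂ))) u) {K : ℝ≥0} {c₀ : ℂ}
    (hc₀ : ∀ x ∈ ball (rₑ : ℂ) rₑ, ‖layerGrad rₑ g x - c₀‖ ≤ K * ‖x‖) {α h h' C : ℝ}
    (hα : α = alpha rᵢ rₑ ε)
    (hh : h = period (alpha rᵢ rₑ ε) (cInt rᵢ rₑ ε) (cExt rᵢ rₑ ε))
    (hh' : h' = 4 * Real.sqrt ε / rStar rᵢ rₑ)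
    (hC1 : min (2 * rₑ) (2 * α) / Real.sinh (h / 2) ≤ C)
    (hC2 : |1 / h - rStar rᵢ rₑ ^ 2 / (4 * α)| ≤ C) (hC3 : |1 / h - 1 / h'| ≤ C)
    (hC4 : h' / h ≤ C) :
    ∃ r : ℂ → ℝ,
      (∀ z ∈ BExt rᵢ rₑ ε, u z = rStar rᵢ rₑ ^ 2 * tau k / 2 *
        (c₀.re * (q rᵢ rₑ ε (beta rᵢ rₑ ε k) z).re +
          -c₀.im * (q rᵢ rₑ ε (beta rᵢ rₑ ε k) z).im) + r z) ∧
      ContinuousOn r (BExt rᵢ rₑ ε) ∧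
      ∀ z ∈ BExt rᵢ rₑ ε, z ∉ sphere (cInt rᵢ rₑ ε : ℂ) rᵢ → ∃ p, HasCGrad r p z ∧
        ‖p‖ ≤ 2 * (K * (2 * rₑ + 2 * C) + ‖c₀‖ * (1 + (5 + 4 * (C * (1 + C) + C)))) := by
  have H := isCoaxal hri hr hε hεr
  have hqi := fun β => (q_eq (β := β) H).1
  have hqe := fun β => (q_eq (β := β) H).2
  have hx₀ := cExt_eq rᵢ rₑ ε
  rw [← hα] at H hqi hqe hh
  rw [← hh] at hqi hqe
  obtain ⟨P, hP, hPi, hPe⟩ := hu.exists_holomorphic H hk0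
  set cᵢ := cInt rᵢ rₑ ε
  set cₑ := cExt rᵢ rₑ ε
  set x₀ := xShift rᵢ rₑ ε
  have hsum := fun z hz => hu.tendsto_sum H hk0 hx₀ hg hg0 hP hPi hPe (z := z) hz
  have hα0 := H.alpha_pos
  have hh0 : 0 < h := hh ▸ H.period_pos
  have hre0 : 0 < rₑ := H.re_pos
  set ρ := rStar rᵢ rₑ with hρ
  have hρ0 : 0 < ρ := Real.sqrt_pos.mpr (div_pos (by positivity) (by linarith))
  have hh'0 : 0 < h' := by rw [hh']; positivity
  set s := -tau k with hs
  have hs0 : 0 < s := neg_pos.mpr (div_neg_of_neg_of_pos (by linarith) (by linarith))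
  have hs1 : s < 1 := by linarith [(abs_lt.mp (abs_tau_lt_one hk0)).1]
  have hτ : tau k = -s := by rw [hs, neg_neg]
  set β := beta rᵢ rₑ ε k with hβdef
  have hβ : β = -Real.log s / h' := by
    rw [hβdef, beta, ← hρ, hτ, abs_neg, abs_of_pos hs0, hh']
    field_simp
  have hβ0 : 0 ≤ β := by
    rw [hβ]; exact div_nonneg (neg_nonneg.mpr (Real.log_nonpos hs0.le hs1.le)) hh'0.le
  simp only [hτ] at hPe hsum ⊢
  rw [← hh] at hsum
  have hs' : (1 + s : ℂ) ≠ 0 := by exact_mod_cast (by linarith : (1 + s : ℝ) ≠ 0)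
  set κ := ρ ^ 2 / (4 * α) with hκ
  set Y : ℂ → ℂ := fun z => P z / (1 + s) with hY
  set B := 5 + 4 * (C * (1 + C) + C) with hBdef
  have hC0 : 0 ≤ C := (abs_nonneg _).trans hC2
  have hB : ∀ w : ℂ, 0 ≤ w.re → ‖flowSum w h s - κ * flowInt w β‖ ≤ B := fun w hw => by
    refine (hβ ▸ norm_flowSum_sub_le hw hh0 hs0 hs1 hh'0 (κ := κ)).trans ?_
    have h1 : |1 / h - 1 / h'| * (1 + h' / h) ≤ C * (1 + C) := by
      have : 0 < h' / h := by positivity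
      gcongr
    linarith
  set A := K * (2 * rₑ + 2 * C) with hAdef
  set G := A + ‖c₀‖ * (1 + B) with hG
  set E₁ : ℂ → ℂ := fun z => Y z - s * κ * c₀ * (flowDer (z / α) h * flowInt (flow (z / α) h) β)
    with hE₁
  set E₂ : ℂ → ℂ := fun z => s * (Y z - κ * c₀ * flowInt (z / α) β) with hE₂
  have hE : ∀ z ∈ ball (cₑ : ℂ) rₑ, ‖E₁ z‖ ≤ G ∧ ‖E₂ z‖ ≤ G := by
    intro z hz
    have hz' := (div_re_pos hα0 (H.re_pos_of_mem hz)).le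
    refine norm_sub_flowInt_le hz' hh0 hs0 hs1 ?_ hB
    have h1 := hsum z hz
    push_cast at h1
    rw [neg_neg, sub_neg_eq_add] at h1
    subst hh
    refine (norm_sub_flowSum_le_of_tendsto H hx₀ hc₀ hs0 hs1 hz h1).trans ?_
    rw [hAdef]
    gcongr
  -- `-a` is the prefactor `r_*² τ / 2` of the singular part. Times the `1/(2α)` from the derivative
  -- of `L` it matches the leading coefficient `s κ` of the series.
  set a := ρ ^ 2 * s / 2 with ha
  have haκ : a * (1 / (2 * α)) = s * κ := by rw [ha, hκ]; field_simp; ring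
  have haκ' : (a : ℂ) * (1 / (2 * α)) = s * κ := by exact_mod_cast haκ
  set J : ℝ → ℂ → ℝ := fun t z => a * (c₀ * -lerch (Real.exp (-t) * expNegXi α z) β).re with hJ
  have hJd : ∀ t, 0 ≤ t → ∀ z : ℂ, 0 < z.re → HasCGrad (J t)
      (-(s * κ * c₀ * (flowDer (z / α) t * flowInt (flow (z / α) t) β))) z := by
    intro t ht z hz
    have h1 := (hasCGrad_re ((hasDerivAt_lerch_expNegXi hα0 hβ0 ht hz).neg.const_mul c₀)).const_mul a
    convert h1.congr (v := J t) (.of_forall fun x => rfl) using 1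
    rw [← haκ']; ring
  obtain ⟨fold, hfc, hf1, hf2, hf3⟩ := exists_continuous_fold (c := cᵢ) hri
  -- The two summands of `q` become `J h` and `J 0 ∘ fold`: outside `Bᵢ` the second is evaluated at
  -- the reflected point, which also gives continuity across the interface.
  set r : ℂ → ℝ := fun z => u z + (J h z + J 0 (fold z)) with hrdef
  have hsub := H.closedBall_subset
  have hJc : ∀ t, 0 ≤ t → ContinuousOn (J t) (ball (cₑ : ℂ) rₑ) := fun t ht z hz =>
    (hJd t ht z (H.re_pos_of_mem hz)).differentiableAt.continuousAt.continuousWithinAt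
  refine ⟨r, fun z hz => ?_, ?_, fun z hz hzs => ?_⟩
  · have hqz : q rᵢ rₑ ε β z = -lerch (Real.exp (-h) * expNegXi α z) β -
        lerch (Real.exp (-0) * expNegXi α (fold z)) β := by
      by_cases hzi : z ∈ closedBall (cᵢ : ℂ) rᵢ
      · rw [hf1 z hzi]; exact hqi β z hzi
      · rw [hf2 z hzi]; exact hqe β z ⟨hz, hzi⟩
    rw [hqz]
    simp only [hrdef, hJ, ha, Complex.mul_re, Complex.sub_re, Complex.sub_im, Complex.neg_re,
      Complex.neg_im]
    ring
  · exact hu.continuous.add ((hJc h hh0.le).add ((hJc 0 le_rfl).comp hfc.continuousOn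
      fun z _ => hsub (hf3 z)))
  · have hzre := H.re_pos_of_mem hz
    have hfl0 : ∀ w : ℂ, flowDer w 0 = 1 ∧ flow w 0 = w := fun w => by
      simp [flowDer, flow, flowDen]
    have hPY : ∀ z, P z = (1 + s) * Y z := fun z => by
      simp only [hY]; field_simp
    rcases mem_of_notMem_sphere hz hzs with hzi | hze
    · have h1 := (hPi z hzi).add ((hJd h hh0.le z hzre).add (hJd 0 le_rfl z hzre))
      refine ⟨E₁ z + E₂ z, ?_, ?_⟩
      · have e : E₁ z + E₂ z =
            P z + (-(s * κ * c₀ * (flowDer (z / α) h * flowInt (flow (z / α) h) β)) +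
              -(s * κ * c₀ * (flowDer (z / α) 0 * flowInt (flow (z / α) 0) β))) := by
          rw [(hfl0 _).1, (hfl0 _).2, hPY]
          simp only [hE₁, hE₂]
          ring
        rw [e]
        refine h1.congr (eventually_of_mem (isOpen_ball.mem_nhds hzi) fun y hy => ?_)
        simp only [hrdef, hf1 y (ball_subset_closedBall hy)]
      · linarith [norm_add_le (E₁ z) (E₂ z), hE z hz]
    · have hzR := refl_mem_ball hri hze.2
      have hzR' := hsub (ball_subset_closedBall hzR)
      have hzc := ne_center_of_notMem_closedBall hri hze.2
      set V : ℂ → ℂ := fun w =>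
        -(s * κ * c₀ * (flowDer (w / α) 0 * flowInt (flow (w / α) 0) β)) with hV
      have h0 : HasCGrad (fun x => J 0 (refl cᵢ rᵢ x)) (reflGrad cᵢ rᵢ V z) z :=
        HasCGrad.comp_refl (hJd 0 le_rfl _ (H.re_pos_of_mem hzR')) hzc
      have h1 := (hPe z hze).add ((hJd h hh0.le z hzre).add h0)
      -- Outside, the gradient of `u` is `Y + s · reflGrad Y`. The first term is paired with the
      -- summand shifted by a period, the second with the reflected summand; reflection from outside
      -- does not increase the norm.
      refine ⟨E₁ z + reflGrad cᵢ rᵢ E₂ z, ?_, ?_⟩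
      · have e : E₁ z + reflGrad cᵢ rᵢ E₂ z =
            (P z - (-s : ℝ) * reflGrad cᵢ rᵢ P z) / (1 - (-s : ℝ)) +
            (-(s * κ * c₀ * (flowDer (z / α) h * flowInt (flow (z / α) h) β)) +
              reflGrad cᵢ rᵢ V z) := by
          have e1 : reflGrad cᵢ rᵢ P z = (1 + s) * reflGrad cᵢ rᵢ Y z := by
            simp only [reflGrad, hPY, map_mul, map_add, map_one, Complex.conj_ofReal]
            ring
          have e2 : reflGrad cᵢ rᵢ E₂ z = s * reflGrad cᵢ rᵢ Y z + reflGrad cᵢ rᵢ V z := by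
            simp only [reflGrad, hE₂, hV, (hfl0 _).1, (hfl0 _).2, map_mul, map_sub, map_neg,
              map_one, Complex.conj_ofReal]
            ring
          rw [e1, e2, hPY]
          simp only [hE₁]
          push_cast
          rw [sub_neg_eq_add]
          field_simp
          ring
        rw [e]
        have hAo : IsOpen (ball (cₑ : ℂ) rₑ \ closedBall (cᵢ : ℂ) rᵢ) :=
          isOpen_ball.sdiff isClosed_closedBall
        refine h1.congr (eventually_of_mem (hAo.mem_nhds hze) fun y hy => ?_)
        simp only [hrdef, hf2 y hy.2]
      · have h2 := (norm_reflGrad_le (p := E₂) hri hze.2).trans (hE _ hzR').2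
        linarith [norm_add_le (E₁ z) (reflGrad cᵢ rᵢ E₂ z), hE z hz]

end remainder

end Inclusion

end

/-! ### The main theorem -/

theorem mainTheorem7 (rᵢ rₑ : ℝ) (hrᵢ : 0 < rᵢ) (hr : rᵢ < rₑ) (δ : ℝ≥0) (hδ : 1 / 2 < δ)
    (g : ℂ → ℝ) (hg : Inclusion.HolderC1OnCircle (rₑ : ℂ) rₑ δ g)
    (hg0 : ∫ t in (0 : ℝ)..(2 * Real.pi), g (circleMap (rₑ : ℂ) rₑ t) = 0) :
    ∃ C₁ C₂ : ℝ,
      Tendsto (fun x : ℂ => fderiv ℝ (Inclusion.H rₑ g) x 1) (𝓝[ball (rₑ : ℂ) rₑ] 0) (𝓝 C₁) ∧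
      Tendsto (fun x : ℂ => fderiv ℝ (Inclusion.H rₑ g) x Complex.I)
        (𝓝[ball (rₑ : ℂ) rₑ] 0) (𝓝 C₂) ∧
      ∃ C : ℝ≥0, ∀ ε k : ℝ, 0 < ε → ε < rₑ - rᵢ → 0 < k → ∀ u : ℂ → ℝ,
        Inclusion.IsNeumannSolution (Inclusion.cExt rᵢ rₑ ε : ℂ) rₑ
          (Inclusion.cInt rᵢ rₑ ε : ℂ) rᵢ k
          (fun z => g (z - (Inclusion.xShift rᵢ rₑ ε : ℂ))) u →
        (1 < k →
          eLpNorm (gradient u) ⊤ (volume.restrict (Inclusion.BExt rᵢ rₑ ε)) ≤ C) ∧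
        (k < 1 →
          ∃ r : ℂ → ℝ,
            (∀ z ∈ Inclusion.BExt rᵢ rₑ ε,
              u z = Inclusion.rStar rᵢ rₑ ^ 2 * Inclusion.tau k / 2 *
                  (C₁ * (Inclusion.q rᵢ rₑ ε (Inclusion.beta rᵢ rₑ ε k) z).re +
                    C₂ * (Inclusion.q rᵢ rₑ ε (Inclusion.beta rᵢ rₑ ε k) z).im) + r z) ∧
            ContinuousOn r (Inclusion.BExt rᵢ rₑ ε) ∧
            DifferentiableOn ℝ r (Inclusion.BInt rᵢ rₑ ε ∪
              (Inclusion.BExt rᵢ rₑ ε \ closure (Inclusion.BInt rᵢ rₑ ε))) ∧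
            eLpNorm (gradient r) ⊤ (volume.restrict (Inclusion.BExt rᵢ rₑ ε)) ≤ C) := by
  have hre : 0 < rₑ := hrᵢ.trans hr
  have hgc : Continuous fun t : ℝ => g (circleMap rₑ rₑ t) := hg.1.continuous
  obtain ⟨K, M, c₀, hf, hlim, hc₀, hM⟩ :=
    Inclusion.exists_layerGrad_limit hre ((by positivity : (0 : ℝ≥0) ≤ 1 / 2).trans_lt hδ) hg
  obtain ⟨C, -, hC⟩ := Inclusion.exists_uniform_bounds hrᵢ hr
  set Ca := 2 * (2 * M + (4 * M + 4 * rₑ * K))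
  set Cb := 2 * (K * (2 * rₑ + 2 * C) + ‖c₀‖ * (1 + (5 + 4 * (C * (1 + C) + C))))
  -- The complex gradient is `∂₁H - i ∂₂H`, hence the sign in `C₂`; correspondingly `C₁ Re q + C₂ Im
  -- q = Re (c₀ q)`.
  refine ⟨c₀.re, -c₀.im, ?_, ?_, max Ca.toNNReal Cb.toNNReal,
    fun ε k hε hεr hk0 u hu => ⟨fun hk => ?_, fun hk => ?_⟩⟩
  · refine ((Complex.continuous_re.tendsto c₀).comp hlim).congr' ?_
    filter_upwards [self_mem_nhdsWithin] with x hx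
    rw [(Inclusion.hasCGrad_H hre hgc hx).fderiv_apply, mul_one, Function.comp]
  · refine ((Complex.continuous_im.tendsto c₀).comp hlim).neg.congr' ?_
    filter_upwards [self_mem_nhdsWithin] with x hx
    rw [(Inclusion.hasCGrad_H hre hgc hx).fderiv_apply, Complex.mul_I_re, Function.comp]
  · have H := Inclusion.isCoaxal hrᵢ hr hε hεr
    refine (Inclusion.eLpNorm_gradient_le hrᵢ.ne' measurableSet_ball fun z hz hzs =>
      hu.exists_hasCGrad_of_one_lt H hk (Inclusion.cExt_eq rᵢ rₑ ε) hgc hg0 hf hM hz hzs).trans ?_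
    exact_mod_cast le_max_left _ _
  · obtain ⟨h1, h2, h3, h4⟩ := hC ε hε hεr _ _ _ rfl rfl rfl
    obtain ⟨r, hr1, hr2, hr3⟩ := hu.remainder_of_lt_one hrᵢ hr hε hεr hk0 hk hgc hg0 hc₀
      rfl rfl rfl h1 h2 h3 h4
    refine ⟨r, hr1, hr2, ?_, ?_⟩
    · rintro z hz
      have hcl : closure (Inclusion.BInt rᵢ rₑ ε) = closedBall (Inclusion.cInt rᵢ rₑ ε : ℂ) rᵢ :=
        closure_ball _ hrᵢ.ne'
      have hsub := (Inclusion.isCoaxal hrᵢ hr hε hεr).closedBall_subset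
      have h5 : z ∈ Inclusion.BExt rᵢ rₑ ε ∧ z ∉ sphere (Inclusion.cInt rᵢ rₑ ε : ℂ) rᵢ := by
        rcases hz with hz | hz
        · exact ⟨hsub (ball_subset_closedBall hz), fun h => (mem_ball.mp hz).ne (mem_sphere.mp h)⟩
        · exact ⟨hz.1, fun h => hz.2 (hcl ▸ sphere_subset_closedBall h)⟩
      obtain ⟨p, hp, -⟩ := hr3 z h5.1 h5.2
      exact hp.differentiableAt.differentiableWithinAt
    · refine (Inclusion.eLpNorm_gradient_le hrᵢ.ne' measurableSet_ball fun z hz hzs =>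
        hr3 z hz hzs).trans ?_
      exact_mod_cast le_max_right _ _
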